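/- **Notation.** $BD=S^1_A\cup S^1_B\subset SU(2)\subset\mathbb H$ is the binary dihedral group, with $S^1_A=\{e^{I\theta}\}$ and $S^1_B=\{Je^{I\theta}\}$. Let $L\subset\mathbb R^3\subset S^3=\mathbb R^3\cup\{\infty\}$ be a (polygonal) link and let $\omega\subset\mathbb R^3$ be either empty or an embedded (polygonal) arc that meets $L$ exactly in its two endpoints. Put $$R_B(L,\omega)=\{\rho:\pi_1(S^3\setminus(L\cup\omega))\to BD \;:\; \rho(\mu)\in S^1_B \text{ for every meridian } \mu \text{ of every component of } L,\ \rho(\mu)=-1 \text{ for every meridian } \mu \text{ of } \omega\}/\text{conjugation}.$$ Assume that $L\cup\omega$ is in general position with respect to the vertical projection $\mathbb R^3\to\mathbb R^2$ (the only multiple points are double points, and no vertex of $L$ or $\omega$, in particular no endpoint of $\omega$, projects to a double point). An arc of the diagram of $L$ is a maximal piece of a component that does not pass under $L$. Let $a_1,\dots,a_n$ be the arcs, and let $M$ be the integer $n\times n$ matrix whose $k$-th row belongs to the crossing at the end of $a_k$ (for a chosen direction on each component): it has a $1$ for each of the two arcs that end at this crossing, a $-2$ for the arc passing over it (entries add up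 if arcs coincide), and $0$ elsewhere; if $a_k$ is a whole component, passing under nothing, the $k$-th row is $0$. The determinant of $L$ is $\det(L)=|\det M_-|$, where $M_-$ is obtained from $M$ by deleting the row and the column with the same (arbitrary) index. **Theorem.** Let $L$ be a two-component link and let $\omega$ be an arc joining the two components of $L$, with $L\cup\omega$ in general position as above. If $\det(L)=0$, then $R_B(L,\omega)=\emptyset$, whereas $R_B(L,\emptyset)\neq\emptyset$. -/

import Mathlib

noncomputable section

namespace MarkedLink

/-! ### The binary dihedral group -/

/-- The unit quaternion `e ^ (I θ)`. -/
def expI (θ : ℝ) : Quaternion ℝ := ⟨Real.cos θ, Real.sin θ, 0, 0⟩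

/-- The quaternion `J`. -/
def quatJ : Quaternion ℝ := ⟨0, 0, 1, 0⟩

/-- The circle `S¹_A = {e ^ (I θ)}`. -/
def circleA : Set (Quaternion ℝ)ˣ := {q | ∃ θ : ℝ, (q : Quaternion ℝ) = expI θ}

/-- The circle `S¹_B = {J e ^ (I θ)}`. -/
def circleB : Set (Quaternion ℝ)ˣ := {q | ∃ θ : ℝ, (q : Quaternion ℝ) = quatJ * expI θ}

lemma expI_re (a : ℝ) : (expI a).re = Real.cos a := rfl
lemma expI_imI (a : ℝ) : (expI a).imI = Real.sin a := rfl
lemma expI_imJ (a : ℝ) : (expI a).imJ = 0 := rfl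
lemma expI_imK (a : ℝ) : (expI a).imK = 0 := rfl
lemma quatJ_re : quatJ.re = 0 := rfl
lemma quatJ_imI : quatJ.imI = 0 := rfl
lemma quatJ_imJ : quatJ.imJ = 1 := rfl
lemma quatJ_imK : quatJ.imK = 0 := rfl

lemma expI_mul (a b : ℝ) : expI a * expI b = expI (a + b) := by
  apply Quaternion.ext <;>
    simp [expI_re, expI_imI, expI_imJ, expI_imK, Real.cos_add, Real.sin_add, add_comm]

lemma expI_mul_J (a : ℝ) : expI a * quatJ = quatJ * expI (-a) := by
  apply Quaternion.ext <;>
    simp [expI_re, expI_imI, expI_imJ, expI_imK, quatJ_re, quatJ_imI, quatJ_imJ, quatJ_imK]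

lemma quatJ_mul_self : quatJ * quatJ = expI Real.pi := by
  apply Quaternion.ext <;>
    simp [expI_re, expI_imI, expI_imJ, expI_imK, quatJ_re, quatJ_imI, quatJ_imJ, quatJ_imK]

lemma expI_zero : expI 0 = 1 := by
  apply Quaternion.ext <;> simp [expI_re, expI_imI, expI_imJ, expI_imK,
    Quaternion.re_one, Quaternion.imI_one, Quaternion.imJ_one, Quaternion.imK_one]

lemma expI_two_pi : expI (2 * Real.pi) = 1 := by
  apply Quaternion.ext <;> simp [expI_re, expI_imI, expI_imJ, expI_imK,
    Quaternion.re_one, Quaternion.imI_one, Quaternion.imJ_one, Quaternion.imK_one]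

/-- The binary dihedral group `BD = S¹_A ∪ S¹_B`, a subgroup of the nonzero quaternions. -/
def BD : Subgroup (Quaternion ℝ)ˣ where
  carrier := circleA ∪ circleB
  one_mem' := Or.inl ⟨0, by simp [expI_zero]⟩
  mul_mem' := by
    rintro p q (⟨a, ha⟩ | ⟨a, ha⟩) (⟨b, hb⟩ | ⟨b, hb⟩)
    · exact Or.inl ⟨a + b, by rw [Units.val_mul, ha, hb, expI_mul]⟩
    · exact Or.inr ⟨-a + b, by
        rw [Units.val_mul, ha, hb, ← mul_assoc, expI_mul_J, mul_assoc, expI_mul]⟩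
    · exact Or.inr ⟨a + b, by rw [Units.val_mul, ha, hb, mul_assoc, expI_mul]⟩
    · exact Or.inl ⟨Real.pi + (-a + b), by
        rw [Units.val_mul, ha, hb, mul_assoc, ← mul_assoc (expI a), expI_mul_J, mul_assoc,
          expI_mul, ← mul_assoc, quatJ_mul_self, expI_mul]⟩
  inv_mem' := by
    rintro p (⟨a, ha⟩ | ⟨a, ha⟩)
    · refine Or.inl ⟨-a, ?_⟩
      refine Units.inv_eq_of_mul_eq_one_right ?_
      rw [ha, expI_mul, add_neg_cancel, expI_zero]
    · refine Or.inr ⟨a + Real.pi, ?_⟩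
      refine Units.inv_eq_of_mul_eq_one_right ?_
      rw [ha, mul_assoc, ← mul_assoc (expI a), expI_mul_J, mul_assoc, expI_mul, ← mul_assoc,
        quatJ_mul_self, expI_mul, show Real.pi + (-a + (a + Real.pi)) = 2 * Real.pi by ring,
        expI_two_pi]

/-! ### Polygonal links and arcs in the three-sphere -/

/-- Euclidean three-space. -/
abbrev E3 : Type := EuclideanSpace ℝ (Fin 3)

/-- The three-sphere, as the one-point compactification `ℝ³ ∪ {∞}`. -/
abbrev S3 : Type := OnePoint E3

/-- A set of edges is a set of pairs of endpoints; its support is the union of the segments. -/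
def support (S : Set (E3 × E3)) : Set E3 := ⋃ e ∈ S, segment ℝ e.1 e.2

/-- A polygonal link in `ℝ³ ⊂ S³` with `m` components: component `i` is a closed polygon with
cyclically ordered vertices `vertex i j`, `j ∈ ℤ / len i`. The closed polygons are traversed by
the `len i`-periodic curves `s ↦ vertex i ⌊s⌋ + (s - ⌊s⌋) (vertex i (⌊s⌋ + 1) - vertex i ⌊s⌋)`,
which are required to be simple and pairwise disjoint. -/
structure PolygonalLink (m : ℕ) where
  len : Fin m → ℕ
  [len_neZero : ∀ i, NeZero (len i)]
  vertex : (i : Fin m) → ZMod (len i) → E3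
  embedded : ∀ (i j : Fin m) (s t : ℝ),
    AffineMap.lineMap (vertex i (⌊s⌋ : ℤ)) (vertex i ((⌊s⌋ : ℤ) + 1)) (Int.fract s) =
      (AffineMap.lineMap (vertex j (⌊t⌋ : ℤ)) (vertex j ((⌊t⌋ : ℤ) + 1)) (Int.fract t) : E3) →
    i = j ∧ ∃ k : ℤ, s = t + k * len i

attribute [instance] PolygonalLink.len_neZero

namespace PolygonalLink

variable {m : ℕ} (L : PolygonalLink m)

/-- The periodic parametrization of component `i`, with period `L.len i`. -/
def curve (i : Fin m) (s : ℝ) : E3 :=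
  AffineMap.lineMap (L.vertex i (⌊s⌋ : ℤ)) (L.vertex i ((⌊s⌋ : ℤ) + 1)) (Int.fract s)

/-- The edges of component `i`. -/
def edges (i : Fin m) : Set (E3 × E3) := Set.range fun j => (L.vertex i j, L.vertex i (j + 1))

/-- The underlying set of the link. -/
def carrier : Set E3 := ⋃ i, support (L.edges i)

end PolygonalLink

/-- An embedded polygonal arc in `ℝ³` with vertices `vertex 0, …, vertex len`
(the later values of `vertex` play no role). -/
structure PolygonalArc where
  len : ℕ
  len_pos : 0 < len
  vertex : ℕ → E3
  embedded : Set.InjOn (fun s : ℝ =>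
    (AffineMap.lineMap (vertex ⌊s⌋₊) (vertex (⌊s⌋₊ + 1)) (Int.fract s) : E3)) (Set.Icc 0 len)

namespace PolygonalArc

variable (ω : PolygonalArc)

/-- The edges of the arc. -/
def edges : Set (E3 × E3) := {e | ∃ k < ω.len, e = (ω.vertex k, ω.vertex (k + 1))}

/-- The arc `ω` goes from component `i` to component `j` of `L`, and meets `L` only in its two
endpoints. -/
def Joins {m : ℕ} (L : PolygonalLink m) (i j : Fin m) : Prop :=
  ω.vertex 0 ∈ support (L.edges i) ∧ ω.vertex ω.len ∈ support (L.edges j) ∧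
    ∀ x ∈ support ω.edges, x ∈ L.carrier → x = ω.vertex 0 ∨ x = ω.vertex ω.len

end PolygonalArc

/-! ### Fundamental group, meridians and representations -/

/-- The complement in `S³` of a subset of `ℝ³`. -/
abbrev Complement (X : Set E3) : Type := {x : S3 // x ∉ ((↑) : E3 → S3) '' X}

/-- `g ∈ π₁(S³ ∖ X, x₀)` is a meridian of the polygonal curve with edge set `S`, where
`support S ⊆ X`: it is represented by a loop `δ · c · δ⁻¹`, where `c` is the boundary of an
(elliptical) disc transverse to an edge `[a, b]` of `S`, whose centre `p` lies in the interior of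
that edge and is the only point of the disc in `X`, and `δ` is any path from `x₀` to `c`. -/
def IsMeridian (X : Set E3) (S : Set (E3 × E3)) {x₀ : Complement X}
    (g : FundamentalGroup (Complement X) x₀) : Prop :=
  ∃ e ∈ S, ∃ p ∈ openSegment ℝ e.1 e.2, ∃ u w : E3,
    LinearIndependent ℝ ![e.2 - e.1, u, w] ∧
    (∀ a b : ℝ, a ^ 2 + b ^ 2 ≤ 1 → p + a • u + b • w ∈ X → a = 0 ∧ b = 0) ∧
    ∃ (y : Complement X) (c : Path y y) (δ : Path x₀ y),
      (∀ t : unitInterval, (c t : S3) =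
        ((p + Real.cos (2 * Real.pi * t) • u + Real.sin (2 * Real.pi * t) • w : E3) : S3)) ∧
      g = FundamentalGroup.fromPath (Path.Homotopic.Quotient.mk ((δ.trans c).trans δ.symm))

/-- The homomorphisms `ρ : π₁(S³ ∖ (L ∪ ω)) → BD` that send the meridians of all components of
`L` to `S¹_B` and the meridians of `ω` to `-1`. Here `ω` is given by its set of edges; the
empty set of edges is `ω = ∅`. -/
def RBHom {m : ℕ} (L : PolygonalLink m) (W : Set (E3 × E3))
    (x₀ : Complement (L.carrier ∪ support W)) : Type :=
  {ρ : FundamentalGroup (Complement (L.carrier ∪ support W)) x₀ →* BD //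
    (∀ i g, IsMeridian (L.carrier ∪ support W) (L.edges i) g →
      (ρ g : (Quaternion ℝ)ˣ) ∈ circleB) ∧
    (∀ g, IsMeridian (L.carrier ∪ support W) W g → (ρ g : (Quaternion ℝ)ˣ) = -1)}

/-- Conjugacy of representations by elements of `BD`. -/
def RBSetoid {m : ℕ} (L : PolygonalLink m) (W : Set (E3 × E3))
    (x₀ : Complement (L.carrier ∪ support W)) : Setoid (RBHom L W x₀) where
  r ρ σ := ∃ h : BD, ∀ g, σ.1 g = h * ρ.1 g * h⁻¹
  iseqv :=
    { refl := fun ρ => ⟨1, fun g => by simp⟩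
      symm := by
        rintro ρ σ ⟨h, hh⟩
        exact ⟨h⁻¹, fun g => by rw [hh]; group⟩
      trans := by
        rintro ρ σ τ ⟨h, hh⟩ ⟨k, hk⟩
        exact ⟨k * h, fun g => by rw [hk, hh]; group⟩ }

/-- The space `R_B(L, ω)` of marked binary dihedral representations modulo conjugation. -/
def RB {m : ℕ} (L : PolygonalLink m) (W : Set (E3 × E3))
    (x₀ : Complement (L.carrier ∪ support W)) : Type :=
  Quotient (RBSetoid L W x₀)

/-! ### Projections, arcs and the determinant -/

/-- The vertical projection to the plane. -/
def shadow (x : E3) : ℝ × ℝ := (x 0, x 1)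

/-- The height above the plane. -/
def height (x : E3) : ℝ := x 2

/-- `L ∪ ω` is in general position with respect to the vertical projection: the only multiple
points of the projection are double points, and no vertex of `L` or `ω` (in particular no endpoint
of `ω`) projects to a double point. -/
def GeneralPosition {m : ℕ} (L : PolygonalLink m) (ω : PolygonalArc) : Prop :=
  (∀ x ∈ L.carrier ∪ support ω.edges, ∀ y ∈ L.carrier ∪ support ω.edges,
    ∀ z ∈ L.carrier ∪ support ω.edges, shadow x = shadow y → shadow y = shadow z →
      x = y ∨ y = z ∨ x = z) ∧
  (∀ i j, ∀ x ∈ L.carrier ∪ support ω.edges, shadow x = shadow (L.vertex i j) →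
    x = L.vertex i j) ∧
  (∀ k ≤ ω.len, ∀ x ∈ L.carrier ∪ support ω.edges, shadow x = shadow (ω.vertex k) →
    x = ω.vertex k)

namespace PolygonalLink

variable {m : ℕ} (L : PolygonalLink m)

/-- At parameter `s`, component `i` passes under the link at a crossing of the projection. -/
def PassesUnder (i : Fin m) (s : ℝ) : Prop :=
  ∃ (j : Fin m) (t : ℝ), shadow (L.curve j t) = shadow (L.curve i s) ∧
    height (L.curve i s) < height (L.curve j t)

/-- A labelling of the arcs of the projection of `L`. Along component `i` there are `num i` arcs
per period, and `cut i : ℤ → ℝ` lists in increasing order the parameters at which component `i`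
passes under the link. A component that passes under nowhere is a single arc, which is cut open at
one arbitrary point. Arc `(i, j)`, with `j ∈ ℤ / num i`, is the piece of component `i` between
the parameters `cut i (j - 1)` and `cut i j`. -/
structure ArcLabelling where
  num : Fin m → ℕ
  [num_neZero : ∀ i, NeZero (num i)]
  cut : Fin m → ℤ → ℝ
  cut_strictMono : ∀ i, StrictMono (cut i)
  cut_add_num : ∀ i k, cut i (k + num i) = cut i k + L.len i
  range_cut : ∀ i, (∃ s, L.PassesUnder i s) → Set.range (cut i) = {s | L.PassesUnder i s}
  num_eq_one : ∀ i, (¬ ∃ s, L.PassesUnder i s) → num i = 1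

attribute [instance] ArcLabelling.num_neZero

namespace ArcLabelling

variable {L} (lab : L.ArcLabelling)

/-- The index set of the arcs. -/
abbrev Arc : Type := Σ i : Fin m, ZMod (lab.num i)

/-- The parameter of the cut at the end of arc `a`. -/
def endCut (a : lab.Arc) : ℝ := lab.cut a.1 (a.2.val : ℤ)

/-- The cut at the end of arc `a` is a crossing, with arc `a` ending and the next arc starting
below some other strand. -/
def IsCrossing (a : lab.Arc) : Prop := L.PassesUnder a.1 (lab.endCut a)

/-- Arc `b` is the arc passing over the crossing at the end of arc `a`. (The half-open interval
makes the cut point of a component that passes under nowhere a point of its only arc.) -/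
def PassesOver (b a : lab.Arc) : Prop :=
  ∃ k : ℤ, (k : ZMod (lab.num b.1)) = b.2 ∧
    ∃ t ∈ Set.Ioc (lab.cut b.1 (k - 1)) (lab.cut b.1 k),
      shadow (L.curve b.1 t) = shadow (L.curve a.1 (lab.endCut a)) ∧
        height (L.curve a.1 (lab.endCut a)) < height (L.curve b.1 t)

open Classical in
/-- The matrix `M` of the diagram. Row `a` belongs to the crossing that separates arc `a` from the
next arc on its component: it has a `1` for each of these two arcs and a `-2` for the arc that goes
over, and these add up if some of the three arcs coincide. If the component of `a` passes under
nowhere, then there is no crossing at the end of `a` and row `a` is zero. -/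
def crossingMatrix : Matrix lab.Arc lab.Arc ℤ := fun a b =>
  if lab.IsCrossing a then
    (if b = a then 1 else 0) + (if b = ⟨a.1, a.2 + 1⟩ then 1 else 0)
      - 2 * (if lab.PassesOver b a then 1 else 0)
  else 0

open Classical in
/-- The determinant of the link: the absolute value of the determinant of the matrix `M₋` obtained
from `M` by deleting the row and the column with index `a` (any one of the indices). -/
def det (a : lab.Arc) : ℕ :=
  (Matrix.det (lab.crossingMatrix.submatrix
    (Subtype.val : {b : lab.Arc // b ≠ a} → lab.Arc) Subtype.val)).natAbs

end ArcLabelling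

end PolygonalLink

end MarkedLink

end

/-! Emptiness. A representation `ρ` is turned into a colouring of the regions of the diagram. To a
point `q` of the plane off the projection belongs the loop through infinity along the vertical line
over `q`; its holonomy `G q` depends only on the region of `q` (the Dehn presentation, `dehn`,
`IsDehn`). Crossing a strand from right to left changes `G` by the label `G(left) * G(right)⁻¹`,
which is conjugate to the holonomy of a meridian: it lies in `circleB` for a strand of `L` and is
`-1` for `ω`. Comparing the regions around one point of the diagram shows how the label of a strand
evolves: it is unchanged at ordinary points, at overcrossings and where `ω` passes over or under
(`-1` is central); it is conjugated by the over label at an undercrossing (`label_crossing`); and it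
changes sign at an endpoint of `ω` (`label_end`).

Writing labels as `J * expI θ`, conjugation is the reflection `θ ↦ 2 θ_over - θ` and a sign is a
shift by `π`. So each crossing gives `θ_a + θ_(a+1) - 2 θ_over = π (v_a + 2 z_a)`, where the integer
`v_a` records whether `ω` ends on the arc `a`; on each component exactly one `v_a` is `1` and the
others are `0`. A component without undercrossings would return to the negative of its own label, so
every row of `M` belongs to a crossing.

If `det M₋ = 0`, there is an integer vector `w` with `w M = 0`, with `w a₀ = 0` and with an odd
entry. Pairing it with the system gives `∑ w_a (v_a + 2 z_a) = 0`. Modulo 2 the columns of `M` say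
that `w` is constant along each component, and the pairing says that the two constants agree; `w a₀
= 0` then makes every entry even, a contradiction (`false_of_system`).

Nonemptiness. It suffices to find a homomorphism to the integers that is odd on all meridians and to
compose it with `n ↦ J ^ n`. It is the winding number of a nowhere zero function on the complement
of `L`: for each closed polygon with vertices `v_k`, the trace of the product of the matrices `|a_k|
+ σ · a_k`, `a_k = v_k - x`. These have rank one, so the trace is a product of overlaps of
neighbouring spin states, and an overlap vanishes only when `x` lies on the edge in between. After
normalization the function extends to infinity with a nonzero value. Near an edge it behaves like
one overlap, whose linear part has the edge direction as its kernel, so it winds `±1` times around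
the edge (`exists_winding_small`). -/

noncomputable section

namespace MarkedLink

open unitInterval Filter Topology

/-! ### Paths in the complement -/

/-- The two ways around a square in a topological space are homotopic. -/
lemma homotopic_of_square {Y : Type*} [TopologicalSpace Y] (K : C(I × I, Y)) {a b c d : Y}
    (γ : Path a b) (δ : Path c d) (α : Path a c) (β : Path b d)
    (hγ : ∀ s, K (s, 0) = γ s) (hδ : ∀ s, K (s, 1) = δ s)
    (hα : ∀ t, K (0, t) = α t) (hβ : ∀ t, K (1, t) = β t) :
    (γ.trans β).Homotopic (α.trans δ) := by
  obtain rfl : K (0, 0) = a := by rw [hγ, γ.source]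
  obtain rfl : K (1, 0) = b := by rw [hγ, γ.target]
  obtain rfl : K (0, 1) = c := by rw [hδ, δ.source]
  obtain rfl : K (1, 1) = d := by rw [hδ, δ.target]
  let p₁ : Path ((0, 0) : I × I) (1, 0) := ⟨⟨fun s => (s, 0), by fun_prop⟩, rfl, rfl⟩
  let p₂ : Path ((1, 0) : I × I) (1, 1) := ⟨⟨fun s => (1, s), by fun_prop⟩, rfl, rfl⟩
  let q₁ : Path ((0, 0) : I × I) (0, 1) := ⟨⟨fun s => (0, s), by fun_prop⟩, rfl, rfl⟩
  let q₂ : Path ((0, 1) : I × I) (1, 1) := ⟨⟨fun s => (s, 1), by fun_prop⟩, rfl, rfl⟩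
  have e₁ : γ = p₁.map K.continuous := by ext s; exact (hγ s).symm
  have e₂ : β = p₂.map K.continuous := by ext s; exact (hβ s).symm
  have e₃ : α = q₁.map K.continuous := by ext s; exact (hα s).symm
  have e₄ : δ = q₂.map K.continuous := by ext s; exact (hδ s).symm
  -- The square is contractible, so its two boundary paths between opposite corners are homotopic in
  -- it; `K` carries this homotopy over.
  have : ContractibleSpace I := (convex_Icc (0 : ℝ) 1).contractibleSpace ⟨0, by simp⟩
  rw [e₁, e₂, e₃, e₄, ← Path.map_trans, ← Path.map_trans]
  exact (SimplyConnectedSpace.paths_homotopic _ _).map K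

/-- A multiplicative, homotopy invariant assignment of group elements to paths. -/
structure Holonomy (Y : Type*) [TopologicalSpace Y] (H : Type*) [Group H] where
  toFun : ∀ {y z : Y}, Path y z → H
  map_trans : ∀ {x y z : Y} (γ : Path x y) (δ : Path y z),
    toFun (γ.trans δ) = toFun γ * toFun δ
  map_homotopic : ∀ {y z : Y} {γ δ : Path y z}, γ.Homotopic δ → toFun γ = toFun δ

namespace Holonomy

variable {Y : Type*} [TopologicalSpace Y] {H : Type*} [Group H] (hol : Holonomy Y H)

lemma map_refl (y : Y) : hol.toFun (Path.refl y) = 1 := by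
  have h := hol.map_trans (Path.refl y) (Path.refl y)
  rw [Path.refl_trans_refl] at h
  exact left_eq_mul.1 h

lemma map_square (K : C(I × I, Y)) {a b c d : Y}
    (γ : Path a b) (δ : Path c d) (α : Path a c) (β : Path b d)
    (hγ : ∀ s, K (s, 0) = γ s) (hδ : ∀ s, K (s, 1) = δ s)
    (hα : ∀ t, K (0, t) = α t) (hβ : ∀ t, K (1, t) = β t) :
    hol.toFun γ * hol.toFun β = hol.toFun α * hol.toFun δ := by
  rw [← hol.map_trans, ← hol.map_trans]
  exact hol.map_homotopic (homotopic_of_square K γ δ α β hγ hδ hα hβ)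

end Holonomy

/-- A representation of the fundamental group of a path connected space extends to a holonomy;
it is inverted because multiplication in the fundamental group composes loops from right to
left. -/
lemma exists_holonomy {Y : Type*} [TopologicalSpace Y] {H : Type*} [Group H] {x₀ : Y}
    (hY : ∀ y, Joined x₀ y) (ρ : FundamentalGroup Y x₀ →* H) :
    ∃ hol : Holonomy Y H, ∀ {y : Y} (c : Path y y), ∃ δ : Path x₀ y,
      hol.toFun c = (ρ (FundamentalGroup.fromPath
        (Path.Homotopic.Quotient.mk ((δ.trans c).trans δ.symm))))⁻¹ := by
  -- Fixed paths `τ y` from the base point close up every path to a loop. In a concatenation the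
  -- inner pieces `(τ y)⁻¹ · τ y` cancel.
  have τ := fun y => (hY y).somePath
  refine ⟨⟨fun {y z} γ => (ρ (FundamentalGroup.fromPath
    (Path.Homotopic.Quotient.mk (((τ y).trans γ).trans (τ z).symm))))⁻¹, ?_, ?_⟩,
    fun {y} c => ⟨τ y, rfl⟩⟩
  · intro x y z γ δ
    rw [← mul_inv_rev, ← map_mul, FundamentalGroup.mul_def]
    congr 3
    simp only [Path.Homotopic.Quotient.mk_trans, Path.Homotopic.Quotient.mk_symm]
    simp only [Path.Homotopic.Quotient.trans_assoc]
    rw [← Path.Homotopic.Quotient.trans_assoc (Path.Homotopic.Quotient.symm _)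
      (Path.Homotopic.Quotient.mk (τ y)), Path.Homotopic.Quotient.symm_trans,
      Path.Homotopic.Quotient.refl_trans]
  · intro y z γ δ h
    congr 3
    simp only [Path.Homotopic.Quotient.mk_trans]
    rw [Path.Homotopic.Quotient.eq.2 h]

/-! ### Rays to infinity, straight paths and small circuits in the complement. -/

section Complement

variable {X : Set E3}

/-- A point of the complement. -/
def cpt (x : E3) (hx : x ∉ X) : Complement X := ⟨x, by
  rintro ⟨y, hy, h⟩
  exact hx (OnePoint.coe_injective h ▸ hy)⟩

/-- The point at infinity. -/
def cinf (X : Set E3) : Complement X := ⟨OnePoint.infty, OnePoint.infty_notMem_image_coe⟩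

/-- The ray from `x` in the direction `n`, parametrized by the unit interval. -/
def rayMap (n : E3) (p : E3 × I) : S3 :=
  if p.2 = 1 then OnePoint.infty else ((p.1 + ((p.2 : ℝ) / (1 - p.2)) • n : E3) : S3)

lemma rayMap_of_ne {n : E3} {p : E3 × I} (h : p.2 ≠ 1) :
    rayMap n p = ((p.1 + ((p.2 : ℝ) / (1 - p.2)) • n : E3) : S3) := if_neg h

lemma one_sub_pos_of_ne {τ : I} (h : τ ≠ 1) : (0 : ℝ) < 1 - τ :=
  sub_pos.2 (lt_of_le_of_ne τ.2.2 fun h' => h (Subtype.ext h'))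

lemma continuous_rayMap {n : E3} (hn : n ≠ 0) : Continuous (rayMap n) := by
  rw [continuous_iff_continuousAt]
  rintro ⟨x, τ⟩
  by_cases hτ : τ = 1
  · subst hτ
    unfold ContinuousAt
    have e : rayMap n (x, 1) = OnePoint.infty := if_pos rfl
    rw [e]
    intro U hU
    have h1 : ((↑) : E3 → S3) ⁻¹' U ∈ cocompact E3 := by
      have := OnePoint.tendsto_coe_infty hU
      rwa [coclosedCompact_eq_cocompact] at this
    obtain ⟨R, -, hR⟩ := (Metric.hasBasis_cobounded_compl_closedBall (0 : E3)).mem_iff.1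
      (by rwa [Metric.cobounded_eq_cocompact])
    -- This is `R + ‖x‖ < τ / (1 - τ) * ‖n‖` with the denominator cleared: an open condition that
    -- still makes sense, and holds, at `τ = 1`.
    have h2 : ∀ᶠ p : E3 × I in 𝓝 (x, 1), (R + ‖p.1‖) * (1 - (p.2 : ℝ)) < p.2 * ‖n‖ := by
      apply ContinuousAt.eventually_lt
      · fun_prop
      · fun_prop
      · simpa using hn
    rw [Filter.mem_map]
    filter_upwards [h2] with p hp
    by_cases hp1 : p.2 = 1
    · rw [Set.mem_preimage, rayMap, if_pos hp1]; exact mem_of_mem_nhds hU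
    · rw [Set.mem_preimage, rayMap_of_ne hp1]
      refine hR ?_
      have h0 := one_sub_pos_of_ne hp1
      rw [Set.mem_compl_iff, mem_closedBall_zero_iff, not_le]
      have h3 : R + ‖p.1‖ < (p.2 : ℝ) / (1 - p.2) * ‖n‖ := by
        rw [div_mul_eq_mul_div, lt_div_iff₀ h0]; exact hp
      have h4 : ‖((p.2 : ℝ) / (1 - p.2)) • n‖ = (p.2 : ℝ) / (1 - p.2) * ‖n‖ := by
        rw [norm_smul, Real.norm_of_nonneg (div_nonneg p.2.2.1 h0.le)]
      have h5 := norm_sub_le (p.1 + ((p.2 : ℝ) / (1 - p.2)) • n) p.1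
      rw [add_sub_cancel_left] at h5
      linarith
  · have h1 : ∀ᶠ p : E3 × I in 𝓝 (x, τ), p.2 ≠ 1 :=
      continuous_snd.continuousAt.eventually_ne hτ
    have h0 := one_sub_pos_of_ne hτ
    refine ContinuousAt.congr ?_ (h1.mono fun p hp => (rayMap_of_ne hp).symm)
    refine OnePoint.continuous_coe.continuousAt.comp ?_
    have h2 : ContinuousAt (fun p : E3 × I => (p.2 : ℝ) / (1 - p.2)) (x, τ) :=
      ContinuousAt.div (by fun_prop) (by fun_prop) h0.ne'
    fun_prop

/-- The ray from `x` in direction `n` misses `X`. -/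
def RayFree (X : Set E3) (n x : E3) : Prop := ∀ t : ℝ, 0 ≤ t → x + t • n ∉ X

lemma RayFree.notMem {n x : E3} (h : RayFree X n x) : x ∉ X := by
  simpa using h 0 le_rfl

lemma RayFree.rayMap_mem {n x : E3} (h : RayFree X n x) (τ : I) :
    rayMap n (x, τ) ∉ ((↑) : E3 → S3) '' X := by
  by_cases hτ : τ = 1
  · rw [rayMap, if_pos hτ]; exact OnePoint.infty_notMem_image_coe
  · rw [rayMap_of_ne hτ]
    rintro ⟨y, hy, e⟩
    have h0 := one_sub_pos_of_ne hτ
    exact h _ (div_nonneg τ.2.1 h0.le) (OnePoint.coe_injective e ▸ hy)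

/-- The path to infinity along a ray. -/
def rayPath {n x : E3} (hn : n ≠ 0) (h : RayFree X n x) :
    Path (cpt x h.notMem) (cinf X) where
  toFun τ := ⟨rayMap n (x, τ), h.rayMap_mem τ⟩
  continuous_toFun := Continuous.subtype_mk ((continuous_rayMap hn).comp (by fun_prop)) _
  source' := Subtype.ext (by simp [rayMap, cpt])
  target' := Subtype.ext (by simp [rayMap, cinf])

/-- A path all of whose rays in direction `n` are free may be pushed to infinity. -/
lemma Holonomy.map_push {H : Type*} [Group H] (hol : Holonomy (Complement X) H)
    {n : E3} (hn : n ≠ 0) {f : I → E3} (hf : Continuous f) (h : ∀ s, RayFree X n (f s))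
    {x y : E3} (hx : RayFree X n x) (hy : RayFree X n y)
    (γ : Path (cpt x hx.notMem) (cpt y hy.notMem)) (hγ : ∀ s, (γ s : S3) = f s) :
    hol.toFun γ * hol.toFun (rayPath hn hy) = hol.toFun (rayPath hn hx) := by
  have ex : f 0 = x := by
    have := hγ 0
    rw [γ.source] at this
    exact (OnePoint.coe_injective this).symm
  have ey : f 1 = y := by
    have := hγ 1
    rw [γ.target] at this
    exact (OnePoint.coe_injective this).symm
  subst ex ey
  -- The rays from the points of the path sweep out a square whose far side is constantly infinity.
  have := hol.map_square
    ⟨fun p : I × I => (⟨rayMap n (f p.1, p.2), (h p.1).rayMap_mem p.2⟩ : Complement X),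
      Continuous.subtype_mk ((continuous_rayMap hn).comp (by fun_prop)) _⟩
    γ (Path.refl (cinf X)) (rayPath hn hx) (rayPath hn hy)
    (fun s => Subtype.ext (by simp [rayMap, hγ])) (fun s => Subtype.ext (if_pos rfl))
    (fun t => rfl) (fun t => rfl)
  rwa [hol.map_refl, mul_one] at this

/-- The straight path between two points. -/
def segPath {x y : E3} (h : ∀ z ∈ segment ℝ x y, z ∉ X) :
    Path (cpt x (h x (left_mem_segment ℝ x y))) (cpt y (h y (right_mem_segment ℝ x y))) where
  toFun s := cpt (AffineMap.lineMap x y (s : ℝ)) (h _ (by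
    rw [segment_eq_image_lineMap]; exact ⟨s, s.2, rfl⟩))
  continuous_toFun := Continuous.subtype_mk (OnePoint.continuous_coe.comp (by
    simp only [AffineMap.lineMap_apply_module]; fun_prop)) _
  source' := Subtype.ext (by simp [cpt])
  target' := Subtype.ext (by simp [cpt])

lemma lineMap_mem_seg {x y : E3} (s : I) :
    AffineMap.lineMap x y (s : ℝ) ∈ segment ℝ x y := by
  rw [segment_eq_image_lineMap]; exact ⟨s, s.2, rfl⟩

lemma Holonomy.map_segPath_push {H : Type*} [Group H] (hol : Holonomy (Complement X) H)
    {n : E3} (hn : n ≠ 0) {x y : E3} (h : ∀ z ∈ segment ℝ x y, RayFree X n z) :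
    hol.toFun (segPath fun z hz => (h z hz).notMem) *
      hol.toFun (rayPath hn (h y (right_mem_segment ℝ x y))) =
      hol.toFun (rayPath hn (h x (left_mem_segment ℝ x y))) :=
  hol.map_push hn (f := fun s : I => AffineMap.lineMap x y (s : ℝ))
    (by simp only [AffineMap.lineMap_apply_module]; fun_prop)
    (fun s => h _ (lineMap_mem_seg s)) _ _ _ (fun _ => rfl)

/-- The holonomy around a parallelogram in the complement is trivial. -/
lemma Holonomy.map_parallelogram {H : Type*} [Group H] (hol : Holonomy (Complement X) H)
    {m a b : E3} (h : ∀ s t : ℝ, s ∈ Set.Icc (-1 : ℝ) 1 → t ∈ Set.Icc (-1 : ℝ) 1 →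
      m + s • a + t • b ∉ X)
    (hAB : ∀ z ∈ segment ℝ (m + a + b) (m + a - b), z ∉ X)
    (hBC : ∀ z ∈ segment ℝ (m + a - b) (m - a - b), z ∉ X)
    (hAD : ∀ z ∈ segment ℝ (m + a + b) (m - a + b), z ∉ X)
    (hDC : ∀ z ∈ segment ℝ (m - a + b) (m - a - b), z ∉ X) :
    hol.toFun (segPath hAB) * hol.toFun (segPath hBC) =
      hol.toFun (segPath hAD) * hol.toFun (segPath hDC) := by
  have aux (r : I) : 1 - 2 * (r : ℝ) ∈ Set.Icc (-1 : ℝ) 1 := by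
    obtain ⟨h0, h1⟩ := r.2
    constructor <;> linarith
  -- Both coefficients run from `1` down to `-1`, so the corner `(0, 0)` of the square goes to `m +
  -- a + b`.
  refine hol.map_square
    ⟨fun p : I × I => cpt (m + (1 - 2 * (p.2 : ℝ)) • a + (1 - 2 * (p.1 : ℝ)) • b)
      (h _ _ (aux _) (aux _)),
      Continuous.subtype_mk (OnePoint.continuous_coe.comp (by fun_prop)) _⟩ _ _ _ _
    (fun s => ?_) (fun s => ?_) (fun s => ?_) (fun s => ?_) <;>
  · refine Subtype.ext (congrArg (fun z : E3 => (z : S3)) ?_)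
    simp only [AffineMap.lineMap_apply_module, Set.Icc.coe_zero, Set.Icc.coe_one]
    module

/-- A circuit around the boundary of an elliptical disc that meets `X` only in its centre `p`,
which lies in the interior of an edge of `S`. -/
def IsRing (X : Set E3) (S : Set (E3 × E3)) {y : Complement X} (c : Path y y) : Prop :=
  ∃ e ∈ S, ∃ p ∈ openSegment ℝ e.1 e.2, ∃ u w : E3,
    LinearIndependent ℝ ![e.2 - e.1, u, w] ∧
    (∀ a b : ℝ, a ^ 2 + b ^ 2 ≤ 1 → p + a • u + b • w ∈ X → a = 0 ∧ b = 0) ∧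
      ∀ t : unitInterval, (c t : S3) =
        ((p + Real.cos (2 * Real.pi * t) • u + Real.sin (2 * Real.pi * t) • w : E3) : S3)

lemma IsRing.isMeridian {S : Set (E3 × E3)} {x₀ y : Complement X} {c : Path y y}
    (h : IsRing X S c) (δ : Path x₀ y) :
    IsMeridian X S (FundamentalGroup.fromPath
      (Path.Homotopic.Quotient.mk ((δ.trans c).trans δ.symm))) := by
  obtain ⟨e, he, p, hp, u, w, h1, h2, h3⟩ := h
  exact ⟨e, he, p, hp, u, w, h1, h2, y, c, δ, h3, rfl⟩

end Complement

end MarkedLink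

end

noncomputable section

namespace MarkedLink

open unitInterval Filter Topology

/-! ### Vertical lines and the Dehn presentation -/

/-- The vertical projection, with values in the complex plane. -/
def csh (x : E3) : ℂ := ⟨x 0, x 1⟩

/-- The point of height `t` above `q`. -/
def lift (q : ℂ) (t : ℝ) : E3 := !₂[q.re, q.im, t]

/-- The upward unit vector. -/
def vert : E3 := lift 0 1

@[simp] lemma csh_lift (q : ℂ) (t : ℝ) : csh (lift q t) = q := by
  apply Complex.ext <;> simp [csh, lift]

@[simp] lemma height_lift (q : ℂ) (t : ℝ) : height (lift q t) = t := by simp [height, lift]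

lemma csh_add (x y : E3) : csh (x + y) = csh x + csh y := by
  apply Complex.ext <;> simp [csh]

lemma csh_sub (x y : E3) : csh (x - y) = csh x - csh y := by
  apply Complex.ext <;> simp [csh]

lemma csh_neg (x : E3) : csh (-x) = -csh x := by
  apply Complex.ext <;> simp [csh]

lemma csh_smul (r : ℝ) (x : E3) : csh (r • x) = r • csh x := by
  apply Complex.ext <;> simp [csh]

lemma height_add (x y : E3) : height (x + y) = height x + height y := by simp [height]

lemma height_neg (x : E3) : height (-x) = -height x := by simp [height]

lemma height_smul (r : ℝ) (x : E3) : height (r • x) = r * height x := by simp [height]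

@[simp] lemma csh_vert : csh vert = 0 := csh_lift 0 1

@[simp] lemma height_vert : height vert = 1 := height_lift 0 1

lemma ext_csh {x y : E3} (h₁ : csh x = csh y) (h₂ : height x = height y) : x = y := by
  have h3 := congrArg Complex.re h₁
  have h4 := congrArg Complex.im h₁
  ext i
  fin_cases i
  · exact h3
  · exact h4
  · exact h₂

lemma vert_ne : vert ≠ 0 := fun h => by
  have := congrArg height h
  simp [height] at this
  simp [vert, lift] at this

lemma neg_vert_ne : -vert ≠ 0 := neg_ne_zero.2 vert_ne

lemma shadow_eq_iff {x y : E3} : shadow x = shadow y ↔ csh x = csh y := by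
  simp [shadow, csh, Complex.ext_iff]

lemma exists_of_mem_segment_add_sub {E : Type*} [AddCommGroup E] [Module ℝ E] {c b z : E}
    (h : z ∈ segment ℝ (c + b) (c - b)) : ∃ t ∈ Set.Icc (-1 : ℝ) 1, z = c + t • b := by
  obtain ⟨u, v, hu, hv, huv, rfl⟩ := h
  refine ⟨u - v, ⟨by linarith, by linarith⟩, ?_⟩
  obtain rfl : u = 1 - v := by linarith
  module

variable {X : Set E3}

/-- The vertical line over `q` misses `X`. -/
def Off (X : Set E3) (q : ℂ) : Prop := ∀ x ∈ X, csh x ≠ q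

lemma Off.rayFree_up {x : E3} (h : Off X (csh x)) : RayFree X vert x := fun t _ ht =>
  h _ ht (by simp [csh_add, csh_smul])

lemma Off.rayFree_down {x : E3} (h : Off X (csh x)) : RayFree X (-vert) x := fun t _ ht =>
  h _ ht (by simp [csh_add, csh_smul, csh_neg])

lemma Off.lift {q : ℂ} (h : Off X q) (t : ℝ) : Off X (csh (lift q t)) := by rwa [csh_lift]

variable {H : Type*} [Group H] (hol : Holonomy (Complement X) H)

open Classical in
/-- The holonomy of the downward vertical line over `q`. -/
def dehn (q : ℂ) : H :=
  if h : Off X q then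
    (hol.toFun (rayPath vert_ne (h.lift 0).rayFree_up))⁻¹ *
      hol.toFun (rayPath neg_vert_ne (h.lift 0).rayFree_down)
  else 1

/-- Pushing the segment from `x` to `y` up and pushing it down multiply the holonomies of the upward
and of the downward ray by the same left factor, the holonomy of the segment, which cancels in the
quotient. -/
lemma dehn_eq_of_path {x y : E3} (h : ∀ z ∈ segment ℝ x y, Off X (csh z))
    (hxu : RayFree X vert x) (hxd : RayFree X (-vert) x)
    (hyu : RayFree X vert y) (hyd : RayFree X (-vert) y) :
    (hol.toFun (rayPath vert_ne hxu))⁻¹ * hol.toFun (rayPath neg_vert_ne hxd) =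
      (hol.toFun (rayPath vert_ne hyu))⁻¹ * hol.toFun (rayPath neg_vert_ne hyd) := by
  have h1 := hol.map_segPath_push vert_ne (fun z hz => (h z hz).rayFree_up)
  have h2 := hol.map_segPath_push neg_vert_ne (fun z hz => (h z hz).rayFree_down)
  rw [← h1, ← h2]
  group

lemma dehn_eq {x : E3} (h : Off X (csh x)) (hu : RayFree X vert x) (hd : RayFree X (-vert) x) :
    dehn hol (csh x) = (hol.toFun (rayPath vert_ne hu))⁻¹ *
      hol.toFun (rayPath neg_vert_ne hd) := by
  rw [dehn, dif_pos h]
  apply dehn_eq_of_path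
  intro z hz
  have : csh z = csh x := by
    obtain ⟨a, b, -, -, hab, rfl⟩ := hz
    rw [csh_add, csh_smul, csh_smul, csh_lift, ← add_smul, hab, one_smul]
  rwa [this]

lemma dehn_eq_of_segment {p q : ℂ} (h : ∀ z ∈ segment ℝ p q, Off X z) :
    dehn hol p = dehn hol q := by
  have hp : Off X (csh (lift p 0)) := (h _ (left_mem_segment ℝ p q)).lift 0
  have hq : Off X (csh (lift q 0)) := (h _ (right_mem_segment ℝ p q)).lift 0
  have h1 := dehn_eq hol hp hp.rayFree_up hp.rayFree_down
  have h2 := dehn_eq hol hq hq.rayFree_up hq.rayFree_down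
  rw [csh_lift] at h1 h2
  rw [h1, h2]
  apply dehn_eq_of_path
  rintro z ⟨a, b, ha, hb, hab, rfl⟩
  refine h _ ⟨a, b, ha, hb, hab, ?_⟩
  simp [csh_add, csh_smul]

/-- The Dehn relation at a crossing at `P`, with the over strand in the direction of `a` and the
under strand in the direction of `b`. -/
lemma dehn_crossing {P a b : ℂ} {h₀ : ℝ}
    (h : ∀ x ∈ X, ∀ s ∈ Set.Icc (-1 : ℝ) 1, ∀ t ∈ Set.Icc (-1 : ℝ) 1,
      csh x = P + s • a + t • b → (t = 0 ∧ h₀ < height x) ∨ (s = 0 ∧ height x < h₀)) :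
    dehn hol (P + a + b) * (dehn hol (P + a - b))⁻¹ =
      dehn hol (P - a + b) * (dehn hol (P - a - b))⁻¹ := by
  -- The horizontal parallelogram at height `h₀` passes between the strands. Its sides `AB` and `DC`
  -- run below the over strand, so they can be pushed down; `AD` and `BC` run above the under
  -- strand, so they can be pushed up.
  set m := lift P h₀ with hm
  set α := lift a 0 with hα
  set β := lift b 0 with hβ
  have c1 : (1 : ℝ) ∈ Set.Icc (-1 : ℝ) 1 := by simp
  have c2 : (-1 : ℝ) ∈ Set.Icc (-1 : ℝ) 1 := by simp
  have hfree (s t : ℝ) (hs : s ∈ Set.Icc (-1 : ℝ) 1) (ht : t ∈ Set.Icc (-1 : ℝ) 1) :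
      m + s • α + t • β ∉ X := fun hx => by
    have := h _ hx s hs t ht (by simp [csh_add, csh_smul, hm, hα, hβ])
    simp [height_add, height_smul, hm, hα, hβ] at this
  have hup (s t : ℝ) (hs : s ∈ Set.Icc (-1 : ℝ) 1) (ht : t ∈ Set.Icc (-1 : ℝ) 1)
      (ht0 : t ≠ 0) : RayFree X vert (m + s • α + t • β) := fun r hr hx => by
    rcases h _ hx s hs t ht (by simp [csh_add, csh_smul, hm, hα, hβ]) with h1 | h1
    · exact ht0 h1.1
    · have := h1.2
      simp [height_add, height_smul, hm, hα, hβ] at this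
      linarith
  have hdown (s t : ℝ) (hs : s ∈ Set.Icc (-1 : ℝ) 1) (ht : t ∈ Set.Icc (-1 : ℝ) 1)
      (hs0 : s ≠ 0) : RayFree X (-vert) (m + s • α + t • β) := fun r hr hx => by
    rcases h _ hx s hs t ht (by simp [csh_add, csh_smul, hm, hα, hβ, csh_neg]) with h1 | h1
    · have := h1.2
      simp [height_add, height_smul, height_neg, hm, hα, hβ] at this
      linarith
    · exact hs0 h1.1
  have e1 : m + α + β = m + (1 : ℝ) • α + (1 : ℝ) • β := by module
  have e2 : m + α - β = m + (1 : ℝ) • α + (-1 : ℝ) • β := by module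
  have e3 : m - α + β = m + (-1 : ℝ) • α + (1 : ℝ) • β := by module
  have e4 : m - α - β = m + (-1 : ℝ) • α + (-1 : ℝ) • β := by module
  have hAB : ∀ z ∈ segment ℝ (m + α + β) (m + α - β), RayFree X (-vert) z := fun z hz => by
    obtain ⟨t, ht, rfl⟩ := exists_of_mem_segment_add_sub hz
    simpa using hdown 1 t c1 ht (by norm_num)
  have hDC : ∀ z ∈ segment ℝ (m - α + β) (m - α - β), RayFree X (-vert) z := fun z hz => by
    obtain ⟨t, ht, rfl⟩ := exists_of_mem_segment_add_sub hz
    have := hdown (-1) t c2 ht (by norm_num)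
    rwa [neg_one_smul, ← sub_eq_add_neg] at this
  have hAD : ∀ z ∈ segment ℝ (m + α + β) (m - α + β), RayFree X vert z := fun z hz => by
    rw [show m + α + β = m + β + α by abel, show m - α + β = m + β - α by abel] at hz
    obtain ⟨t, ht, rfl⟩ := exists_of_mem_segment_add_sub hz
    have := hup t 1 ht c1 (by norm_num)
    rwa [one_smul, add_right_comm] at this
  have hBC : ∀ z ∈ segment ℝ (m + α - β) (m - α - β), RayFree X vert z := fun z hz => by
    rw [show m + α - β = m - β + α by abel, show m - α - β = m - β - α by abel] at hz
    obtain ⟨t, ht, rfl⟩ := exists_of_mem_segment_add_sub hz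
    have := hup t (-1) ht c2 (by norm_num)
    rwa [neg_one_smul, add_right_comm, ← sub_eq_add_neg] at this
  have off (s t : ℝ) (hs : s ∈ Set.Icc (-1 : ℝ) 1) (ht : t ∈ Set.Icc (-1 : ℝ) 1)
      (hs0 : s ≠ 0) (ht0 : t ≠ 0) : Off X (csh (m + s • α + t • β)) := fun x hx e => by
    rcases h x hx s hs t ht (by rw [e]; simp [csh_add, csh_smul, hm, hα, hβ]) with h1 | h1
    · exact ht0 h1.1
    · exact hs0 h1.1
  have hA : Off X (csh (m + α + β)) := e1 ▸ off 1 1 c1 c1 (by norm_num) (by norm_num)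
  have hB : Off X (csh (m + α - β)) := e2 ▸ off 1 (-1) c1 c2 (by norm_num) (by norm_num)
  have hD : Off X (csh (m - α + β)) := e3 ▸ off (-1) 1 c2 c1 (by norm_num) (by norm_num)
  have hC : Off X (csh (m - α - β)) := e4 ▸ off (-1) (-1) c2 c2 (by norm_num) (by norm_num)
  have r1 := hol.map_segPath_push neg_vert_ne hAB
  have r2 := hol.map_segPath_push neg_vert_ne hDC
  have r3 := hol.map_segPath_push vert_ne hAD
  have r4 := hol.map_segPath_push vert_ne hBC
  have r5 := hol.map_parallelogram (fun s t hs ht => hfree s t hs ht)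
    (fun z hz => (hAB z hz).notMem) (fun z hz => (hBC z hz).notMem)
    (fun z hz => (hAD z hz).notMem) (fun z hz => (hDC z hz).notMem)
  have g1 := dehn_eq hol hA hA.rayFree_up hA.rayFree_down
  have g2 := dehn_eq hol hB hB.rayFree_up hB.rayFree_down
  have g3 := dehn_eq hol hD hD.rayFree_up hD.rayFree_down
  have g4 := dehn_eq hol hC hC.rayFree_up hC.rayFree_down
  have k1 : csh (m + α + β) = P + a + b := by simp [csh_add, hm, hα, hβ]
  have k2 : csh (m + α - β) = P + a - b := by simp [csh_add, csh_sub, hm, hα, hβ]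
  have k3 : csh (m - α + β) = P - a + b := by simp [csh_add, csh_sub, hm, hα, hβ]
  have k4 : csh (m - α - β) = P - a - b := by simp [csh_sub, hm, hα, hβ]
  rw [k1] at g1
  rw [k2] at g2
  rw [k3] at g3
  rw [k4] at g4
  rw [g1, g2, g3, g4]
  -- Pushing down reduces the two quotients to the holonomies of `AB` and `DC`, conjugated by upward
  -- rays; pushing up transports those rays along `AD` and `BC`; the rest is `AB · BC = AD · DC`.
  rw [← r1, ← r2, ← r3, ← r4]
  rw [← eq_mul_inv_iff_mul_eq] at r5
  rw [r5]
  group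

/-- Neighbouring vertical lines on the two sides of an edge differ by a meridian. -/
lemma dehn_ring {S : Set (E3 × E3)} {e : E3 × E3} (he : e ∈ S) {p : E3}
    (hp : p ∈ openSegment ℝ e.1 e.2) {v : ℂ}
    (hv : LinearIndependent ℝ ![csh (e.2 - e.1), v])
    (h : ∀ x ∈ X, ∀ t ∈ Set.Icc (-1 : ℝ) 1, csh x = csh p + t • v → x = p) :
    ∃ (y : Complement X) (c : Path y y) (k : H), IsRing X S c ∧
      dehn hol (csh p + v) * (dehn hol (csh p - v))⁻¹ = k⁻¹ * hol.toFun c * k := by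
  set u := lift v 0 with hu
  have cu : csh u = v := csh_lift _ _
  have hv0 : v ≠ 0 := fun h0 => by
    have := hv.ne_zero 1
    simp [h0] at this
  -- The whole vertical strip through `p` in the direction of `u` meets `X` only in `p`, and so does
  -- every disc in it.
  have hmem (t : ℝ) (r : ℝ) (ht : t ∈ Set.Icc (-1 : ℝ) 1) (hx : p + t • u + r • vert ∈ X) :
      t = 0 ∧ r = 0 := by
    have h1 := h _ hx t ht (by simp [csh_add, csh_smul, cu])
    have h2 : t • u + r • vert = 0 := by
      have : p + (t • u + r • vert) = p := by rw [← add_assoc]; exact h1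
      simpa using this
    have h3 := congrArg csh h2
    have h4 := congrArg height h2
    simp [csh_add, csh_smul, cu] at h3
    have z1 : csh 0 = 0 := by apply Complex.ext <;> simp [csh]
    have z2 : height 0 = 0 := by simp [height]
    rw [z1] at h3
    simp [height_add, height_smul, hu, z2] at h4
    exact ⟨by simpa [hv0] using h3, h4⟩
  have hcs (θ : ℝ) : Real.cos θ ∈ Set.Icc (-1 : ℝ) 1 := Real.cos_mem_Icc θ
  have hpt (θ : ℝ) : p + Real.cos θ • u + Real.sin θ • (-vert) ∉ X := fun hx => by
    rw [smul_neg, ← neg_smul] at hx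
    obtain ⟨h1, h2⟩ := hmem _ _ (hcs θ) hx
    have := Real.cos_sq_add_sin_sq θ
    rw [h1, neg_eq_zero.1 h2] at this
    norm_num at this
  have hoff (s : ℝ) (hs : s ∈ Set.Icc (-1 : ℝ) 1) (hs0 : s ≠ 0) : Off X (csh (p + s • u)) :=
    fun x hx e => by
      have := h x hx s hs (by rw [e]; simp [csh_add, csh_smul, cu])
      rw [this, csh_add, csh_smul, cu] at e
      simp [hs0, hv0] at e
  have hy := hoff 1 (by simp) one_ne_zero
  have hy' := hoff (-1) (by simp) (by norm_num)
  rw [one_smul] at hy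
  rw [neg_one_smul] at hy'
  have hdown (θ : ℝ) (hθ : 0 ≤ Real.sin θ) :
      RayFree X (-vert) (p + Real.cos θ • u + Real.sin θ • (-vert)) := fun r hr hx => by
    rw [add_assoc, ← add_smul, smul_neg, ← neg_smul] at hx
    obtain ⟨h1, h2⟩ := hmem _ _ (hcs θ) hx
    have := Real.cos_sq_add_sin_sq θ
    rw [h1, show Real.sin θ = 0 by linarith] at this
    norm_num at this
  have hup (θ : ℝ) (hθ : Real.sin θ ≤ 0) :
      RayFree X vert (p + Real.cos θ • u + Real.sin θ • (-vert)) := fun r hr hx => by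
    rw [smul_neg, ← neg_smul, add_assoc, ← add_smul] at hx
    obtain ⟨h1, h2⟩ := hmem _ _ (hcs θ) hx
    have := Real.cos_sq_add_sin_sq θ
    rw [h1, show Real.sin θ = 0 by linarith] at this
    norm_num at this
  -- The circle in this strip is cut into its lower half `c₁`, which is pushed down, and its upper
  -- half `c₂`, which is pushed up. Together they compare the vertical loops over the two sides of
  -- the edge.
  let c₁ : Path (cpt (p + u) hy.rayFree_up.notMem) (cpt (p + -u) hy'.rayFree_up.notMem) :=
    { toFun := fun t => cpt (p + Real.cos (Real.pi * t) • u + Real.sin (Real.pi * t) • (-vert))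
        (hpt _)
      continuous_toFun := Continuous.subtype_mk (OnePoint.continuous_coe.comp (by fun_prop)) _
      source' := Subtype.ext (by simp [cpt])
      target' := Subtype.ext (by simp [cpt]) }
  let c₂ : Path (cpt (p + -u) hy'.rayFree_up.notMem) (cpt (p + u) hy.rayFree_up.notMem) :=
    { toFun := fun t => cpt (p + Real.cos (Real.pi * t + Real.pi) • u +
        Real.sin (Real.pi * t + Real.pi) • (-vert)) (hpt _)
      continuous_toFun := Continuous.subtype_mk (OnePoint.continuous_coe.comp (by fun_prop)) _
      source' := Subtype.ext (by simp [cpt])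
      target' := Subtype.ext (by simp [cpt]) }
  have p1 := hol.map_push neg_vert_ne
    (f := fun t : I => p + Real.cos (Real.pi * t) • u + Real.sin (Real.pi * t) • (-vert))
    (by fun_prop) (fun t => hdown _ (Real.sin_nonneg_of_nonneg_of_le_pi
      (mul_nonneg Real.pi_pos.le t.2.1) (mul_le_of_le_one_right Real.pi_pos.le t.2.2)))
    hy.rayFree_down hy'.rayFree_down c₁ (fun _ => rfl)
  have p2 := hol.map_push vert_ne
    (f := fun t : I => p + Real.cos (Real.pi * t + Real.pi) • u +
      Real.sin (Real.pi * t + Real.pi) • (-vert))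
    (by fun_prop) (fun t => hup _ (by
      rw [Real.sin_add_pi, neg_nonpos]
      exact Real.sin_nonneg_of_nonneg_of_le_pi
        (mul_nonneg Real.pi_pos.le t.2.1) (mul_le_of_le_one_right Real.pi_pos.le t.2.2)))
    hy'.rayFree_up hy.rayFree_up c₂ (fun _ => rfl)
  refine ⟨_, c₁.trans c₂, hol.toFun (rayPath vert_ne hy.rayFree_up), ?_, ?_⟩
  · refine ⟨e, he, p, hp, u, -vert, ?_, ?_, ?_⟩
    · rw [Fintype.linearIndependent_iff] at hv ⊢
      intro g hg
      have h1 := hv ![g 0, g 1] (by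
        have := congrArg csh hg
        rw [Fin.sum_univ_three] at this
        simp only [Matrix.cons_val_zero, Matrix.cons_val_one, Matrix.cons_val, csh_add, csh_smul,
          cu, csh_neg, csh_vert, neg_zero, smul_zero, add_zero] at this
        rw [Fin.sum_univ_two]
        simp only [Matrix.cons_val_zero, Matrix.cons_val_one]
        rw [this]
        apply Complex.ext <;> simp [csh])
      have g0 : g 0 = 0 := h1 0
      have g1 : g 1 = 0 := h1 1
      have g2 : g 2 = 0 := by
        rw [Fin.sum_univ_three] at hg
        simpa [g0, g1, vert_ne] using hg
      intro i
      fin_cases i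
      · exact g0
      · exact g1
      · exact g2
    · intro a b hab hx
      rw [smul_neg, ← neg_smul] at hx
      have := hmem _ _ ⟨by nlinarith [sq_nonneg b], by nlinarith [sq_nonneg b]⟩ hx
      exact ⟨this.1, neg_eq_zero.1 this.2⟩
    · intro t
      rw [Path.trans_apply]
      split_ifs with ht
      · change ((_ : E3) : S3) = _
        simp only []
        rw [show Real.pi * (2 * (t : ℝ)) = 2 * Real.pi * t by ring]
      · change ((_ : E3) : S3) = _
        simp only []
        rw [show Real.pi * (2 * (t : ℝ) - 1) + Real.pi = 2 * Real.pi * t by ring]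
  · have g1 := dehn_eq hol hy hy.rayFree_up hy.rayFree_down
    have g2 := dehn_eq hol hy' hy'.rayFree_up hy'.rayFree_down
    rw [csh_add, cu] at g1
    rw [csh_add, csh_neg, cu, ← sub_eq_add_neg] at g2
    rw [g1, g2, hol.map_trans, ← p1, ← p2]
    group

end MarkedLink

end

noncomputable section

namespace MarkedLink

open unitInterval Filter Topology

/-! ### The Dehn elements of a binary dihedral representation -/

lemma finite_edges {m : ℕ} (L : PolygonalLink m) (i : Fin m) : (L.edges i).Finite :=
  Set.finite_range _

lemma PolygonalArc.finite_edges (ω : PolygonalArc) : ω.edges.Finite := by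
  refine ((Set.finite_Iio ω.len).image fun k => (ω.vertex k, ω.vertex (k + 1))).subset ?_
  rintro e ⟨k, hk, rfl⟩
  exact ⟨k, hk, rfl⟩

lemma support_iUnion {ι : Type*} (S : ι → Set (E3 × E3)) :
    support (⋃ i, S i) = ⋃ i, support (S i) := by
  simp only [support, Set.biUnion_iUnion]

lemma support_union (S T : Set (E3 × E3)) : support (S ∪ T) = support S ∪ support T := by
  simp only [support, Set.biUnion_union]

lemma mem_support {S : Set (E3 × E3)} {x : E3} :
    x ∈ support S ↔ ∃ e ∈ S, x ∈ segment ℝ e.1 e.2 := by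
  simp [support]

lemma carrier_union_eq {m : ℕ} (L : PolygonalLink m) (W : Set (E3 × E3)) :
    L.carrier ∪ support W = support ((⋃ i, L.edges i) ∪ W) := by
  rw [support_union, support_iUnion]; rfl

/-- A ray from `x` can hit an edge only if its direction lies in the span of the two vectors from
`x` to the endpoints of the edge. Finitely many such proper subspaces do not cover three-space. -/
lemma exists_rayFree {S : Set (E3 × E3)} (hS : S.Finite) {x : E3} (hx : x ∉ support S) :
    ∃ n ≠ 0, RayFree (support S) n x := by
  set T : Set (Submodule ℝ E3) :=
    insert ⊥ ((fun e : E3 × E3 => Submodule.span ℝ {e.1 - x, e.2 - x}) '' S) with hT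
  have hfin : T.Finite := (hS.image _).insert _
  have hne := Subspace.biUnion_ne_univ_of_top_notMem (k := ℝ) (E := E3)
    (s := hfin.toFinset) (by
      rw [Set.Finite.mem_toFinset]
      rintro (h | ⟨e, -, h⟩)
      · exact bot_ne_top h.symm
      · have h1 : Module.finrank ℝ (Submodule.span ℝ {e.1 - x, e.2 - x}) ≤ 2 := by
          classical
          have := finrank_span_finset_le_card (R := ℝ) ({e.1 - x, e.2 - x} : Finset E3)
          rw [Finset.coe_insert, Finset.coe_singleton] at this
          exact this.trans Finset.card_le_two
        simp only [] at h
        rw [h, finrank_top, finrank_euclideanSpace_fin] at h1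
        omega)
  obtain ⟨n, hn⟩ := (Set.ne_univ_iff_exists_notMem _).1 hne
  simp only [Set.Finite.mem_toFinset, Set.mem_iUnion, not_exists] at hn
  refine ⟨n, fun h0 => hn ⊥ (Set.mem_insert _ _) (by simp [h0]), fun t ht hmem => ?_⟩
  obtain ⟨e, he, a, b, ha, hb, hab, h⟩ := mem_support.1 hmem
  have ht0 : t ≠ 0 := by
    rintro rfl
    rw [zero_smul, add_zero] at hmem
    exact hx hmem
  refine hn _ (Set.mem_insert_of_mem _ ⟨e, he, rfl⟩) ?_
  rw [SetLike.mem_coe, Submodule.mem_span_pair]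
  refine ⟨t⁻¹ * a, t⁻¹ * b, ?_⟩
  have h2 : a • (e.1 - x) + b • (e.2 - x) = t • n := by
    have : t • n = a • e.1 + b • e.2 - x := by rw [h]; abel
    rw [this]
    obtain rfl : a = 1 - b := by linarith
    module
  rw [mul_smul, mul_smul, ← smul_add, h2, smul_smul, inv_mul_cancel₀ ht0, one_smul]

lemma joined_complement {S : Set (E3 × E3)} (hS : S.Finite) (y : Complement (support S)) :
    Joined y (cinf (support S)) := by
  obtain ⟨y, hy⟩ := y
  induction y using OnePoint.rec with
  | infty => exact Joined.refl _
  | coe x =>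
    have hx : x ∉ support S := fun h => hy ⟨x, h, rfl⟩
    obtain ⟨n, hn, h⟩ := exists_rayFree hS hx
    exact ⟨rayPath hn h⟩

lemma mul_mem_circleB_conj {b k : (Quaternion ℝ)ˣ} (hb : b ∈ circleB) (hk : k ∈ BD) :
    k⁻¹ * b * k ∈ circleB := by
  suffices h : ∃ b' : (Quaternion ℝ), (∃ θ, b' = quatJ * expI θ) ∧ (b : Quaternion ℝ) * k = k * b' by
    obtain ⟨b', ⟨θ, hθ⟩, h⟩ := h
    refine ⟨θ, ?_⟩
    rw [Units.val_mul, Units.val_mul, mul_assoc, h, ← hθ, Units.inv_mul_cancel_left]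
  obtain ⟨β, hβ⟩ := hb
  rcases hk with ⟨a, ha⟩ | ⟨a, ha⟩
  · refine ⟨quatJ * expI (β + 2 * a), ⟨_, rfl⟩, ?_⟩
    rw [hβ, ha, ← mul_assoc (expI a), expI_mul_J, mul_assoc, expI_mul, mul_assoc, expI_mul]
    congr 2
    ring
  · refine ⟨quatJ * expI (2 * a - β), ⟨_, rfl⟩, ?_⟩
    rw [hβ, ha, mul_assoc, ← mul_assoc (expI β), expI_mul_J, mul_assoc quatJ (expI a),
      ← mul_assoc (expI a), expI_mul_J, mul_assoc, expI_mul, mul_assoc, expI_mul]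
    congr 3
    ring

lemma inv_mem_circleB {b : (Quaternion ℝ)ˣ} (hb : b ∈ circleB) : b⁻¹ ∈ circleB := by
  obtain ⟨a, ha⟩ := hb
  refine ⟨a + Real.pi, Units.inv_eq_of_mul_eq_one_right ?_⟩
  rw [ha, mul_assoc, ← mul_assoc (expI a), expI_mul_J, mul_assoc, expI_mul, ← mul_assoc,
    quatJ_mul_self, expI_mul, show Real.pi + (-a + (a + Real.pi)) = 2 * Real.pi by ring,
    expI_two_pi]

/-- The properties of the Dehn elements `G q` of a representation in `R_B(L, ω)`. -/
structure IsDehn {m : ℕ} (L : PolygonalLink m) (W : Set (E3 × E3))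
    (G : ℂ → (Quaternion ℝ)ˣ) : Prop where
  eq_of_segment : ∀ p q, (∀ z ∈ segment ℝ p q, Off (L.carrier ∪ support W) z) → G p = G q
  crossing : ∀ (P a b : ℂ) (h₀ : ℝ),
    (∀ x ∈ L.carrier ∪ support W, ∀ s ∈ Set.Icc (-1 : ℝ) 1, ∀ t ∈ Set.Icc (-1 : ℝ) 1,
      csh x = P + s • a + t • b → (t = 0 ∧ h₀ < height x) ∨ (s = 0 ∧ height x < h₀)) →
    G (P + a + b) * (G (P + a - b))⁻¹ = G (P - a + b) * (G (P - a - b))⁻¹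
  link : ∀ i, ∀ e ∈ L.edges i, ∀ p ∈ openSegment ℝ e.1 e.2, ∀ v : ℂ,
    LinearIndependent ℝ ![csh (e.2 - e.1), v] →
    (∀ x ∈ L.carrier ∪ support W, ∀ t ∈ Set.Icc (-1 : ℝ) 1, csh x = csh p + t • v → x = p) →
    G (csh p + v) * (G (csh p - v))⁻¹ ∈ circleB
  arc : ∀ e ∈ W, ∀ p ∈ openSegment ℝ e.1 e.2, ∀ v : ℂ,
    LinearIndependent ℝ ![csh (e.2 - e.1), v] →
    (∀ x ∈ L.carrier ∪ support W, ∀ t ∈ Set.Icc (-1 : ℝ) 1, csh x = csh p + t • v → x = p) →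
    G (csh p + v) * (G (csh p - v))⁻¹ = -1

lemma joined_complement_union {m : ℕ} (L : PolygonalLink m) {W : Set (E3 × E3)} (hW : W.Finite)
    (x y : Complement (L.carrier ∪ support W)) : Joined x y := by
  revert x y
  rw [carrier_union_eq]
  intro x y
  have hS : ((⋃ i, L.edges i) ∪ W).Finite :=
    (Set.finite_iUnion fun i => finite_edges L i).union hW
  exact (joined_complement hS x).trans (joined_complement hS y).symm

lemma exists_isDehn {m : ℕ} {L : PolygonalLink m} {W : Set (E3 × E3)} (hW : W.Finite)
    {x₀ : Complement (L.carrier ∪ support W)} (ρ : RBHom L W x₀) :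
    ∃ G : ℂ → (Quaternion ℝ)ˣ, IsDehn L W G := by
  obtain ⟨hol, hhol⟩ := exists_holonomy (joined_complement_union L hW x₀) ρ.1
  refine ⟨fun q => (dehn hol q : BD), ⟨fun p q h => ?_, fun P a b h₀ h => ?_,
    fun i e he p hp v hv h => ?_, fun e he p hp v hv h => ?_⟩⟩
  · rw [dehn_eq_of_segment hol h]
  · exact_mod_cast congrArg (Subtype.val) (dehn_crossing hol h)
  · obtain ⟨y, c, k, hc, hk⟩ := dehn_ring hol he hp hv h
    obtain ⟨δ, hδ⟩ := hhol c
    have h1 := ρ.2.1 i _ (hc.isMeridian δ)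
    -- The holonomy of the ring is the inverse of the value of `ρ` on a meridian, and `S¹_B` is
    -- stable under inversion and under conjugation by `BD`.
    have h2 := mul_mem_circleB_conj (inv_mem_circleB h1) k.2
    have h3 := congrArg Subtype.val hk
    rw [hδ] at h3
    simp only [Subgroup.coe_mul, Subgroup.coe_inv] at h3
    rw [h3]
    exact h2
  · obtain ⟨y, c, k, hc, hk⟩ := dehn_ring hol he hp hv h
    obtain ⟨δ, hδ⟩ := hhol c
    have h1 := ρ.2.2 _ (hc.isMeridian δ)
    have h3 := congrArg Subtype.val hk
    rw [hδ] at h3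
    simp only [Subgroup.coe_mul, Subgroup.coe_inv] at h3
    rw [h3, h1]
    simp

end MarkedLink

end

noncomputable section

namespace MarkedLink

open Filter Topology

/-! ### Angles and cones in the plane -/

/-- The unit vector in direction `θ`. -/
def ang (θ : ℝ) : ℂ := Complex.exp (θ * Complex.I)

lemma ang_add (a b : ℝ) : ang (a + b) = ang a * ang b := by
  rw [ang, ang, ang, ← Complex.exp_add]; push_cast; ring_nf

lemma ang_ne (a : ℝ) : ang a ≠ 0 := Complex.exp_ne_zero _

@[simp] lemma norm_ang (a : ℝ) : ‖ang a‖ = 1 := Complex.norm_exp_ofReal_mul_I a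

lemma ang_pi : ang Real.pi = -1 := Complex.exp_pi_mul_I

lemma ang_two_pi : ang (2 * Real.pi) = 1 := by
  rw [ang]; push_cast; exact Complex.exp_two_pi_mul_I

lemma ang_add_pi (a : ℝ) : ang (a + Real.pi) = -ang a := by rw [ang_add, ang_pi, mul_neg_one]

lemma ang_add_two_pi (a : ℝ) : ang (a + 2 * Real.pi) = ang a := by
  rw [ang_add, ang_two_pi, mul_one]

lemma eq_of_ang_eq {a b : ℝ} (h : ang a = ang b) (hab : |a - b| < 2 * Real.pi) : a = b := by
  rw [ang, ang, Complex.exp_eq_exp_iff_exists_int] at h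
  obtain ⟨n, hn⟩ := h
  have h2 : (a : ℂ) = b + n * (2 * Real.pi) := by
    have : (a : ℂ) * Complex.I = (b + n * (2 * Real.pi)) * Complex.I := by rw [hn]; ring
    exact mul_right_cancel₀ Complex.I_ne_zero this
  have h3 : a = b + n * (2 * Real.pi) := by exact_mod_cast h2
  have h4 : |(n : ℝ)| < 1 := by
    rw [h3, add_sub_cancel_left, abs_mul, abs_of_pos Real.two_pi_pos] at hab
    exact (mul_lt_iff_lt_one_left Real.two_pi_pos).1 hab
  have h5 : n = 0 := by
    rw [← Int.abs_lt_one_iff]; exact_mod_cast h4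
  rw [h3, h5]; simp

lemma smul_ang_inj {a b : ℝ} {x y : ℝ} (hx : 0 < x) (hy : 0 ≤ y) (h : x • ang a = y • ang b) :
    x = y ∧ ang a = ang b := by
  have h1 := congrArg norm h
  rw [norm_smul, norm_smul, norm_ang, norm_ang, mul_one, mul_one, Real.norm_of_nonneg hx.le,
    Real.norm_of_nonneg hy] at h1
  subst h1
  exact ⟨rfl, smul_right_injective ℂ hx.ne' h⟩

lemma exists_ang (α : ℝ) (w : ℂ) :
    ∃ β, α ≤ β ∧ β < α + 2 * Real.pi ∧ w = ‖w‖ • ang β := by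
  refine ⟨toIcoMod Real.two_pi_pos α (Complex.arg w), (toIcoMod_mem_Ico Real.two_pi_pos _ _).1,
    (toIcoMod_mem_Ico Real.two_pi_pos _ _).2, ?_⟩
  have h1 : ang (toIcoMod Real.two_pi_pos α (Complex.arg w)) = ang (Complex.arg w) := by
    rw [toIcoMod, ang, ang, Complex.exp_eq_exp_iff_exists_int]
    refine ⟨-toIcoDiv Real.two_pi_pos α (Complex.arg w), ?_⟩
    push_cast [zsmul_eq_mul]
    ring
  rw [h1, ang, Complex.real_smul, Complex.norm_mul_exp_arg_mul_I]

/-- A positive combination of two directions has a direction in between. -/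
lemma exists_ang_between {α γ x y : ℝ} (h₁ : α < γ) (h₂ : γ < α + Real.pi)
    (hx : 0 < x) (hy : 0 < y) :
    ∃ φ ρ : ℝ, α < φ ∧ φ < γ ∧ 0 < ρ ∧ x • ang α + y • ang γ = ρ • ang φ := by
  -- After rotation by `-α` the vector is `z = x + y e^(iδ)`. Its imaginary part is positive, so `0
  -- < arg z`; after a further rotation by `-δ` the imaginary part is `-x sin δ < 0`, so `arg z <
  -- δ`.
  set δ := γ - α with hδ
  have hs : 0 < Real.sin δ := Real.sin_pos_of_pos_of_lt_pi (by linarith) (by linarith)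
  set z : ℂ := x + y * ang δ with hz
  have him (t : ℝ) : (ang t).im = Real.sin t := Complex.exp_ofReal_mul_I_im t
  have h0 : 0 < z.im := by
    rw [hz]; simp [him]; positivity
  have hz0 : z ≠ 0 := fun h => by rw [h] at h0; simp at h0
  have hpolar : z = (‖z‖ : ℂ) * ang (Complex.arg z) := (Complex.norm_mul_exp_arg_mul_I z).symm
  have ha0 : 0 < Complex.arg z := by
    have h1 : 0 ≤ Complex.arg z := Complex.arg_nonneg_iff.2 h0.le
    refine lt_of_le_of_ne h1 fun h2 => ?_
    rw [← h2] at hpolar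
    rw [hpolar] at h0
    simp [him] at h0
  have hapi := Complex.arg_le_pi z
  have hlt : Complex.arg z < δ := by
    by_contra hcon
    push Not at hcon
    have h1 : (z * ang (-δ)).im = -(x * Real.sin δ) := by
      have : z * ang (-δ) = x * ang (-δ) + y := by
        rw [hz, add_mul, mul_assoc, ← ang_add, add_neg_cancel]
        simp [ang]
      rw [this]; simp [him]
    have h2 : z * ang (-δ) = (‖z‖ : ℂ) * ang (Complex.arg z - δ) := by
      conv_lhs => rw [hpolar]
      rw [mul_assoc, ← ang_add, sub_eq_add_neg]
    rw [h2, Complex.im_ofReal_mul, him] at h1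
    have h3 : 0 ≤ Real.sin (Complex.arg z - δ) :=
      Real.sin_nonneg_of_nonneg_of_le_pi (by linarith) (by linarith)
    have h4 := mul_nonneg (norm_nonneg z) h3
    have h5 := mul_pos hx hs
    linarith
  refine ⟨α + Complex.arg z, ‖z‖, by linarith, by linarith, norm_pos_iff.2 hz0, ?_⟩
  rw [ang_add, Complex.real_smul, Complex.real_smul, Complex.real_smul]
  rw [show γ = α + δ by rw [hδ]; ring, ang_add]
  calc (x : ℂ) * ang α + y * (ang α * ang δ) = ang α * z := by rw [hz]; ring
    _ = _ := by conv_lhs => rw [hpolar]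
                ring

/-! ### The local structure of the projection -/

/-- Near `P` the part of `X` over the plane is the union of the rays from `y k` in the
directions `D k`, whose projections have different directions. -/
structure Star (X : Set E3) (P : ℂ) (r : ℝ) {n : ℕ} (y D : Fin n → E3) (τ c : Fin n → ℝ) :
    Prop where
  r_pos : 0 < r
  csh_y : ∀ k, csh (y k) = P
  c_pos : ∀ k, 0 < c k
  csh_D : ∀ k, csh (D k) = c k • ang (τ k)
  near : ∀ x ∈ X, ‖csh x - P‖ < r → ∃ k, ∃ h : ℝ, 0 ≤ h ∧ x = y k + h • D k
  inj : ∀ k l, ang (τ k) = ang (τ l) → k = l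

namespace Star

variable {X : Set E3} {P : ℂ} {r : ℝ} {n : ℕ} {y D : Fin n → E3} {τ c : Fin n → ℝ}

/-- Polar coordinates around `P` are unique away from `P`, so a shadow point determines the ray
above it and the position on that ray. -/
lemma eq_of_over (S : Star X P r y D τ c) {x : E3} (hx : x ∈ X) {ρ θ : ℝ} (hρ : 0 < ρ) (hρr : ρ < r)
    (h : csh x = P + ρ • ang θ) : ∃ k, ang θ = ang (τ k) ∧ x = y k + (ρ / c k) • D k := by
  obtain ⟨k, t, ht, rfl⟩ := S.near x hx (by
    rw [h, add_sub_cancel_left, norm_smul, norm_ang, mul_one, Real.norm_of_nonneg hρ.le]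
    exact hρr)
  rw [csh_add, S.csh_y, csh_smul, S.csh_D, smul_smul] at h
  have h1 := add_left_cancel h
  obtain ⟨h2, h3⟩ := smul_ang_inj hρ (mul_nonneg ht (S.c_pos k).le) h1.symm
  exact ⟨k, h3, by rw [h2, mul_div_cancel_right₀ _ (S.c_pos k).ne']⟩

lemma off (S : Star X P r y D τ c) {ρ θ : ℝ} (hρ : 0 < ρ) (hρr : ρ < r)
    (h : ∀ k, ang θ ≠ ang (τ k)) : Off X (P + ρ • ang θ) := fun _ hx e =>
  let ⟨k, hk, _⟩ := S.eq_of_over hx hρ hρr e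
  h k hk

variable {G : ℂ → (Quaternion ℝ)ˣ}

/-- `G` is constant on the sectors of a star. -/
lemma eq_of_free_aux (S : Star X P r y D τ c)
    (hG : ∀ p q, (∀ z ∈ segment ℝ p q, Off X z) → G p = G q)
    {θ₁ θ₂ ρ₁ ρ₂ : ℝ} (h₁ : θ₁ ≤ θ₂) (h₂ : θ₂ < θ₁ + Real.pi)
    (hρ₁ : 0 < ρ₁) (hρ₁r : ρ₁ < r) (hρ₂ : 0 < ρ₂) (hρ₂r : ρ₂ < r)
    (h : ∀ θ, θ₁ ≤ θ → θ ≤ θ₂ → ∀ k, ang θ ≠ ang (τ k)) :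
    G (P + ρ₁ • ang θ₁) = G (P + ρ₂ • ang θ₂) := by
  -- With an opening below `π` the straight segment stays in the sector, and the triangle inequality
  -- keeps it in the disc. Vanishing weights and equal angles are treated apart because
  -- `exists_ang_between` needs strict inequalities.
  apply hG
  rintro z ⟨a, b, ha, hb, hab, rfl⟩
  have e : a • (P + ρ₁ • ang θ₁) + b • (P + ρ₂ • ang θ₂) =
      P + ((a * ρ₁) • ang θ₁ + (b * ρ₂) • ang θ₂) := by
    obtain rfl : a = 1 - b := by linarith
    module
  rw [e]
  have hlt : a * ρ₁ + b * ρ₂ < r := by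
    rcases ha.eq_or_lt with rfl | ha
    · rw [zero_add] at hab
      rw [hab]; linarith
    · nlinarith
  rcases ha.eq_or_lt with rfl | ha
  · rw [zero_add] at hab
    rw [hab, zero_mul, zero_smul, zero_add, one_mul]
    exact S.off hρ₂ hρ₂r (h _ h₁ le_rfl)
  rcases hb.eq_or_lt with rfl | hb
  · rw [add_zero] at hab
    rw [hab, zero_mul, zero_smul, add_zero, one_mul]
    exact S.off hρ₁ hρ₁r (h _ le_rfl h₁)
  have p1 := mul_pos ha hρ₁
  have p2 := mul_pos hb hρ₂
  rcases h₁.eq_or_lt with rfl | h₁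
  · rw [← add_smul]
    exact S.off (by positivity) hlt (h _ le_rfl le_rfl)
  · obtain ⟨φ, ρ, hφ₁, hφ₂, hρ, e⟩ := exists_ang_between h₁ h₂ p1 p2
    rw [e]
    refine S.off hρ ?_ (h _ hφ₁.le hφ₂.le)
    have h3 := congrArg norm e
    rw [norm_smul, norm_ang, mul_one, Real.norm_of_nonneg hρ.le] at h3
    rw [← h3]
    refine (norm_add_le _ _).trans_lt ?_
    rwa [norm_smul, norm_smul, norm_ang, norm_ang, mul_one, mul_one, Real.norm_of_nonneg p1.le,
      Real.norm_of_nonneg p2.le]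

/-- A sector may open up to `2π`, whereas straight segments handle only openings below `π`. Three
pieces of at most `2π / 3` suffice. -/
lemma eq_of_free (S : Star X P r y D τ c)
    (hG : ∀ p q, (∀ z ∈ segment ℝ p q, Off X z) → G p = G q)
    {θ₁ θ₂ ρ₁ ρ₂ : ℝ} (h₁ : θ₁ ≤ θ₂) (h₂ : θ₂ ≤ θ₁ + 2 * Real.pi)
    (hρ₁ : 0 < ρ₁) (hρ₁r : ρ₁ < r) (hρ₂ : 0 < ρ₂) (hρ₂r : ρ₂ < r)
    (h : ∀ θ, θ₁ ≤ θ → θ ≤ θ₂ → ∀ k, ang θ ≠ ang (τ k)) :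
    G (P + ρ₁ • ang θ₁) = G (P + ρ₂ • ang θ₂) := by
  have hpi := Real.pi_pos
  have e1 := S.eq_of_free_aux hG (θ₁ := θ₁) (θ₂ := θ₁ + (θ₂ - θ₁) / 3) (by linarith) (by linarith)
    hρ₁ hρ₁r hρ₁ hρ₁r (fun θ a b => h θ (by linarith) (by linarith))
  have e2 := S.eq_of_free_aux hG (θ₁ := θ₁ + (θ₂ - θ₁) / 3) (θ₂ := θ₁ + 2 * (θ₂ - θ₁) / 3)
    (by linarith) (by linarith)
    hρ₁ hρ₁r hρ₁ hρ₁r (fun θ a b => h θ (by linarith) (by linarith))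
  have e3 := S.eq_of_free_aux hG (θ₁ := θ₁ + 2 * (θ₂ - θ₁) / 3) (θ₂ := θ₂)
    (by linarith) (by linarith)
    hρ₁ hρ₁r hρ₂ hρ₂r (fun θ a b => h θ (by linarith) (by linarith))
  rw [e1, e2, e3]

/-- No ray other than the `k`-th has an angle within `η` of `τ k`. -/
def Isolated (τ : Fin n → ℝ) (k : Fin n) (η : ℝ) : Prop :=
  0 < η ∧ η < Real.pi / 2 ∧ ∀ θ, |θ - τ k| ≤ η → θ ≠ τ k → ∀ l, ang θ ≠ ang (τ l)

lemma Isolated.mono {k : Fin n} {η η' : ℝ} (h : Isolated τ k η) (h0 : 0 < η') (h1 : η' ≤ η) :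
    Isolated τ k η' :=
  ⟨h0, h1.trans_lt h.2.1, fun θ a b => h.2.2 θ (a.trans h1) b⟩

/-- The two points at height `±ε` beside the point `ρ` of the positive axis are complex conjugate:
they have equal modulus, near `ρ`, and opposite small angles. After a rotation these are the points
just beside a ray of a star. -/
lemma eventually_polar {ρ η a : ℝ} (hρ : 0 < ρ) (hη : 0 < η) (hρa : ρ < a) :
    ∀ᶠ ε : ℝ in 𝓝[>] 0, ∃ φ ρ' : ℝ, 0 < φ ∧ φ < η ∧ 0 < ρ' ∧ ρ' < a ∧
      (ρ + ε * Complex.I : ℂ) = ρ' • ang φ ∧ (ρ - ε * Complex.I : ℂ) = ρ' • ang (-φ) := by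
  have h1 : ∀ᶠ ε : ℝ in 𝓝[>] 0, Real.arctan (ε / ρ) < η := by
    refine (ContinuousAt.eventually_lt (f := fun ε : ℝ => Real.arctan (ε / ρ))
      (g := fun _ => η) ?_ continuousAt_const (by simpa using hη)).filter_mono nhdsWithin_le_nhds
    exact (Real.continuous_arctan.comp (continuous_id.div_const ρ)).continuousAt
  have h2 : ∀ᶠ ε : ℝ in 𝓝[>] 0, ‖(ρ + ε * Complex.I : ℂ)‖ < a := by
    refine (ContinuousAt.eventually_lt (f := fun ε : ℝ => ‖(ρ + ε * Complex.I : ℂ)‖)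
      (g := fun _ => a) (Continuous.continuousAt (by fun_prop)) continuousAt_const ?_).filter_mono nhdsWithin_le_nhds
    simpa [abs_of_pos hρ] using hρa
  filter_upwards [h1, h2, self_mem_nhdsWithin] with ε h1 h2 h3
  rw [Set.mem_Ioi] at h3
  set z : ℂ := ρ + ε * Complex.I with hz
  have hre : z.re = ρ := by simp [hz]
  have him : z.im = ε := by simp [hz]
  have hz0 : z ≠ 0 := fun h => by rw [h] at him; simp at him; linarith
  have harg : Complex.arg z = Real.arctan (ε / ρ) := by
    rw [Real.arctan_eq_arcsin, Complex.arg_of_re_nonneg (by rw [hre]; exact hρ.le), him]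
    congr 1
    have : ‖z‖ = ρ * √(1 + (ε / ρ) ^ 2) := by
      rw [Complex.norm_def, Complex.normSq_apply, hre, him]
      rw [show ρ * ρ + ε * ε = ρ ^ 2 * (1 + (ε / ρ) ^ 2) by field_simp,
        Real.sqrt_mul (by positivity), Real.sqrt_sq hρ.le]
    rw [this]
    field_simp
  have hp : z = ‖z‖ • ang (Complex.arg z) := by
    rw [Complex.real_smul]; exact (Complex.norm_mul_exp_arg_mul_I z).symm
  refine ⟨Complex.arg z, ‖z‖, ?_, harg ▸ h1, norm_pos_iff.2 hz0, h2, hp, ?_⟩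
  · rw [harg]; exact Real.arctan_pos.2 (div_pos h3 hρ)
  · have : (ρ - ε * Complex.I : ℂ) = (starRingEnd ℂ) z := by simp [hz, sub_eq_add_neg]
    rw [this]
    conv_lhs => rw [hp]
    rw [Complex.real_smul, map_mul, Complex.conj_ofReal, Complex.real_smul, ang, ang,
      ← Complex.exp_conj]
    simp

/-- The value of `G` in direction `θ` from `P`. -/
def W (G : ℂ → (Quaternion ℝ)ˣ) (P : ℂ) (r θ : ℝ) : (Quaternion ℝ)ˣ := G (P + (r / 2) • ang θ)

lemma W_add_two_pi (θ : ℝ) : W G P r (θ + 2 * Real.pi) = W G P r θ := by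
  rw [W, W, ang_add_two_pi]

/-- The values of `G` just beside a ray. -/
lemma eventually_beside (S : Star X P r y D τ c)
    (hG : ∀ p q, (∀ z ∈ segment ℝ p q, Off X z) → G p = G q) {k : Fin n} {η : ℝ}
    (hη : Isolated τ k η) {h : ℝ} (hh : 0 < h) (hr : h * c k < r) :
    ∀ᶠ ε : ℝ in 𝓝[>] 0,
      G (P + h • csh (D k) + ε • (Complex.I * csh (D k))) = W G P r (τ k + η) ∧
      G (P + h • csh (D k) - ε • (Complex.I * csh (D k))) = W G P r (τ k - η) := by
  have hr0 := S.r_pos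
  have hc := S.c_pos k
  have hpi := Real.pi_pos
  filter_upwards [eventually_polar hh hη.1
    ((lt_div_iff₀ (S.c_pos k)).2 hr)] with ε ⟨φ, ρ, hφ0, hφ1, hρ0, hρ1, e1, e2⟩
  have hρr : ρ * c k < r := (lt_div_iff₀ hc).1 hρ1
  have hρ0' : 0 < ρ * c k := mul_pos hρ0 hc
  constructor
  · have : P + h • csh (D k) + ε • (Complex.I * csh (D k)) =
        P + (ρ * c k) • ang (τ k + φ) := by
      rw [S.csh_D, ang_add]
      simp only [Complex.real_smul] at e1 ⊢
      push_cast
      linear_combination (c k * ang (τ k)) * e1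
    rw [this]
    refine S.eq_of_free hG (by linarith) (by linarith [hη.2.1]) hρ0' hρr (by linarith)
      (by linarith) fun θ a b => hη.2.2 θ ?_ ?_
    · rw [abs_le]; constructor <;> linarith
    · intro e; linarith
  · have : P + h • csh (D k) - ε • (Complex.I * csh (D k)) =
        P + (ρ * c k) • ang (τ k + -φ) := by
      rw [S.csh_D, ang_add]
      simp only [Complex.real_smul] at e2 ⊢
      push_cast
      linear_combination (c k * ang (τ k)) * e2
    rw [this]
    refine (S.eq_of_free hG (by linarith) (by linarith [hη.2.1]) (by linarith)
      (by linarith) hρ0' hρr fun θ a b => hη.2.2 θ ?_ ?_).symm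
    · rw [abs_le]; constructor <;> linarith
    · intro e; linarith

/-- Just beside a ray, the segment across the ray meets the projection of `X` only on the ray. -/
lemma eventually_across (S : Star X P r y D τ c) {k : Fin n} {η : ℝ}
    (hη : Isolated τ k η) {h : ℝ} (hh : 0 < h) (hr : h * c k < r) :
    ∀ᶠ ε : ℝ in 𝓝[>] 0, ∀ x ∈ X, ∀ t ∈ Set.Icc (-1 : ℝ) 1,
      csh x = csh (y k + h • D k) + t • (ε • (Complex.I * csh (D k))) → x = y k + h • D k := by
  have hc := S.c_pos k
  obtain ⟨ε₀, hε₀, H⟩ := (nhdsGT_basis (0 : ℝ)).eventually_iff.1 (eventually_polar hh hη.1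
    ((lt_div_iff₀ (S.c_pos k)).2 hr))
  refine (nhdsGT_basis (0 : ℝ)).eventually_iff.2 ⟨ε₀, hε₀, fun ε hε x hx t ht e => ?_⟩
  -- The point with parameter `t` on the transverse segment has angle `τ k + φ`, where `φ` is small
  -- and vanishes only on the ray; for `t < 0` the conjugate point is used. Any point of `X` above
  -- it lies on a ray of the star, and isolation then forces `φ = 0`.
  have key : ∃ φ ρ : ℝ, |φ| < η ∧ (φ = 0 → ρ = h) ∧ 0 < ρ ∧ ρ < r / c k ∧
      (h + (t * ε : ℝ) * Complex.I : ℂ) = ρ • ang φ := by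
    rcases lt_trichotomy t 0 with ht0 | rfl | ht0
    · have hm : -(t * ε) ∈ Set.Ioo 0 ε₀ := ⟨by nlinarith [hε.1], by nlinarith [hε.1, hε.2, ht.1]⟩
      obtain ⟨φ, ρ', h1, h2, h3, h4, -, h6⟩ := H hm
      refine ⟨-φ, ρ', by rwa [abs_neg, abs_of_pos h1], fun h => by linarith, h3, h4, ?_⟩
      rw [← h6]; push_cast; ring
    · refine ⟨0, h, by simpa using hη.1, fun _ => rfl, hh, (lt_div_iff₀ hc).2 hr, ?_⟩
      simp [ang]
    · have hm : t * ε ∈ Set.Ioo 0 ε₀ := ⟨by nlinarith [hε.1], by nlinarith [hε.1, hε.2, ht.2]⟩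
      obtain ⟨φ, ρ', h1, h2, h3, h4, h5, -⟩ := H hm
      exact ⟨φ, ρ', by rwa [abs_of_pos h1], fun h => by linarith, h3, h4, h5⟩
  obtain ⟨φ, ρ, h1, h2, h3, h4, h5⟩ := key
  have e' : csh x = P + (ρ * c k) • ang (τ k + φ) := by
    rw [e, csh_add, csh_smul, S.csh_y, S.csh_D, ang_add]
    simp only [Complex.real_smul] at h5 ⊢
    push_cast at h5 ⊢
    linear_combination (c k * ang (τ k)) * h5
  obtain ⟨l, hl, hxl⟩ := S.eq_of_over hx (mul_pos h3 hc) ((lt_div_iff₀ hc).1 h4) e'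
  have hφ : φ = 0 := by
    by_contra hφ
    exact hη.2.2 (τ k + φ) (by simpa using h1.le) (by simpa using hφ) l hl
  rw [hφ, add_zero] at hl
  obtain rfl := S.inj _ _ hl
  rw [hxl, h2 hφ, mul_div_cancel_right₀ _ hc.ne']

end Star

end MarkedLink

end

noncomputable section

namespace MarkedLink

open Filter Topology

/-! ### The curves -/

lemma fract_int_add {μ : ℝ} (n : ℤ) (h0 : 0 ≤ μ) (h1 : μ < 1) :
    ⌊(n : ℝ) + μ⌋ = n ∧ Int.fract ((n : ℝ) + μ) = μ := by
  have h : ⌊(n : ℝ) + μ⌋ = n := by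
    rw [Int.floor_intCast_add, Int.floor_eq_zero_iff.2 ⟨h0, h1⟩, add_zero]
  exact ⟨h, by rw [Int.fract, h]; ring⟩

namespace PolygonalLink

variable {m : ℕ} (L : PolygonalLink m)

lemma curve_int_add (i : Fin m) (n : ℤ) {μ : ℝ} (h0 : 0 ≤ μ) (h1 : μ ≤ 1) :
    L.curve i (n + μ) =
      L.vertex i n + μ • (L.vertex i (n + 1) - L.vertex i n) := by
  rcases h1.lt_or_eq with h1 | rfl
  · obtain ⟨e1, e2⟩ := fract_int_add n h0 h1
    rw [curve, e1, e2, AffineMap.lineMap_apply_module]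
    module
  · obtain ⟨e1, e2⟩ := fract_int_add (μ := 0) (n + 1) le_rfl one_pos
    rw [add_zero] at e1 e2
    push_cast at e1 e2
    rw [curve, e1, e2, AffineMap.lineMap_apply_module]
    push_cast
    module

lemma curve_int (i : Fin m) (n : ℤ) : L.curve i n = L.vertex i n := by
  have := L.curve_int_add i n le_rfl zero_le_one
  simpa using this

lemma curve_add_len (i : Fin m) (s : ℝ) (k : ℤ) : L.curve i (s + k * L.len i) = L.curve i s := by
  have e : s + k * L.len i = s + ((k * L.len i : ℤ) : ℝ) := by push_cast; ring
  rw [e, curve, curve, Int.floor_add_intCast, Int.fract_add_intCast]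
  push_cast
  simp

lemma curve_inj {i j : Fin m} {s t : ℝ} (h : L.curve i s = L.curve j t) :
    i = j ∧ ∃ k : ℤ, s = t + k * L.len i := L.embedded i j s t h

lemma one_le_len (i : Fin m) : (1 : ℝ) ≤ L.len i := by
  exact_mod_cast Nat.one_le_iff_ne_zero.2 (NeZero.ne (L.len i))

lemma edge_mem (i : Fin m) (n : ℤ) :
    (L.vertex i n, L.vertex i (n + 1)) ∈ L.edges i := ⟨(n : ZMod (L.len i)), rfl⟩

lemma curve_mem_edge (i : Fin m) (n : ℤ) {μ : ℝ} (h0 : 0 ≤ μ) (h1 : μ ≤ 1) :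
    L.curve i (n + μ) ∈ segment ℝ (L.vertex i n) (L.vertex i (n + 1)) := by
  rw [L.curve_int_add i n h0 h1, segment_eq_image']
  exact ⟨μ, ⟨h0, h1⟩, rfl⟩

lemma mem_support_edges {i : Fin m} {x : E3} :
    x ∈ support (L.edges i) ↔ ∃ s, x = L.curve i s := by
  constructor
  · intro h
    obtain ⟨e, ⟨j, rfl⟩, hx⟩ := mem_support.1 h
    obtain ⟨n, rfl⟩ := ZMod.intCast_surjective j
    rw [segment_eq_image'] at hx
    obtain ⟨μ, hμ, rfl⟩ := hx
    exact ⟨n + μ, (L.curve_int_add i n hμ.1 hμ.2).symm⟩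
  · rintro ⟨s, rfl⟩
    refine mem_support.2 ⟨_, L.edge_mem i ⌊s⌋, ?_⟩
    have := L.curve_mem_edge i ⌊s⌋ (Int.fract_nonneg s) (Int.fract_lt_one s).le
    rwa [Int.floor_add_fract] at this

lemma mem_carrier {x : E3} : x ∈ L.carrier ↔ ∃ i s, x = L.curve i s := by
  simp only [carrier, Set.mem_iUnion, mem_support_edges]

lemma curve_mem_carrier (i : Fin m) (s : ℝ) : L.curve i s ∈ L.carrier :=
  L.mem_carrier.2 ⟨i, s, rfl⟩

/-- The direction of the edge that starts at or contains parameter `s`. -/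
def dirOut (i : Fin m) (s : ℝ) : E3 := L.vertex i (⌊s⌋ + 1 : ℤ) - L.vertex i (⌊s⌋ : ℤ)

/-- The direction of the edge that ends at or contains parameter `s`. -/
def dirIn (i : Fin m) (s : ℝ) : E3 := L.vertex i (⌈s⌉ : ℤ) - L.vertex i (⌈s⌉ - 1 : ℤ)

/-- The local form of the curve near parameter `s`. -/
lemma exists_local (i : Fin m) (s : ℝ) : ∃ η : ℝ, 0 < η ∧ η ≤ 1 / 2 ∧
    (∀ h, 0 ≤ h → h ≤ η → L.curve i (s + h) = L.curve i s + h • L.dirOut i s ∧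
      L.curve i (s + h) ∈ segment ℝ (L.vertex i (⌊s⌋ : ℤ)) (L.vertex i ((⌊s⌋ : ℤ) + 1))) ∧
    (∀ h, 0 ≤ h → h ≤ η → L.curve i (s - h) = L.curve i s + h • (-L.dirIn i s) ∧
      L.curve i (s - h) ∈
        segment ℝ (L.vertex i ((⌈s⌉ - 1 : ℤ) : ℤ)) (L.vertex i (((⌈s⌉ - 1 : ℤ) : ℤ) + 1))) ∧
    (∀ h, 0 < h → h ≤ η → ⌊s + h⌋ = ⌊s⌋ ∧ s + h ≠ ⌊s + h⌋) ∧
    (∀ h, 0 < h → h ≤ η → ⌊s - h⌋ = ⌈s⌉ - 1 ∧ s - h ≠ ⌊s - h⌋) := by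
  have f1 := Int.floor_le s
  have f2 := Int.lt_floor_add_one s
  have c1 := Int.le_ceil s
  have c2 := Int.ceil_lt_add_one s
  set n := ⌊s⌋ with hn
  set k := ⌈s⌉ with hk
  -- Half of the distances to `⌊s⌋ + 1` and to `⌈s⌉ - 1` keeps `s + h` and `s - h` strictly inside
  -- the two adjacent edges.
  refine ⟨min (1 / 2) (min ((n + 1 - s) / 2) ((s - k + 1) / 2)), ?_, min_le_left _ _, ?_, ?_, ?_, ?_⟩
  · exact lt_min (by norm_num) (lt_min (by linarith) (by linarith))
  · intro h h0 h1
    have h2 := h1.trans ((min_le_right _ _).trans (min_le_left _ _))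
    constructor
    · have e1 := L.curve_int_add i n (μ := s - n + h) (by linarith) (by linarith)
      have e2 := L.curve_int_add i n (μ := s - n) (by linarith) (by linarith)
      rw [show (n : ℝ) + (s - n + h) = s + h by ring] at e1
      rw [show (n : ℝ) + (s - n) = s by ring] at e2
      rw [e1, e2, dirOut, ← hn]
      push_cast
      module
    · have := L.curve_mem_edge i n (μ := s - n + h) (by linarith) (by linarith)
      rwa [show (n : ℝ) + (s - n + h) = s + h by ring] at this
  · intro h h0 h1
    have h2 := h1.trans ((min_le_right _ _).trans (min_le_right _ _))
    constructor
    · have e1 := L.curve_int_add i (k - 1) (μ := s - k + 1 - h) (by linarith) (by linarith)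
      have e2 := L.curve_int_add i (k - 1) (μ := s - k + 1) (by linarith) (by linarith)
      push_cast at e1 e2
      rw [show (k : ℝ) - 1 + (s - k + 1 - h) = s - h by ring] at e1
      rw [show (k : ℝ) - 1 + (s - k + 1) = s by ring] at e2
      rw [e1, e2, dirIn, ← hk]
      push_cast
      rw [sub_add_cancel]
      module
    · have := L.curve_mem_edge i (k - 1) (μ := s - k + 1 - h) (by linarith) (by linarith)
      push_cast at this
      rw [show (k : ℝ) - 1 + (s - k + 1 - h) = s - h by ring] at this
      push_cast
      exact this
  · intro h h0 h1
    have h2 := h1.trans ((min_le_right _ _).trans (min_le_left _ _))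
    have e : ⌊s + h⌋ = n := by
      rw [Int.floor_eq_iff]; constructor <;> linarith
    exact ⟨e, by rw [e]; intro h3; linarith⟩
  · intro h h0 h1
    have h2 := h1.trans ((min_le_right _ _).trans (min_le_right _ _))
    have e : ⌊s - h⌋ = k - 1 := by
      rw [Int.floor_eq_iff]; push_cast; constructor <;> linarith
    exact ⟨e, by rw [e]; push_cast; intro h3; linarith⟩

lemma dirIn_eq_dirOut (i : Fin m) {s : ℝ} (h : ∀ n : ℤ, s ≠ n) : L.dirIn i s = L.dirOut i s := by
  have : ⌈s⌉ = ⌊s⌋ + 1 := by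
    rw [Int.ceil_eq_iff]
    push_cast
    exact ⟨by linarith [lt_of_le_of_ne (Int.floor_le s) (h _).symm], (Int.lt_floor_add_one s).le⟩
  rw [dirIn, dirOut, this, add_sub_cancel_right]

/-- A point of a component away from the vertices lies in the interior of an edge. -/
lemma curve_mem_openSegment (i : Fin m) {s : ℝ} (h : s ≠ ⌊s⌋) :
    L.curve i s ∈ openSegment ℝ (L.vertex i (⌊s⌋ : ℤ)) (L.vertex i ((⌊s⌋ : ℤ) + 1)) := by
  have h1 := L.curve_int_add i ⌊s⌋ (Int.fract_nonneg s) (Int.fract_lt_one s).le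
  rw [Int.floor_add_fract] at h1
  rw [h1, openSegment_eq_image']
  refine ⟨_, ⟨lt_of_le_of_ne (Int.fract_nonneg s) fun h2 => h ?_, Int.fract_lt_one s⟩, rfl⟩
  have := Int.floor_add_fract s
  rw [← h2] at this
  linarith

lemma vertex_ne (i : Fin m) (n : ℤ) : L.vertex i n ≠ L.vertex i (n + 1) := by
  intro h
  -- A degenerate edge would make the curve agree at `n` and `n + 1/2`, so that `1/2` would be an
  -- integral multiple of the period.
  have e1 := L.curve_int_add i n (μ := 1 / 2) (by norm_num) (by norm_num)
  rw [← h, sub_self, smul_zero, add_zero, ← L.curve_int] at e1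
  obtain ⟨-, k, hk⟩ := L.curve_inj e1
  have h1 : (1 / 2 : ℝ) = ((k * L.len i : ℤ) : ℝ) := by push_cast; linarith
  have h2 : (1 : ℝ) = ((2 * (k * L.len i) : ℤ) : ℝ) := by push_cast at h1 ⊢; linarith
  have h3 : (1 : ℤ) = 2 * (k * L.len i) := by exact_mod_cast h2
  omega

end PolygonalLink

namespace PolygonalArc

variable (ω : PolygonalArc)

/-- The parametrization of the arc. -/
def curve (s : ℝ) : E3 :=
  AffineMap.lineMap (ω.vertex ⌊s⌋₊) (ω.vertex (⌊s⌋₊ + 1)) (Int.fract s)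

lemma curve_nat_add (n : ℕ) {μ : ℝ} (h0 : 0 ≤ μ) (h1 : μ ≤ 1) :
    ω.curve (n + μ) = ω.vertex n + μ • (ω.vertex (n + 1) - ω.vertex n) := by
  rcases h1.lt_or_eq with h1 | rfl
  · obtain ⟨-, e2⟩ := fract_int_add n h0 h1
    have e1 : ⌊(n : ℝ) + μ⌋₊ = n := by
      rw [Nat.floor_eq_iff (by positivity)]; constructor <;> linarith
    push_cast at e2
    rw [curve, e1, e2, AffineMap.lineMap_apply_module]
    module
  · have e1 : ⌊(n : ℝ) + 1⌋₊ = n + 1 := by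
      rw [Nat.floor_eq_iff (by positivity)]; push_cast; constructor <;> linarith
    have e2 : Int.fract ((n : ℝ) + 1) = 0 := by
      rw [Int.fract_add_one, Int.fract_natCast]
    rw [curve, e1, e2, AffineMap.lineMap_apply_module]
    module

lemma curve_nat (n : ℕ) : ω.curve n = ω.vertex n := by
  have := ω.curve_nat_add n le_rfl zero_le_one
  simpa using this

lemma curve_injOn : Set.InjOn ω.curve (Set.Icc 0 ω.len) := ω.embedded

lemma edge_mem {n : ℕ} (h : n < ω.len) : (ω.vertex n, ω.vertex (n + 1)) ∈ ω.edges := ⟨n, h, rfl⟩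

lemma curve_mem_edge (n : ℕ) {μ : ℝ} (h0 : 0 ≤ μ) (h1 : μ ≤ 1) :
    ω.curve (n + μ) ∈ segment ℝ (ω.vertex n) (ω.vertex (n + 1)) := by
  rw [ω.curve_nat_add n h0 h1, segment_eq_image']
  exact ⟨μ, ⟨h0, h1⟩, rfl⟩

lemma exists_nat_add {t : ℝ} (h0 : 0 ≤ t) (h1 : t ≤ ω.len) :
    ∃ n < ω.len, ∃ μ ∈ Set.Icc (0 : ℝ) 1, t = n + μ := by
  have hpos := ω.len_pos
  rcases h1.lt_or_eq with h1 | rfl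
  · refine ⟨⌊t⌋₊, (Nat.floor_lt h0).2 h1, t - ⌊t⌋₊, ⟨?_, ?_⟩, by ring⟩
    · linarith [Nat.floor_le h0]
    · linarith [Nat.lt_floor_add_one t]
  · refine ⟨ω.len - 1, by omega, 1, by simp, ?_⟩
    rw [Nat.cast_sub hpos]; push_cast; ring

lemma mem_support_edges {x : E3} :
    x ∈ support ω.edges ↔ ∃ t ∈ Set.Icc (0 : ℝ) ω.len, x = ω.curve t := by
  constructor
  · intro h
    obtain ⟨e, ⟨n, hn, rfl⟩, hx⟩ := mem_support.1 h
    rw [segment_eq_image'] at hx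
    obtain ⟨μ, hμ, rfl⟩ := hx
    have hn' : (n : ℝ) + 1 ≤ ω.len := by exact_mod_cast hn
    refine ⟨n + μ, ⟨add_nonneg (Nat.cast_nonneg n) hμ.1, by linarith [hμ.2]⟩,
      (ω.curve_nat_add n hμ.1 hμ.2).symm⟩
  · rintro ⟨t, ht, rfl⟩
    obtain ⟨n, hn, μ, hμ, rfl⟩ := ω.exists_nat_add ht.1 ht.2
    exact mem_support.2 ⟨_, ω.edge_mem hn, ω.curve_mem_edge n hμ.1 hμ.2⟩

lemma vertex_ne {n : ℕ} (h : n < ω.len) : ω.vertex n ≠ ω.vertex (n + 1) := by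
  intro h1
  rw [← ω.curve_nat, ← ω.curve_nat] at h1
  have h' : (n : ℝ) + 1 ≤ ω.len := by exact_mod_cast h
  have h2 := ω.curve_injOn ⟨by positivity, by linarith⟩ ⟨by positivity, by push_cast; linarith⟩ h1
  push_cast at h2
  linarith

end PolygonalArc

/-! ### Overlapping edges -/

/-- The difference `f` of the two affinely matched edges is affine and vertical. The overlap is
prolonged in both directions until one of the edges ends; there the shadow of an endpoint is hit,
which by general position is no double point, so `f` vanishes. An affine function with two zeros is
zero. -/
lemma eq_of_overlap_aux {p q p' q' : E3}
    (hv : ∀ s ∈ Set.Icc (0 : ℝ) 1, ∀ s' ∈ Set.Icc (0 : ℝ) 1,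
      csh (p + s • (q - p)) = csh (p' + s' • (q' - p')) → s = 0 ∨ s = 1 ∨ s' = 0 ∨ s' = 1 →
      p + s • (q - p) = p' + s' • (q' - p'))
    {a b a' b' : ℝ} (ha : 0 ≤ a) (hab : a < b) (hb : b ≤ 1) (ha' : 0 ≤ a') (hab' : a' < b')
    (hb' : b' ≤ 1) (h₁ : csh (p + a • (q - p)) = csh (p' + a' • (q' - p')))
    (h₂ : csh (p + b • (q - p)) = csh (p' + b' • (q' - p'))) :
    p + a • (q - p) = p' + a' • (q' - p') ∧ p + b • (q - p) = p' + b' • (q' - p') := by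
  set k := (b' - a') / (b - a) with hk
  have hba : b - a ≠ 0 := by linarith
  have hk0 : 0 < k := div_pos (by linarith) (by linarith)
  have hkb : a' + k * (b - a) = b' := by rw [hk, div_mul_cancel₀ _ hba]; ring
  set f : ℝ → E3 := fun t => (p + t • (q - p)) - (p' + (a' + k * (t - a)) • (q' - p')) with hf
  have faff (t : ℝ) : f t = f a + ((t - a) / (b - a)) • (f b - f a) := by
    obtain ⟨r, hr⟩ : ∃ r, t = a + r * (b - a) := ⟨(t - a) / (b - a), by field_simp; ring⟩
    have : (t - a) / (b - a) = r := by rw [hr]; field_simp; ring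
    rw [this]
    simp only [hf, hr]
    module
  have fa : csh (f a) = 0 := by
    simp only [hf, sub_self, mul_zero, add_zero]
    rw [csh_sub, h₁, sub_self]
  have fb : csh (f b) = 0 := by
    simp only [hf, hkb]
    rw [csh_sub, h₂, sub_self]
  have fc (t : ℝ) : csh (f t) = 0 := by
    rw [faff, csh_add, csh_smul, fa, csh_sub (f b), fa, fb]; simp
  have hend (t : ℝ) (h0 : 0 ≤ t) (h1 : t ≤ 1) (h2 : 0 ≤ a' + k * (t - a))
      (h3 : a' + k * (t - a) ≤ 1)
      (h : t = 0 ∨ t = 1 ∨ a' + k * (t - a) = 0 ∨ a' + k * (t - a) = 1) : f t = 0 := by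
    simp only [hf]
    rw [sub_eq_zero]
    refine hv t ⟨h0, h1⟩ _ ⟨h2, h3⟩ ?_ h
    have := fc t
    simp only [hf] at this
    rwa [csh_sub, sub_eq_zero] at this
  -- Going down from `a`, the first edge ends at `t = 0` and the second at `t = a - a' / k`;
  -- whichever comes first is used.
  have low : ∃ t ≤ a, f t = 0 := by
    rcases le_total (k * a) a' with h | h
    · exact ⟨0, ha, hend 0 le_rfl zero_le_one (by linarith) (by nlinarith) (Or.inl rfl)⟩
    · have e : a' + k * (a - a' / k - a) = 0 := by field_simp; ring
      have h5 : 0 ≤ a' / k := by positivity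
      have h6 : a' / k ≤ a := by rw [div_le_iff₀ hk0]; linarith
      exact ⟨a - a' / k, by linarith, hend _ (by linarith) (by linarith) e.ge (by linarith)
        (Or.inr (Or.inr (Or.inl e)))⟩
  have high : ∃ t ≥ b, f t = 0 := by
    rcases le_total (b' + k * (1 - b)) 1 with h | h
    · have e : a' + k * (1 - a) = b' + k * (1 - b) := by rw [← hkb]; ring
      exact ⟨1, hb, hend 1 zero_le_one le_rfl (by rw [e]; nlinarith) (by rw [e]; exact h)
        (Or.inr (Or.inl rfl))⟩
    · have e : a' + k * (b + (1 - b') / k - a) = 1 := by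
        rw [← hkb]; field_simp; ring
      have h5 : 0 ≤ (1 - b') / k := div_nonneg (by linarith) hk0.le
      have h6 : (1 - b') / k ≤ 1 - b := by rw [div_le_iff₀ hk0]; linarith
      exact ⟨b + (1 - b') / k, by linarith, hend _ (by linarith) (by linarith)
        (by rw [e]; exact zero_le_one) e.le (Or.inr (Or.inr (Or.inr e)))⟩
  obtain ⟨t₀, ht₀, e₀⟩ := low
  obtain ⟨t₁, ht₁, e₁⟩ := high
  have hd : f b - f a = 0 := by
    have h5 : f t₁ - f t₀ = ((t₁ - t₀) / (b - a)) • (f b - f a) := by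
      rw [faff t₁, faff t₀]
      rw [add_sub_add_left_eq_sub, ← sub_smul]
      congr 1
      field_simp
      ring
    rw [e₀, e₁, sub_zero] at h5
    have h6 : (t₁ - t₀) / (b - a) ≠ 0 := div_ne_zero (by linarith) hba
    exact (smul_eq_zero.1 h5.symm).resolve_left h6
  have f0 : f a = 0 := by
    have := faff t₀
    rw [hd, smul_zero, add_zero, e₀] at this
    exact this.symm
  have f1 : f b = 0 := by rw [← sub_eq_zero.1 hd.symm.symm] at f0; exact f0
  simp only [hf, sub_self, mul_zero, add_zero] at f0
  simp only [hf, hkb] at f1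
  exact ⟨sub_eq_zero.1 f0, sub_eq_zero.1 f1⟩

/-- If no endpoint of an edge projects to a double point, then two edges whose projections overlap
in a segment coincide above it. -/
lemma eq_of_overlap {X : Set E3} {p q p' q' : E3} (hX : segment ℝ p q ⊆ X)
    (hX' : segment ℝ p' q' ⊆ X) (hp : ∀ x ∈ X, csh x = csh p → x = p)
    (hq : ∀ x ∈ X, csh x = csh q → x = q) (hp' : ∀ x ∈ X, csh x = csh p' → x = p')
    (hq' : ∀ x ∈ X, csh x = csh q' → x = q') {x y x' y' : E3} (hx : x ∈ segment ℝ p q)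
    (hy : y ∈ segment ℝ p q) (hx' : x' ∈ segment ℝ p' q') (hy' : y' ∈ segment ℝ p' q')
    (hxx' : csh x = csh x') (hyy' : csh y = csh y') (hxy : csh x ≠ csh y) :
    x = x' ∧ y = y' := by
  have key : ∀ {p q p' q' : E3}, segment ℝ p q ⊆ X → segment ℝ p' q' ⊆ X →
      (∀ x ∈ X, csh x = csh p → x = p) → (∀ x ∈ X, csh x = csh q → x = q) →
      (∀ x ∈ X, csh x = csh p' → x = p') → (∀ x ∈ X, csh x = csh q' → x = q') →
      ∀ {a b a' b' : ℝ}, 0 ≤ a → a < b → b ≤ 1 → 0 ≤ a' → a' < b' → b' ≤ 1 →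
      csh (p + a • (q - p)) = csh (p' + a' • (q' - p')) →
      csh (p + b • (q - p)) = csh (p' + b' • (q' - p')) →
      p + a • (q - p) = p' + a' • (q' - p') ∧ p + b • (q - p) = p' + b' • (q' - p') := by
    intro p q p' q' hX hX' hp hq hp' hq' a b a' b' h1 h2 h3 h4 h5 h6 h7 h8
    refine eq_of_overlap_aux ?_ h1 h2 h3 h4 h5 h6 h7 h8
    intro s hs s' hs' e h
    have m1 : p + s • (q - p) ∈ X := hX (by rw [segment_eq_image']; exact ⟨s, hs, rfl⟩)
    have m2 : p' + s' • (q' - p') ∈ X := hX' (by rw [segment_eq_image']; exact ⟨s', hs', rfl⟩)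
    rcases h with rfl | rfl | rfl | rfl
    · rw [zero_smul, add_zero] at e ⊢; exact (hp _ m2 e.symm).symm
    · rw [one_smul, add_sub_cancel] at e ⊢; exact (hq _ m2 e.symm).symm
    · rw [zero_smul, add_zero] at e ⊢; exact hp' _ m1 e
    · rw [one_smul, add_sub_cancel] at e ⊢; exact hq' _ m1 e
  rw [segment_eq_image'] at hx hy hx' hy'
  obtain ⟨a, ha, rfl⟩ := hx
  obtain ⟨b, hb, rfl⟩ := hy
  obtain ⟨a', ha', rfl⟩ := hx'
  obtain ⟨b', hb', rfl⟩ := hy'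
  simp only [] at *
  have hab : a ≠ b := by rintro rfl; exact hxy rfl
  have hab' : a' ≠ b' := by rintro rfl; exact hxy (hxx'.trans hyy'.symm)
  -- When the shadows run in opposite directions, the second edge is reversed.
  have flip (t : ℝ) : p' + t • (q' - p') = q' + (1 - t) • (p' - q') := by module
  have hX'' : segment ℝ q' p' ⊆ X := by rwa [segment_symm]
  rcases lt_or_gt_of_ne hab with h | h <;> rcases lt_or_gt_of_ne hab' with h' | h'
  · exact key hX hX' hp hq hp' hq' ha.1 h hb.2 ha'.1 h' hb'.2 hxx' hyy'
  · rw [flip] at hxx' hyy'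
    rw [flip a', flip b']
    exact key hX hX'' hp hq hq' hp' ha.1 h hb.2 (by linarith [ha'.2]) (by linarith)
      (by linarith [hb'.1]) hxx' hyy'
  · rw [flip] at hxx' hyy'
    rw [flip a', flip b']
    exact (key hX hX'' hp hq hq' hp' hb.1 h ha.2 (by linarith [hb'.2]) (by linarith)
      (by linarith [ha'.1]) hyy' hxx').symm
  · exact (key hX hX' hp hq hp' hq' hb.1 h ha.2 hb'.1 h' ha'.2 hyy' hxx').symm

/-! ### Points over a neighbourhood of a point of the plane -/

/-- Localization: if the segment passes over `P`, distance in the plane is proportional to distance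
of parameters because the segment is not vertical; otherwise compactness keeps its shadow away from
`P`. -/
lemma eventually_near_segment {p q : E3} (hpq : csh p ≠ csh q) (P : ℂ) {η : ℝ} (hη : 0 < η) :
    ∀ᶠ r in 𝓝[>] (0 : ℝ), ∀ μ ∈ Set.Icc (0 : ℝ) 1, ‖csh (p + μ • (q - p)) - P‖ < r →
      ∃ ν ∈ Set.Icc (0 : ℝ) 1, csh (p + ν • (q - p)) = P ∧ |μ - ν| < η := by
  by_cases h : ∃ ν ∈ Set.Icc (0 : ℝ) 1, csh (p + ν • (q - p)) = P
  · obtain ⟨ν, hν, rfl⟩ := h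
    have hd : 0 < ‖csh (q - p)‖ := by
      rw [norm_pos_iff, csh_sub, sub_ne_zero]; exact hpq.symm
    filter_upwards [Ioo_mem_nhdsGT (mul_pos hη hd)] with r hr μ hμ h1
    refine ⟨ν, hν, rfl, ?_⟩
    rw [← csh_sub, add_sub_add_left_eq_sub, ← sub_smul, csh_smul, norm_smul, Real.norm_eq_abs] at h1
    exact lt_of_mul_lt_mul_right (h1.trans hr.2) hd.le
  · push Not at h
    have hcont : Continuous fun μ : ℝ => ‖csh (p + μ • (q - p)) - P‖ := by
      simp only [csh_add, csh_smul]; fun_prop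
    obtain ⟨μ₀, hμ₀, hmin⟩ := isCompact_Icc.exists_isMinOn (Set.nonempty_Icc.2 zero_le_one)
      hcont.continuousOn
    have h0 : 0 < ‖csh (p + μ₀ • (q - p)) - P‖ := by
      rw [norm_pos_iff, sub_ne_zero]; exact h μ₀ hμ₀
    filter_upwards [Ioo_mem_nhdsGT h0] with r hr μ hμ h1
    exact absurd (hmin hμ) (not_le.2 (h1.trans hr.2))

end MarkedLink

end

noncomputable section

namespace MarkedLink

open Filter Topology

/-! ### Labels around a point of the projection -/

/-- The ray from `y` in direction `D` initially runs along an edge of `E`. -/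
def RayOn (E : Set (E3 × E3)) (y D : E3) (η : ℝ) : Prop :=
  0 < η ∧ ∃ e ∈ E, (D = e.2 - e.1 ∨ D = -(e.2 - e.1)) ∧ y ∈ segment ℝ e.1 e.2 ∧
    ∀ h, 0 < h → h ≤ η → y + h • D ∈ openSegment ℝ e.1 e.2

namespace Star

variable {X : Set E3} {P : ℂ} {r : ℝ} {n : ℕ} {y D : Fin n → E3} {τ c : Fin n → ℝ}
  {G : ℂ → (Quaternion ℝ)ˣ}

lemma exists_isolated (S : Star X P r y D τ c) : ∃ η, ∀ k, Isolated τ k η := by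
  have hc : Continuous ang := by unfold ang; fun_prop
  have h1 : ∀ᶠ η in 𝓝[>] (0 : ℝ), ∀ k l, ∀ θ, |θ - τ k| ≤ η → θ ≠ τ k → ang θ ≠ ang (τ l) := by
    rw [eventually_all]; intro k
    rw [eventually_all]; intro l
    have h2 : ∀ᶠ θ in 𝓝 (τ k), θ ≠ τ k → ang θ ≠ ang (τ l) := by
      by_cases hkl : k = l
      · subst hkl
        filter_upwards [Metric.ball_mem_nhds (τ k) Real.two_pi_pos] with θ hθ hne he
        exact hne (eq_of_ang_eq he hθ)
      · have : ang (τ k) ≠ ang (τ l) := fun h => hkl (S.inj k l h)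
        filter_upwards [hc.continuousAt.eventually_ne this] with θ hθ _
        exact hθ
    obtain ⟨ε, hε, hb⟩ := Metric.eventually_nhds_iff.1 h2
    filter_upwards [Ioo_mem_nhdsGT hε] with η hη θ hθ
    exact hb (lt_of_le_of_lt hθ hη.2)
  obtain ⟨η, h2, h3⟩ := (h1.and (Ioo_mem_nhdsGT Real.pi_div_two_pos)).exists
  exact ⟨η, fun k => ⟨h3.1, h3.2, fun θ a b l => h2 k l θ a b⟩⟩

lemma sector (S : Star X P r y D τ c)
    (hG : ∀ p q, (∀ z ∈ segment ℝ p q, Off X z) → G p = G q) {a b θ₁ θ₂ ρ₁ ρ₂ : ℝ}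
    (hab : b ≤ a + 2 * Real.pi) (h : ∀ θ, a < θ → θ < b → ∀ k, ang θ ≠ ang (τ k))
    (h₁ : a < θ₁) (h₁' : θ₁ < b) (h₂ : a < θ₂) (h₂' : θ₂ < b)
    (hρ₁ : 0 < ρ₁) (hρ₁r : ρ₁ < r) (hρ₂ : 0 < ρ₂) (hρ₂r : ρ₂ < r) :
    G (P + ρ₁ • ang θ₁) = G (P + ρ₂ • ang θ₂) := by
  rcases le_total θ₁ θ₂ with hle | hle
  · exact S.eq_of_free hG hle (by linarith) hρ₁ hρ₁r hρ₂ hρ₂r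
      fun θ x y => h θ (by linarith) (by linarith)
  · exact (S.eq_of_free hG hle (by linarith) hρ₂ hρ₂r hρ₁ hρ₁r
      fun θ x y => h θ (by linarith) (by linarith)).symm

lemma W_sector (S : Star X P r y D τ c)
    (hG : ∀ p q, (∀ z ∈ segment ℝ p q, Off X z) → G p = G q) {a b θ₁ θ₂ : ℝ}
    (hab : b ≤ a + 2 * Real.pi) (h : ∀ θ, a < θ → θ < b → ∀ k, ang θ ≠ ang (τ k))
    (h₁ : a < θ₁) (h₁' : θ₁ < b) (h₂ : a < θ₂) (h₂' : θ₂ < b) : W G P r θ₁ = W G P r θ₂ :=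
  have := S.r_pos
  S.sector hG hab h h₁ h₁' h₂ h₂' (by linarith) (by linarith) (by linarith) (by linarith)

/-- A short transverse segment across the ray, close to one of its points, is an admissible test
segment for the fields `link` and `arc` of `IsDehn`. It turns these into statements about the values
of `G` in the two sectors adjacent to the ray. -/
lemma exists_jump (S : Star X P r y D τ c)
    (hG : ∀ p q, (∀ z ∈ segment ℝ p q, Off X z) → G p = G q) {k : Fin n} {η η' : ℝ}
    (hη : Isolated τ k η) {E : Set (E3 × E3)} (hE : RayOn E (y k) (D k) η') :
    ∃ e ∈ E, ∃ p ∈ openSegment ℝ e.1 e.2, ∃ v : ℂ,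
      LinearIndependent ℝ ![csh (e.2 - e.1), v] ∧
      (∀ x ∈ X, ∀ t ∈ Set.Icc (-1 : ℝ) 1, csh x = csh p + t • v → x = p) ∧
      G (csh p + v) = W G P r (τ k + η) ∧ G (csh p - v) = W G P r (τ k - η) := by
  obtain ⟨hη', e, he, hD, -, hop⟩ := hE
  have hc := S.c_pos k
  have hr := S.r_pos
  obtain ⟨h, h0, h1, h2⟩ : ∃ h, 0 < h ∧ h ≤ η' ∧ h * c k < r := by
    refine ⟨min η' (r / c k / 2), lt_min hη' (by positivity), min_le_left _ _, ?_⟩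
    rw [← lt_div_iff₀ hc]
    exact (min_le_right _ _).trans_lt (half_lt_self (by positivity))
  obtain ⟨ε, ⟨e1, e2⟩, e3⟩ := ((S.eventually_beside hG hη h0 h2).and
    ((S.eventually_across hη h0 h2).and self_mem_nhdsWithin)).exists
  have hε : 0 < ε := e3.2
  have hcp : csh (y k + h • D k) = P + h • csh (D k) := by rw [csh_add, csh_smul, S.csh_y]
  refine ⟨e, he, y k + h • D k, hop h h0 h1, ε • (Complex.I * csh (D k)), ?_, e3.1, ?_, ?_⟩
  · have hz : csh (D k) ≠ 0 := by
      rw [S.csh_D]; exact smul_ne_zero hc.ne' (ang_ne _)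
    obtain ⟨sg, hsg, hsg2⟩ : ∃ sg : ℝ, sg ≠ 0 ∧ csh (e.2 - e.1) = sg • csh (D k) := by
      rcases hD with hD | hD
      · exact ⟨1, one_ne_zero, by rw [hD, one_smul]⟩
      · exact ⟨-1, by norm_num, by rw [hD, csh_neg]; simp⟩
    rw [hsg2, LinearIndependent.pair_iff]
    intro a b hab
    have h3 : (a * sg + b * ε * Complex.I : ℂ) * csh (D k) = 0 := by
      rw [← hab]; simp only [Complex.real_smul]; ring
    have h4 := (mul_eq_zero.1 h3).resolve_right hz
    have h5 := congrArg Complex.re h4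
    have h6 := congrArg Complex.im h4
    simp [hsg, hε.ne'] at h5 h6
    exact ⟨h5, h6⟩
  · rw [hcp]; exact e1
  · rw [hcp]; exact e2

lemma jump_link {m : ℕ} {L : PolygonalLink m} {V : Set (E3 × E3)}
    (S : Star (L.carrier ∪ support V) P r y D τ c) (hG : IsDehn L V G) {k : Fin n} {η η' : ℝ}
    (hη : Isolated τ k η) {i : Fin m} (hE : RayOn (L.edges i) (y k) (D k) η') :
    W G P r (τ k + η) * (W G P r (τ k - η))⁻¹ ∈ circleB := by
  obtain ⟨e, he, p, hp, v, h1, h2, h3, h4⟩ := S.exists_jump hG.eq_of_segment hη hE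
  rw [← h3, ← h4]
  exact hG.link i e he p hp v h1 h2

lemma jump_arc {m : ℕ} {L : PolygonalLink m} {V : Set (E3 × E3)}
    (S : Star (L.carrier ∪ support V) P r y D τ c) (hG : IsDehn L V G) {k : Fin n} {η η' : ℝ}
    (hη : Isolated τ k η) (hE : RayOn V (y k) (D k) η') :
    W G P r (τ k + η) = -W G P r (τ k - η) := by
  obtain ⟨e, he, p, hp, v, h1, h2, h3, h4⟩ := S.exists_jump hG.eq_of_segment hη hE
  rw [← h3, ← h4]
  have := hG.arc e he p hp v h1 h2
  rw [mul_inv_eq_iff_eq_mul] at this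
  rw [this, neg_one_mul]

variable {α β γ : ℝ}

/-- Passing a point with no further ray does not change the label. -/
lemma label_two {y D : Fin 2 → E3} {c : Fin 2 → ℝ} (S : Star X P r y D ![α, β] c)
    (hG : ∀ p q, (∀ z ∈ segment ℝ p q, Off X z) → G p = G q)
    (h₁ : α < β) (h₂ : β < α + 2 * Real.pi) :
    ∃ η, (∀ k, Isolated ![α, β] k η) ∧
      W G P r (α + η) * (W G P r (α - η))⁻¹ = W G P r (β - η) * (W G P r (β + η))⁻¹ := by
  obtain ⟨η₀, hη₀⟩ := S.exists_isolated
  obtain ⟨η, h0, h3, h4, h5⟩ : ∃ η, 0 < η ∧ η ≤ η₀ ∧ α + η < β ∧ β + η < α + 2 * Real.pi := by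
    refine ⟨min η₀ (min ((β - α) / 2) ((α + 2 * Real.pi - β) / 2)), ?_, min_le_left _ _, ?_, ?_⟩
    · exact lt_min (hη₀ 0).1 (lt_min (by linarith) (by linarith))
    · have := (min_le_right η₀ _).trans (min_le_left ((β - α) / 2) ((α + 2 * Real.pi - β) / 2))
      linarith
    · have := (min_le_right η₀ _).trans (min_le_right ((β - α) / 2) ((α + 2 * Real.pi - β) / 2))
      linarith
  -- There are only two sectors, on the left and on the right of the strand. The ray `β` points
  -- against the orientation, so its sides appear in the opposite order.
  have e1 : W G P r (α + η) = W G P r (β - η) := by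
    refine S.W_sector hG (a := α) (b := β) h₂.le (fun θ u v k h => ?_) (by linarith) h4
      (by linarith) (by linarith)
    fin_cases k
    · have := eq_of_ang_eq h (abs_lt.2 ⟨by simp; linarith, by simp; linarith⟩)
      simp at this; linarith
    · have := eq_of_ang_eq h (abs_lt.2 ⟨by simp; linarith, by simp; linarith⟩)
      simp at this; linarith
  have e2 : W G P r (α - η) = W G P r (β + η) := by
    rw [← W_add_two_pi (α - η)]
    refine S.W_sector hG (a := β) (b := α + 2 * Real.pi) (by linarith) (fun θ u v k h => ?_)
      (by linarith) (by linarith) (by linarith) (by linarith)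
    fin_cases k
    · have := eq_of_ang_eq h (abs_lt.2 ⟨by simp; linarith, by simp; linarith⟩)
      simp at this; linarith
    · have := eq_of_ang_eq h (abs_lt.2 ⟨by simp; linarith, by simp; linarith⟩)
      simp at this; linarith
  exact ⟨η, fun k => (hη₀ k).mono h0 h3, by rw [e1, e2]⟩

/-- Passing an endpoint of the arc changes the sign of the label. -/
lemma label_three {y D : Fin 3 → E3} {c : Fin 3 → ℝ} (S : Star X P r y D ![α, β, γ] c)
    (hG : ∀ p q, (∀ z ∈ segment ℝ p q, Off X z) → G p = G q)
    (h₁ : α < β) (h₂ : β < α + 2 * Real.pi) (h₃ : α < γ) (h₄ : γ < α + 2 * Real.pi) (h₅ : γ ≠ β)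
    (hj : ∀ η, Isolated ![α, β, γ] 2 η → W G P r (γ + η) = -W G P r (γ - η)) :
    ∃ η, (∀ k, Isolated ![α, β, γ] k η) ∧
      W G P r (α + η) * (W G P r (α - η))⁻¹ = -(W G P r (β - η) * (W G P r (β + η))⁻¹) := by
  obtain ⟨η₀, hη₀⟩ := S.exists_isolated
  have hd : 0 < |γ - β| := abs_pos.2 (sub_ne_zero.2 h₅)
  obtain ⟨η, h0, h3, h4, h5, h6, h7, h8⟩ : ∃ η, 0 < η ∧ η ≤ η₀ ∧ α + η < β ∧
      β + η < α + 2 * Real.pi ∧ α + η < γ ∧ γ + η < α + 2 * Real.pi ∧ η < |γ - β| := by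
    have : ∀ᶠ η in 𝓝[>] (0 : ℝ), 0 < η ∧ η ≤ η₀ ∧ α + η < β ∧
      β + η < α + 2 * Real.pi ∧ α + η < γ ∧ γ + η < α + 2 * Real.pi ∧ η < |γ - β| := by
      filter_upwards [Ioo_mem_nhdsGT (hη₀ 0).1, Ioo_mem_nhdsGT (sub_pos.2 h₁),
        Ioo_mem_nhdsGT (sub_pos.2 h₂), Ioo_mem_nhdsGT (sub_pos.2 h₃), Ioo_mem_nhdsGT (sub_pos.2 h₄),
        Ioo_mem_nhdsGT hd] with η a1 a2 a3 a4 a5 a6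
      exact ⟨a1.1, a1.2.le, by linarith [a2.2], by linarith [a3.2], by linarith [a4.2],
        by linarith [a5.2], a6.2⟩
    exact this.exists
  have hjη := hj η ((hη₀ 2).mono h0 h3)
  have hfree {a b : ℝ} (ha : α ≤ a) (hb : b ≤ α + 2 * Real.pi) (h1 : ¬ (a < β ∧ β < b))
      (h2 : ¬ (a < γ ∧ γ < b)) : ∀ θ, a < θ → θ < b → ∀ k, ang θ ≠ ang (![α, β, γ] k) := by
    intro θ u v k h
    fin_cases k
    · have := eq_of_ang_eq h (abs_lt.2 ⟨by simp; linarith, by simp; linarith⟩)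
      simp at this; linarith
    · have := eq_of_ang_eq h (abs_lt.2 ⟨by simp; linarith, by simp; linarith⟩)
      simp at this; exact h1 ⟨by linarith, by linarith⟩
    · have := eq_of_ang_eq h (abs_lt.2 ⟨by simp; linarith, by simp; linarith⟩)
      simp at this; exact h2 ⟨by linarith, by linarith⟩
  refine ⟨η, fun k => (hη₀ k).mono h0 h3, ?_⟩
  rw [← W_add_two_pi (α - η)]
  -- The arc leaves either to the left of the strand (`γ < β`) or to the right. It splits that side
  -- into two sectors whose values differ by the sign `-1`.
  rcases lt_or_gt_of_ne h₅ with hlt | hlt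
  · rw [abs_of_neg (by linarith)] at h8
    have e1 : W G P r (α + η) = W G P r (γ - η) :=
      S.W_sector hG (a := α) (b := γ) (by linarith)
        (hfree le_rfl h₄.le (by intro h; linarith [h.2]) (by intro h; linarith [h.2]))
        (by linarith) (by linarith) (by linarith) (by linarith)
    have e2 : W G P r (γ + η) = W G P r (β - η) :=
      S.W_sector hG (a := γ) (b := β) (by linarith)
        (hfree h₃.le h₂.le (by intro h; linarith [h.2]) (by intro h; linarith [h.1]))
        (by linarith) (by linarith) (by linarith) (by linarith)
    have e3 : W G P r (α - η + 2 * Real.pi) = W G P r (β + η) :=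
      S.W_sector hG (a := β) (b := α + 2 * Real.pi) (by linarith)
        (hfree h₁.le le_rfl (by intro h; linarith [h.1]) (by intro h; linarith [h.1]))
        (by linarith) (by linarith) (by linarith) (by linarith)
    rw [e3, ← e2, hjη, e1, neg_mul, neg_neg]
  · rw [abs_of_pos (by linarith)] at h8
    have e1 : W G P r (α + η) = W G P r (β - η) :=
      S.W_sector hG (a := α) (b := β) (by linarith)
        (hfree le_rfl h₂.le (by intro h; linarith [h.2]) (by intro h; linarith [h.2]))
        (by linarith) (by linarith) (by linarith) (by linarith)
    have e2 : W G P r (β + η) = W G P r (γ - η) :=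
      S.W_sector hG (a := β) (b := γ) (by linarith)
        (hfree h₁.le h₄.le (by intro h; linarith [h.1]) (by intro h; linarith [h.2]))
        (by linarith) (by linarith) (by linarith) (by linarith)
    have e3 : W G P r (α - η + 2 * Real.pi) = W G P r (γ + η) :=
      S.W_sector hG (a := γ) (b := α + 2 * Real.pi) (by linarith)
        (hfree h₃.le le_rfl (by intro h; linarith [h.1]) (by intro h; linarith [h.1]))
        (by linarith) (by linarith) (by linarith) (by linarith)
    rw [e3, hjη, e1, e2, inv_neg, mul_neg]

lemma free_four (h₁ : α < γ) (h₂ : γ < α + Real.pi) {a b : ℝ} (ha : α ≤ a)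
    (hb : b ≤ α + 2 * Real.pi) (h3 : ¬ (a < γ ∧ γ < b)) (h4 : ¬ (a < α + Real.pi ∧ α + Real.pi < b))
    (h5 : ¬ (a < γ + Real.pi ∧ γ + Real.pi < b)) :
    ∀ θ, a < θ → θ < b → ∀ k, ang θ ≠ ang (![α, α + Real.pi, γ, γ + Real.pi] k) := by
  intro θ u v k h
  have := Real.pi_pos
  fin_cases k
  · have := eq_of_ang_eq h (abs_lt.2 ⟨by simp; linarith, by simp; linarith⟩)
    simp at this; linarith
  · have := eq_of_ang_eq h (abs_lt.2 ⟨by simp; linarith, by simp; linarith⟩)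
    simp at this; exact h4 ⟨by linarith, by linarith⟩
  · have := eq_of_ang_eq h (abs_lt.2 ⟨by simp; linarith, by simp; linarith⟩)
    simp at this; exact h3 ⟨by linarith, by linarith⟩
  · have := eq_of_ang_eq h (abs_lt.2 ⟨by simp; linarith, by simp; linarith⟩)
    simp at this; exact h5 ⟨by linarith, by linarith⟩

/-- The four sectors at a crossing. -/
lemma sectors_four {y D : Fin 4 → E3} {c : Fin 4 → ℝ}
    (S : Star X P r y D ![α, α + Real.pi, γ, γ + Real.pi] c)
    (hG : ∀ p q, (∀ z ∈ segment ℝ p q, Off X z) → G p = G q)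
    (h₁ : α < γ) (h₂ : γ < α + Real.pi) :
    ∃ η, (∀ k, Isolated ![α, α + Real.pi, γ, γ + Real.pi] k η) ∧
      W G P r (α + η) = W G P r (γ - η) ∧ W G P r (γ + η) = W G P r (α + Real.pi - η) ∧
      W G P r (α + Real.pi + η) = W G P r (γ + Real.pi - η) ∧
      W G P r (γ + Real.pi + η) = W G P r (α - η) ∧
      (∀ φ ρ, 0 < ρ → ρ < r → α < φ → φ < γ → G (P + ρ • ang φ) = W G P r (α + η)) ∧
      (∀ φ ρ, 0 < ρ → ρ < r → γ < φ → φ < α + Real.pi → G (P + ρ • ang φ) = W G P r (γ + η)) ∧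
      (∀ φ ρ, 0 < ρ → ρ < r → α + Real.pi < φ → φ < γ + Real.pi →
        G (P + ρ • ang φ) = W G P r (α + Real.pi + η)) ∧
      (∀ φ ρ, 0 < ρ → ρ < r → γ + Real.pi < φ → φ < α + 2 * Real.pi →
        G (P + ρ • ang φ) = W G P r (γ + Real.pi + η)) := by
  obtain ⟨η₀, hη₀⟩ := S.exists_isolated
  have hpi := Real.pi_pos
  have hr := S.r_pos
  obtain ⟨η, h0, h3, h4, h5⟩ : ∃ η, 0 < η ∧ η ≤ η₀ ∧ α + η < γ ∧ γ + η < α + Real.pi := by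
    refine ⟨min η₀ (min ((γ - α) / 2) ((α + Real.pi - γ) / 2)), ?_, min_le_left _ _, ?_, ?_⟩
    · exact lt_min (hη₀ 0).1 (lt_min (by linarith) (by linarith))
    · have := (min_le_right η₀ _).trans (min_le_left ((γ - α) / 2) ((α + Real.pi - γ) / 2))
      linarith
    · have := (min_le_right η₀ _).trans (min_le_right ((γ - α) / 2) ((α + Real.pi - γ) / 2))
      linarith
  have f1 := free_four (a := α) (b := γ) h₁ h₂ le_rfl (by linarith) (by intro h; linarith [h.2])
    (by intro h; linarith [h.2]) (by intro h; linarith [h.2])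
  have f2 := free_four (a := γ) (b := α + Real.pi) h₁ h₂ h₁.le (by linarith)
    (by intro h; linarith [h.1]) (by intro h; linarith [h.2]) (by intro h; linarith [h.2])
  have f3 := free_four (a := α + Real.pi) (b := γ + Real.pi) h₁ h₂ (by linarith) (by linarith)
    (by intro h; linarith [h.1]) (by intro h; linarith [h.1]) (by intro h; linarith [h.2])
  have f4 := free_four (a := γ + Real.pi) (b := α + 2 * Real.pi) h₁ h₂ (by linarith) le_rfl
    (by intro h; linarith [h.1]) (by intro h; linarith [h.1]) (by intro h; linarith [h.1])
  refine ⟨η, fun k => (hη₀ k).mono h0 h3, ?_, ?_, ?_, ?_, ?_, ?_, ?_, ?_⟩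
  · exact S.W_sector hG (by linarith) f1 (by linarith) (by linarith) (by linarith) (by linarith)
  · exact S.W_sector hG (by linarith) f2 (by linarith) (by linarith) (by linarith) (by linarith)
  · exact S.W_sector hG (by linarith) f3 (by linarith) (by linarith) (by linarith) (by linarith)
  · rw [← W_add_two_pi (α - η)]
    exact S.W_sector hG (by linarith) f4 (by linarith) (by linarith) (by linarith) (by linarith)
  · intro φ ρ a1 a2 a3 a4
    exact S.sector hG (by linarith) f1 a3 a4 (by linarith) (by linarith) a1 a2
      (by linarith) (by linarith)
  · intro φ ρ a1 a2 a3 a4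
    exact S.sector hG (by linarith) f2 a3 a4 (by linarith) (by linarith) a1 a2
      (by linarith) (by linarith)
  · intro φ ρ a1 a2 a3 a4
    exact S.sector hG (by linarith) f3 a3 a4 (by linarith) (by linarith) a1 a2
      (by linarith) (by linarith)
  · intro φ ρ a1 a2 a3 a4
    exact S.sector hG (by linarith) f4 a3 a4 (by linarith) (by linarith) a1 a2
      (by linarith) (by linarith)

/-- Crossing the arc does not change the label. -/
lemma label_four_arc {y D : Fin 4 → E3} {c : Fin 4 → ℝ}
    (S : Star X P r y D ![α, α + Real.pi, γ, γ + Real.pi] c)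
    (hG : ∀ p q, (∀ z ∈ segment ℝ p q, Off X z) → G p = G q)
    (h₁ : α < γ) (h₂ : γ < α + Real.pi)
    (hj : ∀ η, Isolated ![α, α + Real.pi, γ, γ + Real.pi] 2 η →
      W G P r (γ + η) = -W G P r (γ - η))
    (hj' : ∀ η, Isolated ![α, α + Real.pi, γ, γ + Real.pi] 3 η →
      W G P r (γ + Real.pi + η) = -W G P r (γ + Real.pi - η)) :
    ∃ η, (∀ k, Isolated ![α, α + Real.pi, γ, γ + Real.pi] k η) ∧
      W G P r (α + η) * (W G P r (α - η))⁻¹ =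
        W G P r (α + Real.pi - η) * (W G P r (α + Real.pi + η))⁻¹ := by
  obtain ⟨η, hη, e1, e2, e3, e4, -⟩ := S.sectors_four hG h₁ h₂
  refine ⟨η, hη, ?_⟩
  -- The arc changes the sign of `G` on both sides of the strand, and the two signs cancel in the
  -- quotient.
  rw [e1, ← e4, ← e2, e3, hj η (hη 2), hj' η (hη 3), inv_neg, neg_mul, mul_neg]

/-- The labels at a crossing, where the strand of the rays `0` and `1` passes under the strand of
the rays `2` and `3`. -/
lemma label_four_link {m : ℕ} {L : PolygonalLink m} {V : Set (E3 × E3)} {y D : Fin 4 → E3}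
    {c : Fin 4 → ℝ}
    (S : Star (L.carrier ∪ support V) P r y D ![α, α + Real.pi, γ, γ + Real.pi] c)
    (hG : IsDehn L V G) (h₁ : α < γ) (h₂ : γ < α + Real.pi) (hy₁ : y 1 = y 0) (hD₁ : D 1 = -D 0)
    (hy₃ : y 3 = y 2) (hD₃ : D 3 = -D 2) (hlt : height (y 0) < height (y 2)) :
    ∃ η, (∀ k, Isolated ![α, α + Real.pi, γ, γ + Real.pi] k η) ∧
      W G P r (γ + Real.pi + η) * (W G P r (γ + Real.pi - η))⁻¹ =
        W G P r (γ - η) * (W G P r (γ + η))⁻¹ ∧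
      W G P r (α + η) * (W G P r (α - η))⁻¹ =
        (W G P r (γ - η) * (W G P r (γ + η))⁻¹) *
          (W G P r (α + Real.pi - η) * (W G P r (α + Real.pi + η))⁻¹) *
          (W G P r (γ - η) * (W G P r (γ + η))⁻¹)⁻¹ := by
  obtain ⟨η, hη, e1, e2, e3, e4, k1, k2, k3, k4⟩ := S.sectors_four hG.eq_of_segment h₁ h₂
  have hpi := Real.pi_pos
  have hr := S.r_pos
  have hc0 := S.c_pos 0
  have hc2 := S.c_pos 2
  have hD0 : csh (D 0) = c 0 • ang α := S.csh_D 0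
  have hD2 : csh (D 2) = c 2 • ang γ := S.csh_D 2
  -- The separating level is `height (y 0) + δ`, halfway between the strands; `t` is so small that
  -- neither strand deviates by `δ` over the parallelogram, which also stays in the disc of radius
  -- `r`.
  set δ := (height (y 2) - height (y 0)) / 2 with hδ
  have hδ0 : 0 < δ := by rw [hδ]; linarith
  obtain ⟨t, ht0, ht1, ht2, ht3⟩ : ∃ t : ℝ, 0 < t ∧ t * (c 0 + c 2) < r ∧
      t * |height (D 0)| < δ ∧ t * |height (D 2)| < δ := by
    have aux (a b : ℝ) (hb : 0 < b) : ∀ᶠ t in 𝓝[>] (0 : ℝ), t * a < b :=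
      (ContinuousAt.eventually_lt (f := fun t : ℝ => t * a) (g := fun _ => b) (by fun_prop)
        continuousAt_const (by simpa using hb)).filter_mono nhdsWithin_le_nhds
    obtain ⟨t, h⟩ := ((aux (c 0 + c 2) r hr).and ((aux |height (D 0)| δ hδ0).and
      ((aux |height (D 2)| δ hδ0).and self_mem_nhdsWithin))).exists
    exact ⟨t, h.2.2.2, h.1, h.2.1, h.2.2.1⟩
  have tc0 := mul_pos ht0 hc0
  have tc2 := mul_pos ht0 hc2
  have hli : ∀ u v u' v' : ℝ, u • ang α + v • ang γ = u' • ang α + v' • ang γ →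
      u = u' ∧ v = v' := by
    have him : ((ang γ) * ang (-α)).im ≠ 0 := by
      rw [← ang_add, ang, Complex.exp_ofReal_mul_I_im]
      exact (Real.sin_pos_of_pos_of_lt_pi (by linarith) (by linarith)).ne'
    intro u v u' v' h
    have h' : ((u - u' : ℝ) : ℂ) + ((v - v' : ℝ) : ℂ) * (ang γ * ang (-α)) = 0 := by
      have h1 : ang α * ang (-α) = 1 := by rw [← ang_add, add_neg_cancel]; simp [ang]
      simp only [Complex.real_smul] at h
      push_cast
      linear_combination ang (-α) * h - (u - u' : ℂ) * h1
    have h5 := congrArg Complex.im h'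
    rw [Complex.add_im, Complex.ofReal_im, zero_add, Complex.im_ofReal_mul, Complex.zero_im] at h5
    have h6 := (mul_eq_zero.1 h5).resolve_right him
    rw [h6] at h'
    have h7 := congrArg Complex.re h'
    simp at h7
    exact ⟨by linarith, by linarith⟩
  -- A point of the link or arc over the parallelogram lies on one of the four rays. Independence of
  -- the two directions puts it on an axis of the parallelogram, and the choice of `t` puts it on
  -- the correct side of the level.
  have hrel := hG.crossing P (t • csh (D 2)) (t • csh (D 0)) (height (y 0) + δ) (by
    intro x hx s hs s' hs' e
    have hbound : ‖csh x - P‖ < r := by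
      rw [e, add_assoc, add_sub_cancel_left, hD0, hD2]
      refine (norm_add_le _ _).trans_lt ?_
      simp only [norm_smul, norm_ang, mul_one, Real.norm_eq_abs, abs_of_pos ht0, abs_of_pos hc0,
        abs_of_pos hc2]
      have := abs_le.2 hs
      have := abs_le.2 hs'
      nlinarith
    obtain ⟨k, h, hh, rfl⟩ := S.near x hx hbound
    have hk : csh (y k) = P := S.csh_y k
    rw [csh_add, csh_smul, hk, add_assoc] at e
    replace e := add_left_cancel e
    rw [hD0, hD2, smul_smul, smul_smul, smul_smul, smul_smul, add_comm] at e
    have hhD0 : ∀ w : ℝ, |w| ≤ t → |w * height (D 0)| < δ := fun w hw => by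
      rw [abs_mul]
      exact (mul_le_mul_of_nonneg_right hw (abs_nonneg _)).trans_lt ht2
    have hhD2 : ∀ w : ℝ, |w| ≤ t → |w * height (D 2)| < δ := fun w hw => by
      rw [abs_mul]
      exact (mul_le_mul_of_nonneg_right hw (abs_nonneg _)).trans_lt ht3
    have hs1 := abs_le.2 hs
    have hs1' := abs_le.2 hs'
    have habs (w : ℝ) (hw : |w| ≤ 1) : |w * t| ≤ t := by
      rw [abs_mul, abs_of_pos ht0]; nlinarith
    have und (w : ℝ) (e : (w * c 0) • ang α = (s' * t * c 0) • ang α + (s * t * c 2) • ang γ) :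
        s = 0 ∧ |w| ≤ t := by
      obtain ⟨q1, q2⟩ := hli (w * c 0) 0 (s' * t * c 0) (s * t * c 2) (by rw [zero_smul, add_zero]; exact e)
      have q3 : s = 0 := by
        rw [mul_assoc] at q2
        exact (mul_eq_zero.1 q2.symm).resolve_right tc2.ne'
      have q4 : w = s' * t := mul_right_cancel₀ hc0.ne' q1
      exact ⟨q3, q4 ▸ habs s' hs1'⟩
    have ovr (w : ℝ) (e : (w * c 2) • ang γ = (s' * t * c 0) • ang α + (s * t * c 2) • ang γ) :
        s' = 0 ∧ |w| ≤ t := by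
      obtain ⟨q1, q2⟩ := hli 0 (w * c 2) (s' * t * c 0) (s * t * c 2) (by rw [zero_smul, zero_add]; exact e)
      have q3 : s' = 0 := by
        rw [mul_assoc] at q1
        exact (mul_eq_zero.1 q1.symm).resolve_right tc0.ne'
      have q4 : w = s * t := mul_right_cancel₀ hc2.ne' q2
      exact ⟨q3, q4 ▸ habs s hs1⟩
    rw [height_add, height_smul]
    fin_cases k
    · simp only [Fin.zero_eta] at e ⊢
      rw [hD0, smul_smul] at e
      obtain ⟨q1, q2⟩ := und h e
      exact Or.inr ⟨q1, by linarith [(abs_lt.1 (hhD0 h q2)).2]⟩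
    · simp only [Fin.mk_one] at e ⊢
      rw [hD₁, csh_neg, hD0, smul_neg, smul_smul, ← neg_smul, ← neg_mul] at e
      obtain ⟨q1, q2⟩ := und (-h) e
      rw [hy₁, hD₁, height_neg, mul_neg, ← neg_mul]
      exact Or.inr ⟨q1, by linarith [(abs_lt.1 (hhD0 (-h) q2)).2]⟩
    · simp only [Fin.reduceFinMk] at e ⊢
      rw [hD2, smul_smul] at e
      obtain ⟨q1, q2⟩ := ovr h e
      exact Or.inl ⟨q1, by linarith [(abs_lt.1 (hhD2 h q2)).1]⟩
    · simp only [Fin.reduceFinMk] at e ⊢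
      rw [hD₃, csh_neg, hD2, smul_neg, smul_smul, ← neg_smul, ← neg_mul] at e
      obtain ⟨q1, q2⟩ := ovr (-h) e
      rw [hy₃, hD₃, height_neg, mul_neg, ← neg_mul]
      exact Or.inl ⟨q1, by linarith [(abs_lt.1 (hhD2 (-h) q2)).1]⟩)
  have hnorm {u v ρ a b φ : ℝ} (hu : 0 < u) (hv : 0 < v) (hρ : 0 < ρ) (huv : u + v < r)
      (e : u • ang a + v • ang b = ρ • ang φ) : ρ < r := by
    have := congrArg norm e
    rw [norm_smul ρ, norm_ang, mul_one, Real.norm_of_nonneg hρ.le] at this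
    rw [← this]
    refine (norm_add_le _ _).trans_lt ?_
    rwa [norm_smul, norm_smul, norm_ang, norm_ang, mul_one, mul_one, Real.norm_of_nonneg hu.le,
      Real.norm_of_nonneg hv.le]
  have corner1 : G (P + t • csh (D 2) + t • csh (D 0)) = W G P r (α + η) := by
    obtain ⟨φ, ρ, a1, a2, a3, a4⟩ := exists_ang_between h₁ h₂ tc0 tc2
    rw [← k1 φ ρ a3 (hnorm tc0 tc2 a3 (by linarith) a4) a1 a2, ← a4, hD0, hD2]
    congr 1; module
  have corner2 : G (P + t • csh (D 2) - t • csh (D 0)) = W G P r (γ + η) := by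
    obtain ⟨φ, ρ, a1, a2, a3, a4⟩ := exists_ang_between (α := γ) (γ := α + Real.pi) h₂
      (by linarith) tc2 tc0
    rw [← k2 φ ρ a3 (hnorm tc2 tc0 a3 (by linarith) a4) a1 a2, ← a4, hD0, hD2, ang_add_pi]
    congr 1; module
  have corner3 : G (P - t • csh (D 2) - t • csh (D 0)) = W G P r (α + Real.pi + η) := by
    obtain ⟨φ, ρ, a1, a2, a3, a4⟩ := exists_ang_between (α := α + Real.pi) (γ := γ + Real.pi)
      (by linarith) (by linarith) tc0 tc2
    rw [← k3 φ ρ a3 (hnorm tc0 tc2 a3 (by linarith) a4) a1 a2, ← a4, hD0, hD2, ang_add_pi,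
      ang_add_pi]
    congr 1; module
  have corner4 : G (P - t • csh (D 2) + t • csh (D 0)) = W G P r (γ + Real.pi + η) := by
    obtain ⟨φ, ρ, a1, a2, a3, a4⟩ := exists_ang_between (α := γ + Real.pi)
      (γ := α + 2 * Real.pi) (by linarith) (by linarith) tc2 tc0
    rw [← k4 φ ρ a3 (hnorm tc2 tc0 a3 (by linarith) a4) a1 a2, ← a4, hD0, hD2, ang_add_pi,
      ang_add_two_pi]
    congr 1; module
  rw [corner1, corner2, corner3, corner4] at hrel
  -- The Dehn relation itself says that the over label is the same before and after the crossing.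
  -- Solved for the corner next to `α`, it becomes the conjugation rule for the under label.
  refine ⟨η, hη, ?_, ?_⟩
  · rw [← e3, ← e1, ← hrel]
  · have h6 : W G P r (α + η) = W G P r (γ + Real.pi + η) * (W G P r (α + Real.pi + η))⁻¹ *
        W G P r (γ + η) := by rw [← hrel]; group
    rw [← e1, ← e2, ← e4, h6]
    group

end Star

end MarkedLink

end

noncomputable section

namespace MarkedLink

open Filter Topology

/-! ### Consequences of general position -/

section GeneralPosition

variable {m : ℕ} {L : PolygonalLink m} {ω : PolygonalArc}

lemma GeneralPosition.triple (h : GeneralPosition L ω) {x y z : E3}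
    (hx : x ∈ L.carrier ∪ support ω.edges) (hy : y ∈ L.carrier ∪ support ω.edges)
    (hz : z ∈ L.carrier ∪ support ω.edges) (h₁ : csh x = csh y) (h₂ : csh z = csh y)
    (hxy : x ≠ y) : z = x ∨ z = y := by
  rcases h.1 x hx y hy z hz (shadow_eq_iff.2 h₁) (shadow_eq_iff.2 h₂.symm) with e | e | e
  · exact absurd e hxy
  · exact Or.inr e.symm
  · exact Or.inl e.symm

lemma GeneralPosition.vertex (h : GeneralPosition L ω) {x : E3}
    (hx : x ∈ L.carrier ∪ support ω.edges) {i : Fin m} {j : ZMod (L.len i)}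
    (e : csh x = csh (L.vertex i j)) : x = L.vertex i j :=
  h.2.1 i j x hx (shadow_eq_iff.2 e)

lemma GeneralPosition.arcVertex (h : GeneralPosition L ω) {x : E3}
    (hx : x ∈ L.carrier ∪ support ω.edges) {k : ℕ} (hk : k ≤ ω.len)
    (e : csh x = csh (ω.vertex k)) : x = ω.vertex k :=
  h.2.2 k hk x hx (shadow_eq_iff.2 e)

lemma vertex_mem (i : Fin m) (n : ℤ) : L.vertex i n ∈ L.carrier ∪ support ω.edges :=
  Or.inl (L.curve_int i n ▸ L.curve_mem_carrier i n)

lemma arcVertex_mem {k : ℕ} (hk : k ≤ ω.len) : ω.vertex k ∈ L.carrier ∪ support ω.edges :=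
  Or.inr (ω.mem_support_edges.2 ⟨k, ⟨by positivity, by exact_mod_cast hk⟩, (ω.curve_nat k).symm⟩)

/-- The edges of a component or of the arc. -/
def IsPart (L : PolygonalLink m) (ω : PolygonalArc) (E : Set (E3 × E3)) : Prop :=
  (∃ i, E = L.edges i) ∨ E = ω.edges

lemma IsPart.segment_subset {E : Set (E3 × E3)} (hE : IsPart L ω E) {e : E3 × E3} (he : e ∈ E) :
    segment ℝ e.1 e.2 ⊆ L.carrier ∪ support ω.edges := by
  intro x hx
  rcases hE with ⟨i, rfl⟩ | rfl
  · exact Or.inl (Set.mem_iUnion.2 ⟨i, mem_support.2 ⟨e, he, hx⟩⟩)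
  · exact Or.inr (mem_support.2 ⟨e, he, hx⟩)

lemma IsPart.endpoint {E : Set (E3 × E3)} (hgp : GeneralPosition L ω) (hE : IsPart L ω E)
    {e : E3 × E3} (he : e ∈ E) :
    (∀ x ∈ L.carrier ∪ support ω.edges, csh x = csh e.1 → x = e.1) ∧
    (∀ x ∈ L.carrier ∪ support ω.edges, csh x = csh e.2 → x = e.2) := by
  rcases hE with ⟨i, rfl⟩ | rfl
  · obtain ⟨j, rfl⟩ := he
    exact ⟨fun x hx h => hgp.vertex hx h, fun x hx h => hgp.vertex hx h⟩
  · obtain ⟨k, hk, rfl⟩ := he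
    exact ⟨fun x hx h => hgp.arcVertex hx hk.le h, fun x hx h => hgp.arcVertex hx hk h⟩

lemma GeneralPosition.csh_vertex_ne (hgp : GeneralPosition L ω) (i : Fin m) (n : ℤ) :
    csh (L.vertex i n) ≠ csh (L.vertex i (n + 1)) := fun h =>
  L.vertex_ne i n (hgp.vertex (vertex_mem i n) h)

lemma GeneralPosition.csh_arcVertex_ne (hgp : GeneralPosition L ω) {n : ℕ} (h : n < ω.len) :
    csh (ω.vertex n) ≠ csh (ω.vertex (n + 1)) := fun h1 =>
  ω.vertex_ne h (hgp.arcVertex (arcVertex_mem h.le) h h1)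

lemma GeneralPosition.csh_dirOut_ne (hgp : GeneralPosition L ω) (i : Fin m) (s : ℝ) :
    csh (L.dirOut i s) ≠ 0 := by
  rw [PolygonalLink.dirOut, csh_sub, sub_ne_zero]
  push_cast
  exact (hgp.csh_vertex_ne i ⌊s⌋).symm

lemma GeneralPosition.csh_dirIn_ne (hgp : GeneralPosition L ω) (i : Fin m) (s : ℝ) :
    csh (-L.dirIn i s) ≠ 0 := by
  rw [csh_neg, neg_ne_zero, PolygonalLink.dirIn, csh_sub, sub_ne_zero]
  have := hgp.csh_vertex_ne i (⌈s⌉ - 1)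
  push_cast at this ⊢
  rw [sub_add_cancel] at this
  exact this.symm

/-- Two rays in the same direction of the plane coincide. -/
lemma GeneralPosition.ray_eq (hgp : GeneralPosition L ω) {E E' : Set (E3 × E3)}
    (hE : IsPart L ω E) (hE' : IsPart L ω E') {y D y' D' : E3} {η η' c c' τ τ' : ℝ}
    (h : RayOn E y D η) (h' : RayOn E' y' D' η') (hy : csh y = csh y') (hc : 0 < c) (hc' : 0 < c')
    (hD : csh D = c • ang τ) (hD' : csh D' = c' • ang τ') (hτ : ang τ = ang τ') :
    y = y' ∧ ∀ᶠ δ in 𝓝[>] (0 : ℝ), y + (δ / c) • D = y' + (δ / c') • D' := by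
  obtain ⟨hη, e, he, -, hye, ho⟩ := h
  obtain ⟨hη', e', he', -, hye', ho'⟩ := h'
  -- Dividing by `c` and `c'` puts both points over the same shadow point, at distance `δ` from the
  -- common start. The two edges thus overlap in projection, and `eq_of_overlap` applies.
  have key : ∀ᶠ δ in 𝓝[>] (0 : ℝ), y + (δ / c) • D = y' + (δ / c') • D' ∧ y = y' := by
    filter_upwards [Ioo_mem_nhdsGT (mul_pos hη hc), Ioo_mem_nhdsGT (mul_pos hη' hc')] with δ h1 h2
    have h3 : 0 < δ / c := div_pos h1.1 hc
    have h4 : 0 < δ / c' := div_pos h1.1 hc'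
    have e1 : csh (y + (δ / c) • D) = csh y + δ • ang τ := by
      rw [csh_add, csh_smul, hD, smul_smul, div_mul_cancel₀ _ hc.ne']
    have e2 : csh (y' + (δ / c') • D') = csh y + δ • ang τ := by
      rw [csh_add, csh_smul, hD', smul_smul, div_mul_cancel₀ _ hc'.ne', hy, hτ]
    refine eq_of_overlap (hE.segment_subset he) (hE'.segment_subset he') (hE.endpoint hgp he).1
      (hE.endpoint hgp he).2 (hE'.endpoint hgp he').1 (hE'.endpoint hgp he').2
      (openSegment_subset_segment ℝ _ _ (ho _ h3 ((div_le_iff₀ hc).2 h1.2.le))) hye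
      (openSegment_subset_segment ℝ _ _ (ho' _ h4 ((div_le_iff₀ hc').2 h2.2.le))) hye'
      (e1.trans e2.symm) hy ?_
    rw [e1]
    intro h5
    rw [add_eq_left] at h5
    exact smul_ne_zero h1.1.ne' (ang_ne τ) h5
  obtain ⟨δ, hδ⟩ := key.exists
  exact ⟨hδ.2, key.mono fun _ h => h.1⟩

/-- There are finitely many edges, so one radius localizes all of them: a point of the link or arc
whose shadow is near `P` has a parameter near that of a point exactly over `P`. -/
lemma GeneralPosition.eventually_near (hgp : GeneralPosition L ω) (P : ℂ) {η : ℝ} (hη : 0 < η) :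
    ∀ᶠ r in 𝓝[>] (0 : ℝ), ∀ x ∈ L.carrier ∪ support ω.edges, ‖csh x - P‖ < r →
      (∃ i t t', x = L.curve i t ∧ csh (L.curve i t') = P ∧ |t - t'| < η) ∨
      (∃ t ∈ Set.Icc (0 : ℝ) ω.len, ∃ t' ∈ Set.Icc (0 : ℝ) ω.len,
        x = ω.curve t ∧ csh (ω.curve t') = P ∧ |t - t'| < η) := by
  have h1 : ∀ᶠ r in 𝓝[>] (0 : ℝ), ∀ i, ∀ j : ZMod (L.len i), ∀ μ ∈ Set.Icc (0 : ℝ) 1,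
      ‖csh (L.vertex i j + μ • (L.vertex i (j + 1) - L.vertex i j)) - P‖ < r →
      ∃ ν ∈ Set.Icc (0 : ℝ) 1,
        csh (L.vertex i j + ν • (L.vertex i (j + 1) - L.vertex i j)) = P ∧ |μ - ν| < η := by
    rw [eventually_all]; intro i
    rw [eventually_all]; intro j
    obtain ⟨n, rfl⟩ := ZMod.intCast_surjective j
    exact eventually_near_segment (hgp.csh_vertex_ne i n) P hη
  have h2 : ∀ᶠ r in 𝓝[>] (0 : ℝ), ∀ k : Fin ω.len, ∀ μ ∈ Set.Icc (0 : ℝ) 1,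
      ‖csh (ω.vertex k + μ • (ω.vertex (k + 1) - ω.vertex k)) - P‖ < r →
      ∃ ν ∈ Set.Icc (0 : ℝ) 1,
        csh (ω.vertex k + ν • (ω.vertex (k + 1) - ω.vertex k)) = P ∧ |μ - ν| < η := by
    rw [eventually_all]; intro k
    exact eventually_near_segment (hgp.csh_arcVertex_ne k.2) P hη
  filter_upwards [h1, h2] with r h1 h2 x hx hr
  rcases hx with hx | hx
  · left
    obtain ⟨i, s, rfl⟩ := L.mem_carrier.1 hx
    have e := L.curve_int_add i ⌊s⌋ (Int.fract_nonneg s) (Int.fract_lt_one s).le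
    have e0 := Int.floor_add_fract s
    rw [e0] at e
    obtain ⟨ν, hν, e1, e2⟩ := h1 i (⌊s⌋ : ℤ) (Int.fract s)
      ⟨Int.fract_nonneg s, (Int.fract_lt_one s).le⟩ (by rw [← e]; exact hr)
    refine ⟨i, s, ⌊s⌋ + ν, rfl, ?_, ?_⟩
    · rw [L.curve_int_add i _ hν.1 hν.2]; exact e1
    · have : s - (⌊s⌋ + ν) = Int.fract s - ν := by rw [Int.fract]; ring
      rw [this]; exact e2
  · right
    obtain ⟨t, ht, rfl⟩ := ω.mem_support_edges.1 hx
    obtain ⟨n, hn, μ, hμ, rfl⟩ := ω.exists_nat_add ht.1 ht.2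
    obtain ⟨ν, hν, e1, e2⟩ := h2 ⟨n, hn⟩ μ hμ (by
      rw [ω.curve_nat_add n hμ.1 hμ.2] at hr; exact hr)
    have hn' : (n : ℝ) + 1 ≤ ω.len := by exact_mod_cast hn
    refine ⟨_, ht, n + ν, ⟨add_nonneg (Nat.cast_nonneg n) hν.1, by linarith [hν.2]⟩, rfl, ?_, ?_⟩
    · rw [ω.curve_nat_add n hν.1 hν.2]; exact e1
    · rw [add_sub_add_left_eq_sub]; exact e2

/-- The strand of the link at parameter `s`: the two rays, and all nearby points are on them. -/
lemma exists_strand (L : PolygonalLink m) (i : Fin m) (s : ℝ) : ∃ η, 0 < η ∧ η ≤ 1 / 2 ∧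
    RayOn (L.edges i) (L.curve i s) (L.dirOut i s) η ∧
    RayOn (L.edges i) (L.curve i s) (-L.dirIn i s) η ∧
    (∀ h, 0 < h → h ≤ η → L.curve i (s + h) = L.curve i s + h • L.dirOut i s ∧
      L.dirOut i (s + h) = L.dirOut i s) ∧
    (∀ h, 0 < h → h ≤ η → L.curve i (s - h) = L.curve i s + h • (-L.dirIn i s) ∧
      L.dirOut i (s - h) = L.dirIn i s) ∧
    (∀ j t t', L.curve j t' = L.curve i s → |t - t'| < η →
      ∃ h : ℝ, 0 ≤ h ∧ (L.curve j t = L.curve i s + h • L.dirOut i s ∨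
        L.curve j t = L.curve i s + h • (-L.dirIn i s))) := by
  obtain ⟨η, h0, h1, h2, h3, h4, h5⟩ := L.exists_local i s
  refine ⟨η, h0, h1, ⟨h0, _, L.edge_mem i ⌊s⌋, Or.inl ?_, ?_, fun h a b => ?_⟩,
    ⟨h0, _, L.edge_mem i (⌈s⌉ - 1), Or.inr ?_, ?_, fun h a b => ?_⟩, fun h a b => ?_,
    fun h a b => ?_, fun j t t' e ht => ?_⟩
  · rw [PolygonalLink.dirOut]; push_cast; rfl
  · simpa using (h2 0 le_rfl h0.le).2
  · rw [← (h2 h a.le b).1]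
    have := L.curve_mem_openSegment i (h4 h a b).2
    rwa [(h4 h a b).1] at this
  · rw [PolygonalLink.dirIn]; push_cast; rw [sub_add_cancel]
  · simpa using (h3 0 le_rfl h0.le).2
  · rw [← (h3 h a.le b).1]
    have := L.curve_mem_openSegment i (h5 h a b).2
    rwa [(h5 h a b).1] at this
  · exact ⟨(h2 h a.le b).1, by rw [PolygonalLink.dirOut, (h4 h a b).1]; rfl⟩
  · exact ⟨(h3 h a.le b).1, by
      rw [PolygonalLink.dirOut, (h5 h a b).1, sub_add_cancel]; rfl⟩
  · obtain ⟨rfl, k, rfl⟩ := L.curve_inj e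
    have e1 : L.curve j t = L.curve j (s + (t - (s + k * L.len j))) := by
      rw [← L.curve_add_len j (s + (t - (s + k * L.len j))) k]
      congr 1; ring
    rw [e1]
    rcases le_total 0 (t - (s + k * L.len j)) with h | h
    · exact ⟨_, h, Or.inl (h2 _ h ((le_abs_self _).trans ht.le)).1⟩
    · refine ⟨-(t - (s + k * L.len j)), by linarith, Or.inr ?_⟩
      rw [← (h3 _ (by linarith) ((neg_le_abs _).trans ht.le)).1]
      congr 1; ring

/-- The strand of the arc at an interior point that is not a vertex. -/
lemma exists_arc_strand (hgp : GeneralPosition L ω) {n : ℕ} (hn : n < ω.len) {μ : ℝ} (h0 : 0 < μ)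
    (h1 : μ < 1) : ∃ η D, csh D ≠ 0 ∧ 0 < η ∧ RayOn ω.edges (ω.curve (n + μ)) D η ∧
      RayOn ω.edges (ω.curve (n + μ)) (-D) η ∧
      ∀ t ∈ Set.Icc (0 : ℝ) ω.len, ∀ t' ∈ Set.Icc (0 : ℝ) ω.len, ω.curve t' = ω.curve (n + μ) →
        |t - t'| < η → ∃ h : ℝ, 0 ≤ h ∧ (ω.curve t = ω.curve (n + μ) + h • D ∨
          ω.curve t = ω.curve (n + μ) + h • (-D)) := by
  have hn' : (n : ℝ) + 1 ≤ ω.len := by exact_mod_cast hn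
  have hn0 : (0 : ℝ) ≤ n := Nat.cast_nonneg n
  have hc (ν : ℝ) (a : 0 ≤ ν) (b : ν ≤ 1) := ω.curve_nat_add n a b
  have hlin (h : ℝ) : ω.curve (n + μ) + h • (ω.vertex (n + 1) - ω.vertex n) =
      ω.vertex n + (μ + h) • (ω.vertex (n + 1) - ω.vertex n) := by
    rw [hc μ h0.le h1.le]; module
  have hop (h : ℝ) (a : 0 < μ + h) (b : μ + h < 1) :
      ω.curve (n + μ) + h • (ω.vertex (n + 1) - ω.vertex n) ∈
        openSegment ℝ (ω.vertex n) (ω.vertex (n + 1)) := by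
    rw [hlin, openSegment_eq_image']; exact ⟨_, ⟨a, b⟩, rfl⟩
  have hη : 0 < min (μ / 2) ((1 - μ) / 2) := lt_min (by linarith) (by linarith)
  refine ⟨min (μ / 2) ((1 - μ) / 2), ω.vertex (n + 1) - ω.vertex n, ?_, hη,
    ⟨hη, _, ω.edge_mem hn, Or.inl rfl, ω.curve_mem_edge n h0.le h1.le, fun h a b => ?_⟩,
    ⟨hη, _, ω.edge_mem hn, Or.inr rfl, ω.curve_mem_edge n h0.le h1.le, fun h a b => ?_⟩,
    fun t ht t' ht' e htt => ?_⟩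
  · rw [csh_sub, sub_ne_zero]; exact (hgp.csh_arcVertex_ne hn).symm
  · have := b.trans (min_le_right _ _)
    exact hop h (by linarith) (by linarith)
  · have := b.trans (min_le_left _ _)
    rw [smul_neg, ← neg_smul]
    exact hop (-h) (by linarith) (by linarith)
  · obtain rfl := ω.curve_injOn ht' ⟨by positivity, by linarith⟩ e
    obtain ⟨a, b⟩ := abs_lt.1 htt
    have m1 := min_le_left (μ / 2) ((1 - μ) / 2)
    have m2 := min_le_right (μ / 2) ((1 - μ) / 2)
    have e1 : ω.curve t =
        ω.curve (n + μ) + (t - (n + μ)) • (ω.vertex (n + 1) - ω.vertex n) := by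
      rw [hlin, ← hc _ (by linarith) (by linarith)]; congr 1; ring
    rcases le_total 0 (t - (n + μ)) with h | h
    · exact ⟨_, h, Or.inl e1⟩
    · exact ⟨-(t - (n + μ)), by linarith, Or.inr (by rw [e1]; module)⟩

/-- The strand of the arc at one of its endpoints. -/
lemma exists_end_strand (hgp : GeneralPosition L ω) {x : E3}
    (hx : x = ω.vertex 0 ∨ x = ω.vertex ω.len) : ∃ η D, csh D ≠ 0 ∧ 0 < η ∧
      RayOn ω.edges x D η ∧ (∀ h, 0 < h → h ≤ η →
        ∃ t : ℝ, 0 < t ∧ t < ω.len ∧ x + h • D = ω.curve t) ∧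
      ∀ t ∈ Set.Icc (0 : ℝ) ω.len, ∀ t' ∈ Set.Icc (0 : ℝ) ω.len, ω.curve t' = x →
        |t - t'| < η → ∃ h : ℝ, 0 ≤ h ∧ ω.curve t = x + h • D := by
  have hpos := ω.len_pos
  have hpos' : (1 : ℝ) ≤ ω.len := by exact_mod_cast hpos
  rcases hx with rfl | rfl
  · have hc (ν : ℝ) (a : 0 ≤ ν) (b : ν ≤ 1) :
        ω.curve ν = ω.vertex 0 + ν • (ω.vertex 1 - ω.vertex 0) := by
      simpa using ω.curve_nat_add 0 a b
    refine ⟨1 / 2, ω.vertex 1 - ω.vertex 0, ?_, by norm_num,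
      ⟨by norm_num, _, ω.edge_mem hpos, Or.inl rfl, left_mem_segment ℝ _ _, fun h a b => ?_⟩,
      fun h a b => ⟨h, a, by linarith, (hc h a.le (by linarith)).symm⟩,
      fun t ht t' ht' e htt => ?_⟩
    · rw [csh_sub, sub_ne_zero]; exact (hgp.csh_arcVertex_ne hpos).symm
    · rw [openSegment_eq_image']; exact ⟨_, ⟨a, by linarith⟩, rfl⟩
    · have e0 : ω.curve t' = ω.curve 0 := by rw [e]; simpa using (ω.curve_nat 0).symm
      obtain rfl := ω.curve_injOn ht' ⟨le_rfl, by linarith⟩ e0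
      rw [sub_zero, abs_of_nonneg ht.1] at htt
      exact ⟨t, ht.1, hc t ht.1 (by linarith)⟩
  · obtain ⟨l, hl⟩ : ∃ l, ω.len = l + 1 := ⟨ω.len - 1, by omega⟩
    have hc (ν : ℝ) (a : 0 ≤ ν) (b : ν ≤ 1) : ω.curve (ω.len - ν) =
        ω.vertex ω.len + ν • (-(ω.vertex (l + 1) - ω.vertex l)) := by
      have := ω.curve_nat_add l (μ := 1 - ν) (by linarith) (by linarith)
      rw [hl]
      push_cast
      rw [show (l : ℝ) + 1 - ν = l + (1 - ν) by ring, this]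
      module
    refine ⟨1 / 2, -(ω.vertex (l + 1) - ω.vertex l), ?_, by norm_num,
      ⟨by norm_num, _, ω.edge_mem (n := l) (by omega), Or.inr rfl, ?_, fun h a b => ?_⟩,
      fun h a b => ⟨ω.len - h, by linarith, by linarith, (hc h a.le (by linarith)).symm⟩,
      fun t ht t' ht' e htt => ?_⟩
    · rw [csh_neg, neg_ne_zero, csh_sub, sub_ne_zero]
      exact (hgp.csh_arcVertex_ne (n := l) (by omega)).symm
    · rw [hl]; exact right_mem_segment ℝ _ _
    · rw [hl, openSegment_eq_image']; exact ⟨1 - h, ⟨by linarith, by linarith⟩, by module⟩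
    · have e0 : ω.curve t' = ω.curve ω.len := by rw [e, ω.curve_nat]
      obtain rfl := ω.curve_injOn ht' ⟨by linarith, le_rfl⟩ e0
      rw [abs_sub_comm, abs_of_nonneg (sub_nonneg.2 ht.2)] at htt
      refine ⟨ω.len - t, by linarith [ht.2], ?_⟩
      rw [← hc _ (by linarith [ht.2]) (by linarith)]
      congr 1; ring

/-- The arc meets the link only in its endpoints, which are in general position. -/
lemma mem_both {i j : Fin m} (hω : ω.Joins L i j) {x : E3} (hx : x ∈ L.carrier)
    (hx' : x ∈ support ω.edges) : x = ω.vertex 0 ∨ x = ω.vertex ω.len := hω.2.2 x hx' hx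

lemma GeneralPosition.eq_of_mem_both (hgp : GeneralPosition L ω) {i j : Fin m}
    (hω : ω.Joins L i j) {x z : E3} (hx : x ∈ L.carrier)
    (hx' : x ∈ support ω.edges) (hz : z ∈ L.carrier ∪ support ω.edges) (h : csh z = csh x) :
    z = x := by
  rcases mem_both hω hx hx' with rfl | rfl
  · exact hgp.arcVertex hz (Nat.zero_le _) h
  · exact hgp.arcVertex hz le_rfl h

/-- A double point of the projection is not a vertex. -/
lemma GeneralPosition.not_int (hgp : GeneralPosition L ω) {i : Fin m} {s : ℝ} {z : E3}
    (hz : z ∈ L.carrier ∪ support ω.edges) (h : csh z = csh (L.curve i s))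
    (hne : z ≠ L.curve i s) (n : ℤ) : s ≠ n := by
  rintro rfl
  rw [L.curve_int] at h hne
  exact hne (hgp.vertex hz h)

end GeneralPosition

end MarkedLink

end

noncomputable section

namespace MarkedLink

open Filter Topology

/-! ### Labels along the link -/

lemma mul_self_of_mem_circleB {b : (Quaternion ℝ)ˣ} (hb : b ∈ circleB) : b * b = -1 := by
  obtain ⟨a, ha⟩ := hb
  apply Units.ext
  rw [Units.val_mul, ha, mul_assoc, ← mul_assoc (expI a), expI_mul_J, mul_assoc, expI_mul,
    neg_add_cancel, expI_zero, mul_one, quatJ_mul_self]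
  apply Quaternion.ext <;> simp [expI_re, expI_imI, expI_imJ, expI_imK,
    Quaternion.re_one, Quaternion.imI_one, Quaternion.imJ_one, Quaternion.imK_one]

lemma inv_eq_neg_of_mem_circleB {b : (Quaternion ℝ)ˣ} (hb : b ∈ circleB) : b⁻¹ = -b := by
  rw [inv_eq_iff_mul_eq_one, mul_neg, mul_self_of_mem_circleB hb, neg_neg]

section Labels

variable {m : ℕ} (L : PolygonalLink m) (G : ℂ → (Quaternion ℝ)ˣ)

/-- The strand of component `i` at parameter `s`, seen from above with its orientation, has the
meridian `x`. -/
def HasLab (i : Fin m) (s : ℝ) (x : (Quaternion ℝ)ˣ) : Prop :=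
  ∀ᶠ ε : ℝ in 𝓝[>] 0, G (csh (L.curve i s) + ε • (Complex.I * csh (L.dirOut i s))) *
    (G (csh (L.curve i s) - ε • (Complex.I * csh (L.dirOut i s))))⁻¹ = x

/-- The label to the right of parameter `s`. -/
def LabR (i : Fin m) (s : ℝ) (x : (Quaternion ℝ)ˣ) : Prop :=
  ∀ᶠ t in 𝓝[>] s, HasLab L G i t x

/-- The label to the left of parameter `s`. -/
def LabL (i : Fin m) (s : ℝ) (x : (Quaternion ℝ)ˣ) : Prop :=
  ∀ᶠ t in 𝓝[<] s, HasLab L G i t x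

variable {L G}

lemma HasLab.unique {i : Fin m} {s : ℝ} {x y : (Quaternion ℝ)ˣ} (h : HasLab L G i s x)
    (h' : HasLab L G i s y) : x = y := by
  obtain ⟨ε, h1, h2⟩ := (h.and h').exists
  exact h1.symm.trans h2

lemma LabR.unique {i : Fin m} {s : ℝ} {x y : (Quaternion ℝ)ˣ} (h : LabR L G i s x)
    (h' : LabR L G i s y) : x = y := by
  obtain ⟨ε, h1, h2⟩ := (h.and h').exists
  exact h1.unique h2

lemma LabL.unique {i : Fin m} {s : ℝ} {x y : (Quaternion ℝ)ˣ} (h : LabL L G i s x)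
    (h' : LabL L G i s y) : x = y := by
  obtain ⟨ε, h1, h2⟩ := (h.and h').exists
  exact h1.unique h2

variable {V : Set (E3 × E3)} {P : ℂ} {r : ℝ} {n : ℕ} {y D : Fin n → E3} {τ c : Fin n → ℝ}

/-- Close to `P` on the outgoing ray, the left and right sides of the strand lie in the two sectors
adjacent to the ray. -/
lemma Star.labR (S : Star (L.carrier ∪ support V) P r y D τ c) (hG : IsDehn L V G) {k : Fin n}
    {η : ℝ} (hη : Star.Isolated τ k η) {i : Fin m} {s : ℝ} (hy : y k = L.curve i s)
    (hD : D k = L.dirOut i s) :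
    LabR L G i s (Star.W G P r (τ k + η) * (Star.W G P r (τ k - η))⁻¹) := by
  obtain ⟨η', h0, -, -, -, h1, -⟩ := exists_strand L i s
  have hc := S.c_pos k
  have hP := S.csh_y k
  have : ∀ᶠ t in 𝓝[>] s, t < s + min η' (r / c k) := by
    filter_upwards [Ioo_mem_nhdsGT (lt_add_of_pos_right s (lt_min h0 (div_pos S.r_pos hc)))]
      with t ht using ht.2
  filter_upwards [this, self_mem_nhdsWithin] with t h2 h3
  obtain ⟨h, rfl⟩ : ∃ h, t = s + h := ⟨t - s, by ring⟩
  have h4 : 0 < h := by simpa using h3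
  have h5 := lt_min_iff.1 (lt_of_add_lt_add_left h2)
  filter_upwards [S.eventually_beside hG.eq_of_segment hη h4 ((lt_div_iff₀ hc).1 h5.2)] with ε hε
  obtain ⟨e1, e2⟩ := h1 h h4 h5.1.le
  rw [e1, e2, ← hy, ← hD, csh_add, csh_smul, hP, hε.1, hε.2]

/-- The backward ray runs against the orientation of the strand, so left and right are exchanged
compared with `Star.labR`. -/
lemma Star.labL (S : Star (L.carrier ∪ support V) P r y D τ c) (hG : IsDehn L V G) {k : Fin n}
    {η : ℝ} (hη : Star.Isolated τ k η) {i : Fin m} {s : ℝ} (hy : y k = L.curve i s)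
    (hD : D k = -L.dirIn i s) :
    LabL L G i s (Star.W G P r (τ k - η) * (Star.W G P r (τ k + η))⁻¹) := by
  obtain ⟨η', h0, -, -, -, -, h1, -⟩ := exists_strand L i s
  have hc := S.c_pos k
  have hP := S.csh_y k
  have : ∀ᶠ t in 𝓝[<] s, s - min η' (r / c k) < t := by
    filter_upwards [Ioo_mem_nhdsLT (sub_lt_self s (lt_min h0 (div_pos S.r_pos hc)))]
      with t ht using ht.1
  filter_upwards [this, self_mem_nhdsWithin] with t h2 h3
  obtain ⟨h, rfl⟩ : ∃ h, t = s - h := ⟨s - t, by ring⟩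
  have h4 : 0 < h := by simpa using h3
  have h5 := lt_min_iff.1 (sub_lt_sub_iff_left s |>.1 h2)
  filter_upwards [S.eventually_beside hG.eq_of_segment hη h4 ((lt_div_iff₀ hc).1 h5.2)] with ε hε
  obtain ⟨e1, e2⟩ := h1 h h4 h5.1.le
  have e3 : csh (L.dirIn i s) = -csh (D k) := by rw [hD, csh_neg, neg_neg]
  rw [e1, e2, ← hy, ← hD, csh_add, csh_smul, hP, e3, mul_neg, smul_neg, ← sub_eq_add_neg,
    sub_neg_eq_add, hε.1, hε.2]

end Labels

attribute [local irreducible] Star.W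

/-! ### Labels at simple points and at the endpoints of the arc. -/

section Local

variable {m : ℕ} {L : PolygonalLink m} {ω : PolygonalArc} {G : ℂ → (Quaternion ℝ)ˣ}

/-- If the outgoing and the backward direction had the same shadow direction, the two rays would
coincide in space by `ray_eq`, and the curve would retrace itself. -/
lemma exists_ang_of_ne (hgp : GeneralPosition L ω) (i : Fin m) (s : ℝ) :
    ∃ α β c₀ c₁ : ℝ, α < β ∧ β < α + 2 * Real.pi ∧ 0 < c₀ ∧ 0 < c₁ ∧
      csh (L.dirOut i s) = c₀ • ang α ∧ csh (-L.dirIn i s) = c₁ • ang β := by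
  obtain ⟨α, -, -, hα⟩ := exists_ang 0 (csh (L.dirOut i s))
  obtain ⟨β, hβ₁, hβ₂, hβ⟩ := exists_ang α (csh (-L.dirIn i s))
  have h0 := norm_pos_iff.2 (hgp.csh_dirOut_ne i s)
  have h1 := norm_pos_iff.2 (hgp.csh_dirIn_ne i s)
  refine ⟨α, β, _, _, lt_of_le_of_ne hβ₁ ?_, hβ₂, h0, h1, hα, hβ⟩
  rintro rfl
  obtain ⟨η, hη, hη', r1, r2, l1, l2, -⟩ := exists_strand L i s
  obtain ⟨-, h⟩ := hgp.ray_eq (Or.inl ⟨i, rfl⟩) (Or.inl ⟨i, rfl⟩) r1 r2 rfl h0 h1 hα hβ rfl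
  obtain ⟨δ, ⟨h, hδ, hδ2⟩, hδ3⟩ := ((h.and (Ioo_mem_nhdsGT (mul_pos hη h0))).and
    (Ioo_mem_nhdsGT (mul_pos hη h1))).exists
  have p0 := div_pos hδ h0
  have p1 := div_pos hδ h1
  have q0 := (div_lt_iff₀ h0).2 hδ2
  have q1 := (div_lt_iff₀ h1).2 hδ3.2
  rw [← (l1 _ p0 q0.le).1, ← (l2 _ p1 q1.le).1] at h
  obtain ⟨-, k, hk⟩ := L.curve_inj h
  have hlen := L.one_le_len i
  -- Coinciding points on the two rays have parameters whose difference is positive and less than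
  -- `1`, since each of the two steps is below `1/2`; it cannot be a multiple of the period.
  have e : δ / ‖csh (L.dirOut i s)‖ + δ / ‖csh (-L.dirIn i s)‖ = k * L.len i := by linarith
  have k0 : (0 : ℝ) < k := by
    by_contra hc
    push Not at hc
    nlinarith
  have k2 : 0 < k := by exact_mod_cast k0
  have k1 : (1 : ℝ) ≤ k := by exact_mod_cast (by omega : 1 ≤ k)
  nlinarith

/-- Away from the other strands and the arc the label does not change. -/
lemma label_simple (hG : IsDehn L ω.edges G) (hgp : GeneralPosition L ω) {i : Fin m} {s : ℝ}
    (h : ∀ z ∈ L.carrier ∪ support ω.edges, csh z = csh (L.curve i s) → z = L.curve i s)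
    (hs : L.curve i s ∉ support ω.edges) :
    ∃ x ∈ circleB, LabL L G i s x ∧ LabR L G i s x := by
  obtain ⟨α, β, c₀, c₁, h1, h2, hc0, hc1, e0, e1⟩ := exists_ang_of_ne hgp i s
  obtain ⟨η₁, hη₁, -, r1, r2, -, -, hst⟩ := exists_strand L i s
  obtain ⟨r, hr, hr0⟩ := ((hgp.eventually_near (csh (L.curve i s)) hη₁).and
    self_mem_nhdsWithin).exists
  have S : Star (L.carrier ∪ support ω.edges) (csh (L.curve i s)) r
      ![L.curve i s, L.curve i s] ![L.dirOut i s, -L.dirIn i s] ![α, β] ![c₀, c₁] := by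
    refine ⟨hr0, fun k => ?_, fun k => ?_, fun k => ?_, fun x hx hxr => ?_, fun k l hkl => ?_⟩
    · fin_cases k <;> rfl
    · fin_cases k <;> assumption
    · fin_cases k <;> assumption
    · rcases hr x hx hxr with ⟨j, t, t', rfl, e, htt⟩ | ⟨t, ht, t', ht', rfl, e, htt⟩
      · obtain ⟨u, hu, hu'⟩ := hst j t t' (h _ (Or.inl (L.curve_mem_carrier j t')) e) htt
        rcases hu' with hu' | hu'
        · exact ⟨0, u, hu, hu'⟩
        · exact ⟨1, u, hu, hu'⟩
      · have hm := ω.mem_support_edges.2 ⟨t', ht', rfl⟩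
        rw [h _ (Or.inr hm) e] at hm
        exact absurd hm hs
    · fin_cases k <;> fin_cases l <;> first | rfl | skip
      · have := eq_of_ang_eq hkl (abs_lt.2 ⟨by simp; linarith, by simp; linarith⟩)
        simp at this; linarith
      · have := eq_of_ang_eq hkl (abs_lt.2 ⟨by simp; linarith, by simp; linarith⟩)
        simp at this; linarith
  obtain ⟨η, hη, e⟩ := S.label_two hG.eq_of_segment h1 h2
  have l0 := S.labR hG (hη 0) rfl rfl
  have l1 := S.labL hG (hη 1) rfl rfl
  have j0 := S.jump_link hG (hη 0) (i := i) (η' := η₁) r1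
  refine ⟨_, j0, ?_, l0⟩
  simp only [Matrix.cons_val_zero, Matrix.cons_val_one] at l1 ⊢
  rwa [e]

/-- At an endpoint of the arc the label changes its sign. -/
lemma label_end (hG : IsDehn L ω.edges G) (hgp : GeneralPosition L ω) {i₀ j₀ : Fin m}
    (hω : ω.Joins L i₀ j₀) {i : Fin m} {s : ℝ}
    (hs : L.curve i s ∈ support ω.edges) :
    ∃ x ∈ circleB, LabL L G i s x ∧ LabR L G i s (-x) := by
  have hcar := L.curve_mem_carrier i s
  have hend := mem_both hω hcar hs
  have h (z) (hz : z ∈ L.carrier ∪ support ω.edges) (e : csh z = csh (L.curve i s)) :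
    z = L.curve i s := hgp.eq_of_mem_both hω hcar hs hz e
  obtain ⟨α, β, c₀, c₁, h1, h2, hc0, hc1, e0, e1⟩ := exists_ang_of_ne hgp i s
  obtain ⟨η₁, hη₁, -, r1, r2, l1, l2, hst⟩ := exists_strand L i s
  obtain ⟨η₂, D, hD, hη₂, r3, l3, hst'⟩ := exists_end_strand hgp hend
  have hcD := norm_pos_iff.2 hD
  obtain ⟨γ, hγ₁, hγ₂, hγ⟩ := exists_ang α (csh D)
  have hpart : IsPart L ω (L.edges i) := Or.inl ⟨i, rfl⟩
  have hpos : (1 : ℝ) ≤ ω.len := by exact_mod_cast ω.len_pos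
  -- Points of the arc just beyond its endpoint have inner parameters, so by injectivity they are
  -- not endpoints and do not lie on the link.
  have hnot (u : ℝ) (hu : 0 < u) (hu' : u ≤ η₂) : L.curve i s + u • D ∉ L.carrier := fun hc => by
    obtain ⟨t, t0, t1, ht⟩ := l3 u hu hu'
    have hm := ω.mem_support_edges.2 ⟨t, ⟨t0.le, t1.le⟩, rfl⟩
    rw [ht] at hc
    rcases mem_both hω hc hm with e | e
    · rw [← ω.curve_nat] at e
      have := ω.curve_injOn ⟨t0.le, t1.le⟩ ⟨by simp, by simp⟩ e
      simp at this; linarith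
    · rw [← ω.curve_nat] at e
      have := ω.curve_injOn ⟨t0.le, t1.le⟩ ⟨by simp, by simp⟩ e
      linarith
  -- If the arc left in the direction of a link ray, it would run along the link by `ray_eq`.
  have hdist {D' : E3} {c' τ' : ℝ} (hc' : 0 < c') (hr : RayOn (L.edges i) (L.curve i s) D' η₁)
      (hD' : csh D' = c' • ang τ') : ang γ ≠ ang τ' := fun e => by
    obtain ⟨-, hev⟩ := hgp.ray_eq (Or.inr rfl) hpart r3 hr rfl hcD hc' hγ hD' e
    obtain ⟨δ, ⟨h, hδ, hδ2⟩, hδ3⟩ := ((hev.and (Ioo_mem_nhdsGT (mul_pos hη₂ hcD))).and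
      (Ioo_mem_nhdsGT (mul_pos hη₁ hc'))).exists
    refine hnot (δ / ‖csh D‖) (div_pos hδ hcD) ((div_lt_iff₀ hcD).2 hδ2).le ?_
    rw [h]
    obtain ⟨-, e, he, -, -, hop⟩ := hr
    exact Set.mem_iUnion.2 ⟨i, mem_support.2 ⟨e, he, openSegment_subset_segment ℝ _ _
      (hop _ (div_pos hδ hc') ((div_lt_iff₀ hc').2 hδ3.2).le)⟩⟩
  have hγα : ang γ ≠ ang α := hdist hc0 r1 e0
  have hγβ : ang γ ≠ ang β := hdist hc1 r2 e1
  obtain ⟨r, hr, hr0⟩ := ((hgp.eventually_near (csh (L.curve i s)) (lt_min hη₁ hη₂)).and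
    self_mem_nhdsWithin).exists
  have S : Star (L.carrier ∪ support ω.edges) (csh (L.curve i s)) r
      ![L.curve i s, L.curve i s, L.curve i s] ![L.dirOut i s, -L.dirIn i s, D] ![α, β, γ]
      ![c₀, c₁, ‖csh D‖] := by
    refine ⟨hr0, fun k => ?_, fun k => ?_, fun k => ?_, fun x hx hxr => ?_, fun k l hkl => ?_⟩
    · fin_cases k <;> rfl
    · fin_cases k <;> assumption
    · fin_cases k <;> assumption
    · rcases hr x hx hxr with ⟨j, t, t', rfl, e, htt⟩ | ⟨t, ht, t', ht', rfl, e, htt⟩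
      · obtain ⟨u, hu, hu'⟩ := hst j t t' (h _ (Or.inl (L.curve_mem_carrier j t')) e)
          (htt.trans_le (min_le_left _ _))
        rcases hu' with hu' | hu'
        · exact ⟨0, u, hu, hu'⟩
        · exact ⟨1, u, hu, hu'⟩
      · obtain ⟨u, hu, hu'⟩ := hst' t ht t' ht'
          (h _ (Or.inr (ω.mem_support_edges.2 ⟨t', ht', rfl⟩)) e) (htt.trans_le (min_le_right _ _))
        exact ⟨2, u, hu, hu'⟩
    · fin_cases k <;> fin_cases l <;> first | rfl | skip
      · have := eq_of_ang_eq hkl (abs_lt.2 ⟨by simp; linarith, by simp; linarith⟩)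
        simp at this; linarith
      · exact absurd hkl.symm hγα
      · have := eq_of_ang_eq hkl (abs_lt.2 ⟨by simp; linarith, by simp; linarith⟩)
        simp at this; linarith
      · exact absurd hkl.symm hγβ
      · exact absurd hkl hγα
      · exact absurd hkl hγβ
  have hj : ∀ η, Star.Isolated ![α, β, γ] 2 η →
      Star.W G (csh (L.curve i s)) r (γ + η) = -Star.W G (csh (L.curve i s)) r (γ - η) :=
    fun η hη => S.jump_arc hG hη (η' := η₂) r3
  obtain ⟨η, hη, e⟩ := S.label_three hG.eq_of_segment h1 h2
    (lt_of_le_of_ne hγ₁ fun e => hγα (e ▸ rfl)) hγ₂ (fun e => hγβ (e ▸ rfl)) hj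
  have l0 := S.labR hG (hη 0) rfl rfl
  have l1 := S.labL hG (hη 1) rfl rfl
  have j0 := inv_mem_circleB (S.jump_link hG (hη 1) (i := i) (η' := η₁) r2)
  simp only [Matrix.cons_val_zero, Matrix.cons_val_one, mul_inv_rev, inv_inv] at l0 l1 j0
  exact ⟨_, j0, l1, e ▸ l0⟩

end Local

end MarkedLink

end

noncomputable section

namespace MarkedLink

open Filter Topology

/-! ### Labels at double points -/

lemma conj_inv_of_mem_circleB {u x : (Quaternion ℝ)ˣ} (h : u ∈ circleB) :
    u * x * u⁻¹ = u⁻¹ * x * u := by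
  rw [inv_eq_neg_of_mem_circleB h]; simp

attribute [local irreducible] Star.W

section Double

variable {m : ℕ} {L : PolygonalLink m} {ω : PolygonalArc} {G : ℂ → (Quaternion ℝ)ˣ}

/-- Through `x` there is a straight strand of the link or the arc, in direction `D`. -/
structure Strand (L : PolygonalLink m) (ω : PolygonalArc) (E : Set (E3 × E3)) (x D : E3) (η : ℝ) :
    Prop where
  part : IsPart L ω E
  csh_ne : csh D ≠ 0
  mem : x ∈ L.carrier ∪ support ω.edges
  ray : RayOn E x D η
  ray_neg : RayOn E x (-D) η
  near : ∀ i t t', L.curve i t' = x → |t - t'| < η → ∃ h : ℝ, L.curve i t = x + h • D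
  near_arc : ∀ t ∈ Set.Icc (0 : ℝ) ω.len, ∀ t' ∈ Set.Icc (0 : ℝ) ω.len, ω.curve t' = x →
    |t - t'| < η → ∃ h : ℝ, ω.curve t = x + h • D

lemma Strand.neg {E : Set (E3 × E3)} {x D : E3} {η : ℝ} (h : Strand L ω E x D η) :
    Strand L ω E x (-D) η where
  part := h.part
  csh_ne := by rw [csh_neg, neg_ne_zero]; exact h.csh_ne
  mem := h.mem
  ray := h.ray_neg
  ray_neg := by rw [neg_neg]; exact h.ray
  near i t t' h1 h2 := by
    obtain ⟨u, hu⟩ := h.near i t t' h1 h2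
    exact ⟨-u, by rw [hu, smul_neg, neg_smul, neg_neg]⟩
  near_arc t ht t' ht' h1 h2 := by
    obtain ⟨u, hu⟩ := h.near_arc t ht t' ht' h1 h2
    exact ⟨-u, by rw [hu, smul_neg, neg_smul, neg_neg]⟩

/-- A strand of the link over a double point. -/
lemma exists_strand_link (hgp : GeneralPosition L ω) {i : Fin m} {s : ℝ} {z : E3}
    (hz : z ∈ L.carrier ∪ support ω.edges) (h : csh z = csh (L.curve i s))
    (hne : z ≠ L.curve i s) (hs : L.curve i s ∉ support ω.edges) :
    L.dirIn i s = L.dirOut i s ∧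
      ∃ η, Strand L ω (L.edges i) (L.curve i s) (L.dirOut i s) η := by
  have hd := L.dirIn_eq_dirOut i (fun n => hgp.not_int hz h hne n)
  obtain ⟨η, -, -, r1, r2, -, -, hst⟩ := exists_strand L i s
  rw [hd] at r2 hst
  refine ⟨hd, η, Or.inl ⟨i, rfl⟩, hgp.csh_dirOut_ne i s, Or.inl (L.curve_mem_carrier i s), r1, r2,
    fun j t t' e htt => ?_, fun t ht t' ht' e htt => ?_⟩
  · obtain ⟨u, -, hu | hu⟩ := hst j t t' e htt
    · exact ⟨u, hu⟩
    · exact ⟨-u, by rw [hu, smul_neg, neg_smul]⟩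
  · exact absurd (ω.mem_support_edges.2 ⟨t', ht', e.symm⟩) hs

/-- A strand of the arc over a double point. -/
lemma exists_strand_arc (hgp : GeneralPosition L ω) {x z : E3} (hx : x ∈ support ω.edges)
    (hz : z ∈ L.carrier ∪ support ω.edges) (h : csh z = csh x)
    (hne : z ≠ x) (hs : x ∉ L.carrier) : ∃ D η, Strand L ω ω.edges x D η := by
  obtain ⟨t, ht, rfl⟩ := ω.mem_support_edges.1 hx
  obtain ⟨n, hn, μ, hμ, rfl⟩ := ω.exists_nat_add ht.1 ht.2
  have h0 : 0 < μ := by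
    refine lt_of_le_of_ne hμ.1 ?_
    rintro rfl
    rw [add_zero, ω.curve_nat] at h hne
    exact hne (hgp.arcVertex hz hn.le h)
  have h1 : μ < 1 := by
    refine lt_of_le_of_ne hμ.2 ?_
    rintro rfl
    rw [← Nat.cast_add_one, ω.curve_nat] at h hne
    exact hne (hgp.arcVertex hz hn h)
  obtain ⟨η, D, hD, hη, r1, r2, hst⟩ := exists_arc_strand hgp hn h0 h1
  refine ⟨D, η, Or.inr rfl, hD, Or.inr hx, r1, r2, fun j t t' e htt => ?_,
    fun t ht t' ht' e htt => ?_⟩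
  · exact absurd (e ▸ L.curve_mem_carrier j t') hs
  · obtain ⟨u, -, hu | hu⟩ := hst t ht t' ht' e htt
    · exact ⟨u, hu⟩
    · exact ⟨-u, by rw [hu, smul_neg, neg_smul]⟩

/-- Crossings are transverse: strands through different points of the same vertical line cannot
share a shadow direction, because overlapping edges coincide in space. -/
lemma Strand.ang_ne (hgp : GeneralPosition L ω) {E E' : Set (E3 × E3)} {x D x' D' : E3}
    {η η' c c' τ τ' : ℝ} (h : Strand L ω E x D η) (h' : Strand L ω E' x' D' η') (hne : x ≠ x')
    (he : csh x' = csh x) (hc : 0 < c) (hc' : 0 < c') (hD : csh D = c • ang τ)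
    (hD' : csh D' = c' • ang τ') : ang τ ≠ ang τ' := fun e =>
  hne (hgp.ray_eq h.part h'.part h.ray h'.ray he.symm hc hc' hD hD' e).1

/-- The star of a double point. -/
lemma exists_star_four (hgp : GeneralPosition L ω) {E E' : Set (E3 × E3)} {x D x' D' : E3}
    {η η' : ℝ} (h : Strand L ω E x D η) (h' : Strand L ω E' x' D' η') (hne : x ≠ x')
    (he : csh x' = csh x) : ∃ (D'' : E3) (r α γ : ℝ) (c : Fin 4 → ℝ), (D'' = D' ∨ D'' = -D') ∧
      α < γ ∧ γ < α + Real.pi ∧ Star (L.carrier ∪ support ω.edges) (csh x) r ![x, x, x', x']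
        ![D, -D, D'', -D''] ![α, α + Real.pi, γ, γ + Real.pi] c := by
  have hpi := Real.pi_pos
  obtain ⟨α, -, -, hα⟩ := exists_ang 0 (csh D)
  have hc := norm_pos_iff.2 h.csh_ne
  have hne' {D' : E3} (h' : Strand L ω E' x' D' η') : ∃ γ, α < γ ∧ γ < α + 2 * Real.pi ∧
      γ ≠ α + Real.pi ∧ csh D' = ‖csh D'‖ • ang γ := by
    obtain ⟨γ, hγ₁, hγ₂, hγ⟩ := exists_ang α (csh D')
    have hc' := norm_pos_iff.2 h'.csh_ne
    refine ⟨γ, lt_of_le_of_ne hγ₁ ?_, hγ₂, ?_, hγ⟩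
    · rintro rfl
      exact h.ang_ne hgp h' hne he hc hc' hα hγ rfl
    · rintro rfl
      refine h.neg.ang_ne hgp h' hne he hc hc' (τ := α + Real.pi) ?_ hγ rfl
      rw [csh_neg, ang_add_pi, smul_neg, ← hα]
  -- The second strand is reversed if necessary so that its angle lies in `(α, α + π)`. This puts
  -- the four rays in a fixed cyclic order and costs only the bookkeeping of the sign.
  obtain ⟨D'', γ, hor, hγ₁, hγ₂, hγ, hst⟩ : ∃ D'' γ, (D'' = D' ∨ D'' = -D') ∧ α < γ ∧
      γ < α + Real.pi ∧ csh D'' = ‖csh D''‖ • ang γ ∧ Strand L ω E' x' D'' η' := by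
    obtain ⟨γ, h1, h2, h3, h4⟩ := hne' h'
    rcases lt_or_gt_of_ne h3 with h5 | h5
    · exact ⟨D', γ, Or.inl rfl, h1, h5, h4, h'⟩
    · refine ⟨-D', γ - Real.pi, Or.inr rfl, by linarith, by linarith, ?_, h'.neg⟩
      rw [csh_neg, norm_neg]
      conv_lhs => rw [h4, show γ = γ - Real.pi + Real.pi by ring, ang_add_pi]
      simp
  have hc' := norm_pos_iff.2 hst.csh_ne
  obtain ⟨r, hr, hr0⟩ := ((hgp.eventually_near (csh x) (lt_min h.ray.1 hst.ray.1)).and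
    self_mem_nhdsWithin).exists
  refine ⟨D'', r, α, γ, ![‖csh D‖, ‖csh D‖, ‖csh D''‖, ‖csh D''‖], hor, hγ₁, hγ₂,
    hr0, fun k => ?_, fun k => ?_, fun k => ?_, fun y hy hyr => ?_, fun k l hkl => ?_⟩
  · fin_cases k <;> first | rfl | exact he
  · fin_cases k <;> assumption
  · have e1 : csh (-D) = ‖csh D‖ • ang (α + Real.pi) := by
      rw [csh_neg, ang_add_pi, smul_neg, ← hα]
    have e2 : csh (-D'') = ‖csh D''‖ • ang (γ + Real.pi) := by
      rw [csh_neg, ang_add_pi, smul_neg, ← hγ]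
    fin_cases k <;> assumption
  · have fin {y : E3} (hy : (∃ u : ℝ, y = x + u • D) ∨ ∃ u : ℝ, y = x' + u • D'') :
        ∃ k : Fin 4, ∃ h : ℝ, 0 ≤ h ∧
          y = (![x, x, x', x'] : Fin 4 → E3) k + h • (![D, -D, D'', -D''] : Fin 4 → E3) k := by
      rcases hy with ⟨u, rfl⟩ | ⟨u, rfl⟩ <;> rcases le_total 0 u with hu | hu
      · exact ⟨0, u, hu, rfl⟩
      · exact ⟨1, -u, by linarith, by simp⟩
      · exact ⟨2, u, hu, rfl⟩
      · exact ⟨3, -u, by linarith, by simp⟩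
    refine fin ?_
    -- Without triple points, whatever lies over `csh x` is `x` or `x'`, so nearby points lie on one
    -- of the two strands.
    rcases hr y hy hyr with ⟨j, t, t', rfl, e, htt⟩ | ⟨t, ht, t', ht', rfl, e, htt⟩
    · rcases hgp.triple h.mem h'.mem (Or.inl (L.curve_mem_carrier j t')) he.symm (e.trans he.symm)
        hne with e' | e'
      · exact Or.inl (h.near j t t' e' (htt.trans_le (min_le_left _ _)))
      · exact Or.inr (hst.near j t t' e' (htt.trans_le (min_le_right _ _)))
    · rcases hgp.triple h.mem h'.mem (Or.inr (ω.mem_support_edges.2 ⟨t', ht', rfl⟩)) he.symm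
        (e.trans he.symm) hne with e' | e'
      · exact Or.inl (h.near_arc t ht t' ht' e' (htt.trans_le (min_le_left _ _)))
      · exact Or.inr (hst.near_arc t ht t' ht' e' (htt.trans_le (min_le_right _ _)))
  · by_contra hkl'
    have aux : ∀ {a b : ℝ}, α ≤ a → a < b → b < α + 2 * Real.pi → ang a ≠ ang b :=
      fun h1 h2 h3 e => by
        have := eq_of_ang_eq e (abs_lt.2 ⟨by linarith, by linarith⟩)
        linarith
    have n1 := aux (a := α) (b := α + Real.pi) le_rfl (by linarith) (by linarith)
    have n2 := aux (a := α) (b := γ) le_rfl (by linarith) (by linarith)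
    have n3 := aux (a := α) (b := γ + Real.pi) le_rfl (by linarith) (by linarith)
    have n4 := aux (a := γ) (b := α + Real.pi) (by linarith) (by linarith) (by linarith)
    have n5 := aux (a := α + Real.pi) (b := γ + Real.pi) (by linarith) (by linarith) (by linarith)
    have n6 := aux (a := γ) (b := γ + Real.pi) (by linarith) (by linarith) (by linarith)
    fin_cases k <;> fin_cases l <;>
      first
      | exact hkl' rfl
      | exact n1 hkl | exact n1 hkl.symm | exact n2 hkl | exact n2 hkl.symm
      | exact n3 hkl | exact n3 hkl.symm | exact n4 hkl | exact n4 hkl.symm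
      | exact n5 hkl | exact n5 hkl.symm | exact n6 hkl | exact n6 hkl.symm

/-- Crossing the arc does not change the label. -/
lemma label_arc (hG : IsDehn L ω.edges G) (hgp : GeneralPosition L ω) {i₀ j₀ : Fin m}
    (hω : ω.Joins L i₀ j₀) {i : Fin m} {s : ℝ} {z : E3} (hz : z ∈ support ω.edges)
    (h : csh z = csh (L.curve i s)) (hne : z ≠ L.curve i s) :
    ∃ x ∈ circleB, LabL L G i s x ∧ LabR L G i s x := by
  have hs : L.curve i s ∉ support ω.edges := fun hs =>
    hne (hgp.eq_of_mem_both hω (L.curve_mem_carrier i s) hs (Or.inr hz) h)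
  have hzL : z ∉ L.carrier := fun hzL =>
    hne (hgp.eq_of_mem_both hω hzL hz (Or.inl (L.curve_mem_carrier i s)) h.symm).symm
  obtain ⟨hd, η₁, hS₁⟩ := exists_strand_link hgp (Or.inr hz) h hne hs
  obtain ⟨D, η₂, hS₂⟩ := exists_strand_arc hgp hz (Or.inl (L.curve_mem_carrier i s)) h.symm
    hne.symm hzL
  obtain ⟨D', r, α, γ, c, hor, hγ₁, hγ₂, S⟩ := exists_star_four hgp hS₁ hS₂ hne.symm h
  have r2 : RayOn ω.edges z D' η₂ ∧ RayOn ω.edges z (-D') η₂ := by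
    rcases hor with rfl | rfl
    · exact ⟨hS₂.ray, hS₂.ray_neg⟩
    · exact ⟨hS₂.neg.ray, hS₂.neg.ray_neg⟩
  obtain ⟨η, hη, e⟩ := S.label_four_arc hG.eq_of_segment hγ₁ hγ₂
    (fun η hη => S.jump_arc hG hη (η' := η₂) r2.1) (fun η hη => S.jump_arc hG hη (η' := η₂) r2.2)
  have l0 := S.labR hG (hη 0) rfl rfl
  have l1 := S.labL hG (hη 1) rfl (congrArg Neg.neg hd.symm)
  have j0 := S.jump_link hG (hη 0) (i := i) (η' := η₁) hS₁.ray
  exact ⟨_, j0, e ▸ l1, l0⟩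

/-- At a crossing the label of the strand that passes under is conjugated by the label of the
strand that passes over, which does not change. -/
lemma label_crossing (hG : IsDehn L ω.edges G) (hgp : GeneralPosition L ω) {i₀ j₀ : Fin m}
    (hω : ω.Joins L i₀ j₀) {i j : Fin m} {s t : ℝ} (h : csh (L.curve j t) = csh (L.curve i s))
    (hlt : height (L.curve i s) < height (L.curve j t)) :
    ∃ x ∈ circleB, ∃ o ∈ circleB, LabL L G i s x ∧ LabR L G i s (o * x * o⁻¹) ∧
      LabL L G j t o ∧ LabR L G j t o := by
  have hne : L.curve j t ≠ L.curve i s := fun e => by rw [e] at hlt; exact lt_irrefl _ hlt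
  have hs : L.curve i s ∉ support ω.edges := fun hs =>
    hne (hgp.eq_of_mem_both hω (L.curve_mem_carrier i s) hs (Or.inl (L.curve_mem_carrier j t)) h)
  have ht : L.curve j t ∉ support ω.edges := fun ht =>
    hne (hgp.eq_of_mem_both hω (L.curve_mem_carrier j t) ht (Or.inl (L.curve_mem_carrier i s))
      h.symm).symm
  obtain ⟨hd, η₁, hS₁⟩ := exists_strand_link hgp (Or.inl (L.curve_mem_carrier j t)) h hne hs
  obtain ⟨hd', η₂, hS₂⟩ := exists_strand_link hgp (Or.inl (L.curve_mem_carrier i s)) h.symm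
    hne.symm ht
  obtain ⟨D', r, α, γ, c, hor, hγ₁, hγ₂, S⟩ := exists_star_four hgp hS₁ hS₂ hne.symm h
  obtain ⟨η, hη, e1, e2⟩ := S.label_four_link hG hγ₁ hγ₂ rfl rfl rfl rfl hlt
  have l0 := S.labR hG (hη 0) rfl rfl
  have l1 := S.labL hG (hη 1) rfl (congrArg Neg.neg hd.symm)
  have j1 := inv_mem_circleB (S.jump_link hG (hη 1) (i := i) (η' := η₁) hS₁.ray_neg)
  simp only [mul_inv_rev, inv_inv] at j1
  set x := Star.W G (csh (L.curve i s)) r (α + Real.pi - η) *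
    (Star.W G (csh (L.curve i s)) r (α + Real.pi + η))⁻¹ with hx
  set u := Star.W G (csh (L.curve i s)) r (γ - η) *
    (Star.W G (csh (L.curve i s)) r (γ + η))⁻¹ with hu
  have l0' : LabR L G i s (u * x * u⁻¹) := e2 ▸ l0
  -- The reversal made by the star decides whether the over label is `u⁻¹` or `u`. The under label
  -- does not notice this: `u⁻¹ = -u`, so both conjugate in the same way.
  rcases hor with rfl | rfl
  · have j2 := S.jump_link hG (hη 2) (i := j) (η' := η₂) hS₂.ray
    have huB : u⁻¹ ∈ circleB := by rw [hu, mul_inv_rev, inv_inv]; exact j2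
    have l2 := S.labR hG (hη 2) rfl rfl
    have l3 := S.labL hG (hη 3) rfl (congrArg Neg.neg hd'.symm)
    refine ⟨x, j1, u⁻¹, huB, l1, ?_, ?_, ?_⟩
    · rw [inv_inv, ← conj_inv_of_mem_circleB (by simpa using inv_mem_circleB huB)]
      exact l0'
    · have h1 : u⁻¹ = _ := congrArg Inv.inv e1.symm
      rw [h1, mul_inv_rev, inv_inv]
      exact l3
    · rw [hu, mul_inv_rev, inv_inv]
      exact l2
  · have j2 := S.jump_link hG (hη 2) (i := j) (η' := η₂) hS₂.ray_neg
    have huB : u ∈ circleB := by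
      have := inv_mem_circleB j2
      rw [mul_inv_rev, inv_inv] at this
      exact this
    have l2 := S.labL hG (hη 2) rfl (congrArg Neg.neg hd'.symm)
    have l3 := S.labR hG (hη 3) rfl (neg_neg _)
    refine ⟨x, j1, u, huB, l1, l0', l2, ?_⟩
    rw [← e1]
    exact l3

open Classical in
/-- Away from the undercrossings the label changes only at the endpoints of the arc. -/
lemma label_of_not_passesUnder (hG : IsDehn L ω.edges G) (hgp : GeneralPosition L ω)
    {i₀ j₀ : Fin m} (hω : ω.Joins L i₀ j₀) {i : Fin m} {s : ℝ} (h : ¬ L.PassesUnder i s) :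
    ∃ x ∈ circleB, LabL L G i s x ∧
      LabR L G i s (if L.curve i s ∈ support ω.edges then -x else x) := by
  by_cases hs : L.curve i s ∈ support ω.edges
  · simp only [if_pos hs]
    exact label_end hG hgp hω hs
  simp only [if_neg hs]
  by_cases h1 : ∀ z ∈ L.carrier ∪ support ω.edges, csh z = csh (L.curve i s) → z = L.curve i s
  · exact label_simple hG hgp h1 hs
  push Not at h1
  obtain ⟨z, hz, e, hne⟩ := h1
  rcases hz with hz | hz
  · obtain ⟨j, t, rfl⟩ := L.mem_carrier.1 hz
    -- The other strand is not above, since there is no undercrossing here, and not at the same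
    -- height, since the points differ. Hence the present strand passes over, and its label is the
    -- `o` of `label_crossing`.
    have hlt : height (L.curve j t) < height (L.curve i s) := by
      refine lt_of_le_of_ne (not_lt.1 fun hc => h ⟨j, t, shadow_eq_iff.2 e, hc⟩) fun hh => ?_
      exact hne (ext_csh e hh)
    obtain ⟨-, -, o, ho, -, -, h2, h3⟩ := label_crossing hG hgp hω e.symm hlt
    exact ⟨o, ho, h2, h3⟩
  · exact label_arc hG hgp hω hz e hne

lemma not_mem_arc_of_passesUnder (hgp : GeneralPosition L ω) {i₀ j₀ : Fin m}
    (hω : ω.Joins L i₀ j₀) {i : Fin m} {s : ℝ} (h : L.PassesUnder i s) :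
    L.curve i s ∉ support ω.edges := by
  obtain ⟨j, t, e, hlt⟩ := h
  intro hs
  rw [hgp.eq_of_mem_both hω (L.curve_mem_carrier i s) hs (Or.inl (L.curve_mem_carrier j t))
    (shadow_eq_iff.1 e)] at hlt
  exact lt_irrefl _ hlt

end Double

end MarkedLink

end

noncomputable section

namespace MarkedLink

open Filter Topology

/-! ### Labels along arcs of the diagram -/

section Glue

variable {m : ℕ} {L : PolygonalLink m} {ω : PolygonalArc} {G : ℂ → (Quaternion ℝ)ˣ}

lemma LabR.eventually_labL {i : Fin m} {s : ℝ} {x : (Quaternion ℝ)ˣ} (h : LabR L G i s x) :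
    ∀ᶠ t in 𝓝[>] s, LabL L G i t x := by
  filter_upwards [eventually_eventually_nhdsWithin.2 h, self_mem_nhdsWithin] with t ht hst
  rw [nhdsWithin_eq_nhds.2 (Ioi_mem_nhds hst)] at ht
  exact ht.filter_mono nhdsWithin_le_nhds

lemma LabL.eventually_labL {i : Fin m} {s : ℝ} {x : (Quaternion ℝ)ˣ} (h : LabL L G i s x) :
    ∀ᶠ t in 𝓝[<] s, LabL L G i t x := by
  filter_upwards [eventually_eventually_nhdsWithin.2 h, self_mem_nhdsWithin] with t ht hst
  rw [nhdsWithin_eq_nhds.2 (Iio_mem_nhds hst)] at ht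
  exact ht.filter_mono nhdsWithin_le_nhds

lemma exists_labL (hG : IsDehn L ω.edges G) (hgp : GeneralPosition L ω) {i₀ j₀ : Fin m}
    (hω : ω.Joins L i₀ j₀) (i : Fin m) (s : ℝ) : ∃ x ∈ circleB, LabL L G i s x := by
  by_cases h : L.PassesUnder i s
  · obtain ⟨j, t, e, hlt⟩ := h
    obtain ⟨x, hx, -, -, h, -⟩ := label_crossing hG hgp hω (shadow_eq_iff.1 e) hlt
    exact ⟨x, hx, h⟩
  · obtain ⟨x, hx, h, -⟩ := label_of_not_passesUnder hG hgp hω h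
    exact ⟨x, hx, h⟩

lemma exists_labR (hG : IsDehn L ω.edges G) (hgp : GeneralPosition L ω) {i₀ j₀ : Fin m}
    (hω : ω.Joins L i₀ j₀) {i : Fin m} {s : ℝ} (h : L.PassesUnder i s) :
    ∃ x ∈ circleB, LabR L G i s x := by
  obtain ⟨j, t, e, hlt⟩ := h
  obtain ⟨x, hx, o, ho, -, h, -⟩ := label_crossing hG hgp hω (shadow_eq_iff.1 e) hlt
  refine ⟨_, ?_, h⟩
  rw [conj_inv_of_mem_circleB ho]
  exact mul_mem_circleB_conj hx (Or.inr ho)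

/-- The label does not change between two consecutive undercrossings or endpoints of the arc. -/
lemma LabR.labL_of_free (hG : IsDehn L ω.edges G) (hgp : GeneralPosition L ω) {i₀ j₀ : Fin m}
    (hω : ω.Joins L i₀ j₀) {i : Fin m} {s₁ s₂ : ℝ} (hs : s₁ < s₂) {x : (Quaternion ℝ)ˣ}
    (hx : LabR L G i s₁ x) (h : ∀ s ∈ Set.Ioo s₁ s₂, ¬ L.PassesUnder i s)
    (h' : ∀ s ∈ Set.Ioo s₁ s₂, L.curve i s ∉ support ω.edges) : LabL L G i s₂ x := by
  -- Being the left label is a locally constant property on the open interval: at each point the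
  -- labels on the two sides agree. Connectedness then transports `x` from one end to the other.
  have key : ∀ s ∈ Set.Ioo s₁ s₂, ∀ᶠ t in 𝓝[Set.Ioo s₁ s₂] s,
      (LabL L G i s x ↔ LabL L G i t x) := by
    intro s hs
    obtain ⟨y, -, h1, h2⟩ := label_of_not_passesUnder hG hgp hω (h s hs)
    rw [if_neg (h' s hs)] at h2
    have h3 : ∀ᶠ t in 𝓝[≠] s, LabL L G i t y := by
      rw [← Set.Iio_union_Ioi, nhdsWithin_union]
      exact eventually_sup.2 ⟨h1.eventually_labL, h2.eventually_labL⟩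
    have h4 : ∀ᶠ t in 𝓝 s, LabL L G i t y := by
      rw [eventually_nhdsWithin_iff] at h3
      filter_upwards [h3] with t ht
      by_cases e : t = s
      · rw [e]; exact h1
      · exact ht e
    refine (h4.filter_mono nhdsWithin_le_nhds).mono fun t ht => ⟨fun h5 => ?_, fun h5 => ?_⟩
    · rw [h5.unique h1]; exact ht
    · rw [h5.unique ht]; exact h1
  obtain ⟨z, -, hz⟩ := exists_labL hG hgp hω i s₂
  obtain ⟨a, ha, ha'⟩ := (hx.eventually_labL.and (Ioo_mem_nhdsGT hs)).exists
  obtain ⟨b, hb, hb'⟩ := (hz.eventually_labL.and (Ioo_mem_nhdsLT hs)).exists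
  have := isPreconnected_Ioo.induction₂ (fun s t => LabL L G i s x ↔ LabL L G i t x) key
    (fun _ _ _ _ _ _ => Iff.trans) (fun _ _ _ _ => Iff.symm) ha' hb'
  rw [(this.1 ha).unique hb]
  exact hz

open Classical in
/-- The label changes its sign when an endpoint of the arc is passed. -/
lemma LabR.labL (hG : IsDehn L ω.edges G) (hgp : GeneralPosition L ω) {i₀ j₀ : Fin m}
    (hω : ω.Joins L i₀ j₀) {i : Fin m} {s₁ s₂ : ℝ} (hs : s₁ < s₂) {x : (Quaternion ℝ)ˣ}
    (hx : LabR L G i s₁ x) (h : ∀ s ∈ Set.Ioo s₁ s₂, ¬ L.PassesUnder i s)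
    (h' : ∀ s ∈ Set.Ioo s₁ s₂, ∀ t ∈ Set.Ioo s₁ s₂, L.curve i s ∈ support ω.edges →
      L.curve i t ∈ support ω.edges → s = t) :
    LabL L G i s₂ (if ∃ s ∈ Set.Ioo s₁ s₂, L.curve i s ∈ support ω.edges then -x else x) := by
  split_ifs with hex
  · obtain ⟨e, he, heω⟩ := hex
    have h1 := hx.labL_of_free hG hgp hω he.1 (fun s hs => h s ⟨hs.1, hs.2.trans he.2⟩)
      (fun s hs hsω => hs.2.ne (h' s ⟨hs.1, hs.2.trans he.2⟩ e he hsω heω))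
    obtain ⟨y, -, h2, h3⟩ := label_of_not_passesUnder hG hgp hω (h e he)
    rw [if_pos heω, ← h1.unique h2] at h3
    exact h3.labL_of_free hG hgp hω he.2 (fun s hs => h s ⟨he.1.trans hs.1, hs.2⟩)
      (fun s hs hsω => hs.1.ne' (h' s ⟨he.1.trans hs.1, hs.2⟩ e he hsω heω))
  · push Not at hex
    exact hx.labL_of_free hG hgp hω hs h hex

lemma hasLab_add_len {i : Fin m} {s : ℝ} {x : (Quaternion ℝ)ˣ} (k : ℤ) :
    HasLab L G i (s + k * L.len i) x ↔ HasLab L G i s x := by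
  have e : L.dirOut i (s + k * L.len i) = L.dirOut i s := by
    have : s + k * L.len i = s + ((k * L.len i : ℤ) : ℝ) := by push_cast; ring
    rw [PolygonalLink.dirOut, PolygonalLink.dirOut, this, Int.floor_add_intCast]
    push_cast
    simp
  rw [HasLab, HasLab, L.curve_add_len, e]

lemma LabL.add_len {i : Fin m} {s : ℝ} {x : (Quaternion ℝ)ˣ} (h : LabL L G i s x) (k : ℤ) :
    LabL L G i (s + k * L.len i) x := by
  have h1 : Tendsto (fun t : ℝ => t - k * L.len i) (𝓝[<] (s + k * L.len i)) (𝓝[<] s) := by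
    refine tendsto_nhdsWithin_iff.2 ⟨?_, ?_⟩
    · have : Continuous fun t : ℝ => t - k * L.len i := by fun_prop
      have := this.tendsto (s + k * L.len i)
      rw [add_sub_cancel_right] at this
      exact this.mono_left nhdsWithin_le_nhds
    · filter_upwards [self_mem_nhdsWithin] with t ht
      exact sub_lt_iff_lt_add.2 (Set.mem_Iio.1 ht)
  refine (h1.eventually h).mono fun t ht => ?_
  rw [← hasLab_add_len k, sub_add_cancel] at ht
  exact ht

lemma LabR.add_len {i : Fin m} {s : ℝ} {x : (Quaternion ℝ)ˣ} (h : LabR L G i s x) (k : ℤ) :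
    LabR L G i (s + k * L.len i) x := by
  have h1 : Tendsto (fun t : ℝ => t - k * L.len i) (𝓝[>] (s + k * L.len i)) (𝓝[>] s) := by
    refine tendsto_nhdsWithin_iff.2 ⟨?_, ?_⟩
    · have : Continuous fun t : ℝ => t - k * L.len i := by fun_prop
      have := this.tendsto (s + k * L.len i)
      rw [add_sub_cancel_right] at this
      exact this.mono_left nhdsWithin_le_nhds
    · filter_upwards [self_mem_nhdsWithin] with t ht
      exact lt_sub_iff_add_lt.2 (Set.mem_Ioi.1 ht)
  refine (h1.eventually h).mono fun t ht => ?_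
  rw [← hasLab_add_len k, sub_add_cancel] at ht
  exact ht

lemma unit_ne_neg (x : (Quaternion ℝ)ˣ) : x ≠ -x := by
  intro h
  have h1 : (x : Quaternion ℝ) = -x := congrArg Units.val h
  have h2 : (2 : ℝ) • (x : Quaternion ℝ) = 0 := by
    rw [two_smul]; nth_rewrite 1 [h1]; exact neg_add_cancel _
  exact x.ne_zero ((smul_eq_zero.1 h2).resolve_left two_ne_zero)

/-- A component on which the arc ends once passes under the link somewhere. -/
lemma exists_passesUnder (hG : IsDehn L ω.edges G) (hgp : GeneralPosition L ω) {i₀ j₀ : Fin m}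
    (hω : ω.Joins L i₀ j₀) {i : Fin m} {e : ℝ}
    (he : ∀ t, L.curve i t ∈ support ω.edges ↔ ∃ k : ℤ, t = e + k * L.len i) :
    ∃ s, L.PassesUnder i s := by
  by_contra! h
  have heω : L.curve i e ∈ support ω.edges := (he e).2 ⟨0, by simp⟩
  obtain ⟨x, -, h1, h2⟩ := label_of_not_passesUnder hG hgp hω (h e)
  rw [if_pos heω] at h2
  have hlen := L.one_le_len i
  -- One turn around the component starts with `-x` just after `e` and meets neither an
  -- undercrossing nor another endpoint, but periodicity requires `x` on arrival.
  have h3 := h2.labL_of_free hG hgp hω (s₂ := e + (1 : ℤ) * L.len i) (by push_cast; linarith)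
    (fun s _ => h s) (fun s hs hsω => by
      obtain ⟨k, rfl⟩ := (he s).1 hsω
      have h4 := (lt_add_iff_pos_right e).1 hs.1
      have h5 := lt_of_mul_lt_mul_right ((add_lt_add_iff_left e).1 hs.2) (by linarith)
      have h6 : (0 : ℝ) < k := pos_of_mul_pos_left h4 (by linarith)
      norm_cast at h5 h6
      omega)
  exact unit_ne_neg x ((h1.add_len 1).unique h3)

end Glue

/-! ### The cuts of a component and the arcs between them. -/

namespace PolygonalLink.ArcLabelling

variable {m : ℕ} {L : PolygonalLink m} (lab : L.ArcLabelling)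

lemma cut_add_mul (i : Fin m) (k q : ℤ) :
    lab.cut i (k + q * lab.num i) = lab.cut i k + q * L.len i := by
  induction q using Int.induction_on with
  | zero => simp
  | succ n ih =>
    rw [show k + ((n : ℤ) + 1) * lab.num i = k + n * lab.num i + lab.num i by ring,
      lab.cut_add_num, ih]
    push_cast; ring
  | pred n ih =>
    have := lab.cut_add_num i (k + (-n - 1) * lab.num i)
    rw [show k + (-(n : ℤ) - 1) * lab.num i + lab.num i = k + -n * lab.num i by ring, ih] at this
    push_cast at this ⊢
    linarith

lemma cut_sub_le (i : Fin m) (k : ℤ) : lab.cut i k ≤ lab.cut i (k - 1) + L.len i := by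
  rw [← lab.cut_add_num]
  have : (1 : ℤ) ≤ lab.num i := by exact_mod_cast Nat.one_le_iff_ne_zero.2 (NeZero.ne _)
  exact (lab.cut_strictMono i).monotone (by omega)

/-- Periodicity makes the cuts unbounded in both directions, so there is a first cut at or after
`t`. -/
lemma exists_mem_Ioc (i : Fin m) (t : ℝ) :
    ∃ k : ℤ, t ∈ Set.Ioc (lab.cut i (k - 1)) (lab.cut i k) := by
  have hlen := L.one_le_len i
  have hbd : ∃ b : ℤ, ∀ k, t ≤ lab.cut i k → b ≤ k := by
    obtain ⟨q, hq⟩ := exists_int_lt ((t - lab.cut i 0) / L.len i)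
    rw [lt_div_iff₀ (by linarith)] at hq
    refine ⟨0 + q * lab.num i, fun k hk => ?_⟩
    by_contra! hc
    have := (lab.cut_strictMono i) hc
    rw [lab.cut_add_mul] at this
    linarith
  have hex : ∃ k, t ≤ lab.cut i k := by
    obtain ⟨q, hq⟩ := exists_int_gt ((t - lab.cut i 0) / L.len i)
    rw [div_lt_iff₀ (by linarith)] at hq
    exact ⟨0 + q * lab.num i, by rw [lab.cut_add_mul]; linarith⟩
  obtain ⟨k, hk, hmin⟩ := Int.exists_least_of_bdd hbd hex
  exact ⟨k, not_le.1 fun h => by linarith [hmin _ h], hk⟩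

lemma eq_of_mem_Ioc {i : Fin m} {t : ℝ} {k l : ℤ}
    (hk : t ∈ Set.Ioc (lab.cut i (k - 1)) (lab.cut i k))
    (hl : t ∈ Set.Ioc (lab.cut i (l - 1)) (lab.cut i l)) : k = l := by
  have h1 := (lab.cut_strictMono i).lt_iff_lt.1 (hk.1.trans_le hl.2)
  have h2 := (lab.cut_strictMono i).lt_iff_lt.1 (hl.1.trans_le hk.2)
  omega

/-- The residue class that names an arc depends only on the point of the component, not on the
parameter chosen modulo the period. -/
lemma cast_eq_of_mem_Ioc {i : Fin m} {t : ℝ} {k l q : ℤ}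
    (hk : t ∈ Set.Ioc (lab.cut i (k - 1)) (lab.cut i k))
    (hl : t + q * L.len i ∈ Set.Ioc (lab.cut i (l - 1)) (lab.cut i l)) :
    (k : ZMod (lab.num i)) = l := by
  have : k + q * lab.num i = l := by
    refine lab.eq_of_mem_Ioc ?_ hl
    rw [show k + q * lab.num i - 1 = k - 1 + q * lab.num i by ring, lab.cut_add_mul,
      lab.cut_add_mul]
    exact ⟨by linarith [hk.1], by linarith [hk.2]⟩
  rw [← this]
  push_cast
  simp

lemma not_passesUnder {i : Fin m} (h : ∃ s, L.PassesUnder i s) (k : ℤ) :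
    ∀ s ∈ Set.Ioo (lab.cut i (k - 1)) (lab.cut i k), ¬ L.PassesUnder i s := by
  intro s hs hu
  have : s ∈ Set.range (lab.cut i) := by rw [lab.range_cut i h]; exact hu
  obtain ⟨l, rfl⟩ := this
  have h1 := (lab.cut_strictMono i).lt_iff_lt.1 hs.1
  have h2 := (lab.cut_strictMono i).lt_iff_lt.1 hs.2
  omega

lemma passesUnder_cut {i : Fin m} (h : ∃ s, L.PassesUnder i s) (k : ℤ) :
    L.PassesUnder i (lab.cut i k) := by
  have : lab.cut i k ∈ {s | L.PassesUnder i s} := by rw [← lab.range_cut i h]; exact ⟨k, rfl⟩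
  exact this

/-- Two over strands would produce a triple point. Parameters of the same point differ by a period
and hence name the same arc. -/
lemma existsUnique_passesOver {ω : PolygonalArc} (hgp : GeneralPosition L ω) {a : lab.Arc}
    (ha : lab.IsCrossing a) : ∃! b, lab.PassesOver b a := by
  obtain ⟨j, t, e, hlt⟩ := ha
  obtain ⟨k, hk⟩ := lab.exists_mem_Ioc j t
  refine ⟨⟨j, k⟩, ⟨k, rfl, t, hk, e, hlt⟩, ?_⟩
  rintro ⟨j', c⟩ ⟨k', hc, t', hk', e', hlt'⟩
  dsimp only at k' hc t' hk' e' hlt'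
  have h1 : L.curve j' t' ≠ L.curve a.1 (lab.endCut a) := fun h => by
    rw [h] at hlt'; exact lt_irrefl _ hlt'
  have h2 : L.curve j t ≠ L.curve a.1 (lab.endCut a) := fun h => by
    rw [h] at hlt; exact lt_irrefl _ hlt
  have h3 : L.curve j' t' = L.curve j t :=
    (hgp.triple (Or.inl (L.curve_mem_carrier j t)) (Or.inl (L.curve_mem_carrier _ _))
      (Or.inl (L.curve_mem_carrier j' t')) (shadow_eq_iff.1 e) (shadow_eq_iff.1 e')
      h2).resolve_right h1
  obtain ⟨rfl, q, rfl⟩ := L.curve_inj h3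
  rw [← hc, lab.cast_eq_of_mem_Ioc hk hk']

end PolygonalLink.ArcLabelling

end MarkedLink

end

noncomputable section

namespace MarkedLink

/-! ### Integer linear algebra of the crossing matrix -/

section Algebra

/-- A singular integer minor has a nonzero integer left null vector, which division by the gcd of
its entries makes primitive. Extension by zero at `a₀` kills the remaining columns, and the last one
follows because every row sum is zero. -/
lemma exists_odd_vecMul_eq_zero {ι : Type*} [Fintype ι] [DecidableEq ι] (M : Matrix ι ι ℤ)
    (hrow : ∀ a, ∑ b, M a b = 0) (a₀ : ι)
    (h : (M.submatrix (Subtype.val : {b : ι // b ≠ a₀} → ι) Subtype.val).det = 0) :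
    ∃ w : ι → ℤ, w a₀ = 0 ∧ (∃ b, Odd (w b)) ∧ ∀ b, ∑ a, w a * M a b = 0 := by
  obtain ⟨v, hv, hvM⟩ := Matrix.exists_vecMul_eq_zero_iff.2 h
  obtain ⟨b₀, hb₀⟩ := Function.ne_iff.1 hv
  obtain ⟨g, hg, hg1⟩ := Finset.univ.extract_gcd v ⟨b₀, Finset.mem_univ _⟩
  set d := Finset.univ.gcd v with hd
  have hd0 : d ≠ 0 := fun h0 => hb₀ (by
    have := hg b₀ (Finset.mem_univ _)
    rw [h0, zero_mul] at this
    exact this)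
  -- If all entries were even, `2` would divide the gcd `1`.
  have hodd : ∃ b, Odd (g b) := by
    by_contra! hc
    have h2 : (2 : ℤ) ∣ Finset.univ.gcd g :=
      Finset.dvd_gcd fun b _ => (Int.not_odd_iff_even.1 (hc b)).two_dvd
    rw [hg1] at h2
    norm_num at h2
  have hgM (b : {b : ι // b ≠ a₀}) : ∑ a, g a * M a b = 0 := by
    have h1 : ∑ a, v a * M a b = 0 := congrFun hvM b
    have h2 : d * ∑ a, g a * M a b = 0 := by
      rw [← h1, Finset.mul_sum]
      exact Finset.sum_congr rfl fun a ha => by rw [hg a ha, mul_assoc]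
    exact (mul_eq_zero.1 h2).resolve_left hd0
  set w : ι → ℤ := fun b => if hb : b ≠ a₀ then g ⟨b, hb⟩ else 0 with hw
  have hsum (f : ι → ℤ) : ∑ a, w a * f a = ∑ a, g a * f a := by
    rw [← Fintype.sum_subtype_add_sum_subtype (fun b => b ≠ a₀)]
    have h1 : ∑ a : {b // ¬ b ≠ a₀}, w a * f a = 0 :=
      Finset.sum_eq_zero fun a _ => by simp [hw, not_not.1 a.2]
    rw [h1, add_zero]
    exact Finset.sum_congr rfl fun a _ => by simp [hw, a.2]
  have hcol (b : ι) (hb : b ≠ a₀) : ∑ a, w a * M a b = 0 := by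
    rw [hsum]; exact hgM ⟨b, hb⟩
  refine ⟨w, by simp [hw], ?_, fun b => ?_⟩
  · obtain ⟨⟨b, hb⟩, hodd⟩ := hodd
    exact ⟨b, by simpa [hw, hb] using hodd⟩
  · by_cases hb : b = a₀
    · have h1 : ∑ b, ∑ a, w a * M a b = 0 := by
        rw [Finset.sum_comm]
        simp [← Finset.mul_sum, hrow]
      rw [Fintype.sum_eq_single a₀ hcol] at h1
      rw [hb]; exact h1
    · exact hcol b hb

lemma zmod_const {n : ℕ} [NeZero n] {α : Type*} (f : ZMod n → α) (h : ∀ k, f (k + 1) = f k)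
    (k l : ZMod n) : f k = f l := by
  have key (k : ZMod n) : f k = f 0 := by
    rw [← ZMod.natCast_zmod_val k]
    induction k.val with
    | zero => simp
    | succ q ih => rw [Nat.cast_add_one, h, ih]
  rw [key, key l]

/-- The obstruction: the linear system with one odd right hand side on each component. -/
lemma false_of_system {n : Fin 2 → ℕ} [∀ i, NeZero (n i)]
    (M : Matrix (Σ i, ZMod (n i)) (Σ i, ZMod (n i)) ℤ)
    (ov : (Σ i, ZMod (n i)) → Σ i, ZMod (n i))
    (hM : ∀ a b, M a b = (if b = a then 1 else 0) + (if b = ⟨a.1, a.2 + 1⟩ then 1 else 0)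
      - 2 * (if b = ov a then 1 else 0)) (a₀ : Σ i, ZMod (n i))
    (hdet : (M.submatrix (Subtype.val : {b // b ≠ a₀} → _) Subtype.val).det = 0)
    (θ : (Σ i, ZMod (n i)) → ℝ) (v z : (Σ i, ZMod (n i)) → ℤ)
    (hθ : ∀ a, θ a + θ ⟨a.1, a.2 + 1⟩ - 2 * θ (ov a) = Real.pi * (v a + 2 * z a))
    (hv : ∀ i, ∃ k, v ⟨i, k⟩ = 1 ∧ ∀ k', k' ≠ k → v ⟨i, k'⟩ = 0) : False := by
  obtain ⟨w, hw0, ⟨b₀, hodd⟩, hw⟩ := exists_odd_vecMul_eq_zero M (fun a => by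
    simp [hM, Finset.sum_add_distrib, Finset.sum_sub_distrib]) a₀ hdet
  -- Pairing the real system `M θ = π (v + 2 z)` with `w` kills the left side; what remains is `π`
  -- times an integer.
  have h1 : ∑ a, w a * (v a + 2 * z a) = 0 := by
    have h2 : ∑ a, (w a : ℝ) * ∑ b, (M a b : ℝ) * θ b = 0 := by
      simp_rw [Finset.mul_sum]
      rw [Finset.sum_comm]
      refine Finset.sum_eq_zero fun b _ => ?_
      have : (∑ a, (w a : ℝ) * M a b) = 0 := by exact_mod_cast hw b
      simp_rw [← mul_assoc]
      rw [← Finset.sum_mul, this, zero_mul]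
    have h3 (a) : ∑ b, (M a b : ℝ) * θ b = Real.pi * (v a + 2 * z a) := by
      rw [← hθ]
      simp [hM, add_mul, sub_mul, Finset.sum_add_distrib, Finset.sum_sub_distrib]
    simp_rw [h3] at h2
    have h4 : Real.pi * ((∑ a, w a * (v a + 2 * z a) : ℤ) : ℝ) = 0 := by
      rw [← h2, Int.cast_sum, Finset.mul_sum]
      refine Finset.sum_congr rfl fun a _ => ?_
      push_cast; ring
    exact_mod_cast (mul_eq_zero.1 h4).resolve_left Real.pi_ne_zero
  -- Modulo 2 the over strands drop out of `M`, and the column of an arc contains only that arc and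
  -- its predecessor.
  have h2 : ∀ a, (w ⟨a.1, a.2 + 1⟩ : ZMod 2) = w a := by
    intro a
    have h3 := congrArg (Int.cast : ℤ → ZMod 2) (hw ⟨a.1, a.2 + 1⟩)
    have h5 (a' : Σ i, ZMod (n i)) :
        ((⟨a.1, a.2 + 1⟩ : Σ i, ZMod (n i)) = ⟨a'.1, a'.2 + 1⟩) = (a' = a) := by
      obtain ⟨i, k⟩ := a
      obtain ⟨i', k'⟩ := a'
      refine propext ⟨fun h => ?_, fun h => h ▸ rfl⟩
      obtain rfl : i = i' := congrArg Sigma.fst h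
      have := eq_of_heq (Sigma.mk.inj h).2
      have h6 : k = k' := add_right_cancel this
      rw [h6]
    have h4 : (2 : ZMod 2) = 0 := rfl
    simp only [hM, h5] at h3
    push_cast at h3
    simp only [h4, zero_mul, sub_zero, mul_add, Finset.sum_add_distrib] at h3
    simp at h3
    have h6 : ∀ x y : ZMod 2, x + y = 0 → x = y := by decide
    exact h6 _ _ h3
  have h3 (i) (k l : ZMod (n i)) : (w ⟨i, k⟩ : ZMod 2) = w ⟨i, l⟩ :=
    zmod_const (fun k => (w ⟨i, k⟩ : ZMod 2)) (fun k => h2 ⟨i, k⟩) k l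
  choose k hk hk' using hv
  -- Modulo 2 only the two arcs with `v = 1` survive in the pairing, one from each component.
  have h4 : (w ⟨0, k 0⟩ : ZMod 2) + w ⟨1, k 1⟩ = 0 := by
    have h5 := congrArg (Int.cast : ℤ → ZMod 2) h1
    have h6 : (2 : ZMod 2) = 0 := rfl
    push_cast at h5
    simp only [h6, zero_mul, add_zero] at h5
    rw [Fintype.sum_sigma, Fin.sum_univ_two] at h5
    have h7 (i) : ∑ l, (w ⟨i, l⟩ : ZMod 2) * v ⟨i, l⟩ = w ⟨i, k i⟩ := by
      rw [Fintype.sum_eq_single (k i), hk]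
      · simp
      · intro l hl
        rw [hk' i l hl]; simp
    rwa [h7, h7] at h5
  have h5 : ∀ a, (w a : ZMod 2) = 0 := by
    obtain ⟨i₀, k₀⟩ := a₀
    have e1 : ∀ k, (w ⟨i₀, k⟩ : ZMod 2) = 0 := fun k => by rw [h3 i₀ k k₀, hw0]; simp
    rintro ⟨i, l⟩
    rw [h3 i l (k i)]
    fin_cases i₀ <;> fin_cases i
    · exact e1 _
    · have := e1 (k 0)
      simp only [Fin.zero_eta] at this
      rw [this, zero_add] at h4
      exact h4
    · have := e1 (k 1)
      simp only [Fin.mk_one] at this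
      rw [this, add_zero] at h4
      exact h4
    · exact e1 _
  have h6 := (ZMod.intCast_eq_zero_iff_even).1 (h5 b₀)
  exact (Int.not_even_iff_odd.2 hodd) h6

end Algebra

end MarkedLink

end

noncomputable section

namespace MarkedLink

/-! ### There are no representations of the link with the arc -/

lemma expI_add_pi (a : ℝ) : expI (a + Real.pi) = -expI a := by
  apply Quaternion.ext <;> simp [expI_re, expI_imI, expI_imJ, expI_imK]

lemma val_neg_eq {x : (Quaternion ℝ)ˣ} {a : ℝ} (hx : (x : Quaternion ℝ) = quatJ * expI a) :
    ((-x : (Quaternion ℝ)ˣ) : Quaternion ℝ) = quatJ * expI (a + Real.pi) := by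
  rw [Units.val_neg, hx, expI_add_pi, mul_neg]

/-- On angles, conjugation within `S¹_B` is the reflection about `b`. This is the source of the
coefficients `1, 1, -2` in the rows of the matrix. -/
lemma val_conj_eq {x o : (Quaternion ℝ)ˣ} {a b : ℝ} (hx : (x : Quaternion ℝ) = quatJ * expI a)
    (ho : (o : Quaternion ℝ) = quatJ * expI b) :
    ((o * x * o⁻¹ : (Quaternion ℝ)ˣ) : Quaternion ℝ) = quatJ * expI (2 * b - a) := by
  rw [inv_eq_neg_of_mem_circleB ⟨b, ho⟩, mul_neg, Units.val_neg, Units.val_mul, Units.val_mul, hx,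
    ho]
  have h1 : quatJ * expI b * (quatJ * expI a) = expI (Real.pi + (-b + a)) := by
    rw [mul_assoc, ← mul_assoc (expI b), expI_mul_J, mul_assoc, expI_mul, ← mul_assoc,
      quatJ_mul_self, expI_mul]
  rw [h1, ← mul_assoc, expI_mul_J, mul_assoc, expI_mul, ← mul_neg, ← expI_add_pi]
  congr 2; ring

lemma exists_int_of_expI_eq {a b : ℝ} (h : quatJ * expI a = quatJ * expI b) :
    ∃ k : ℤ, a - b = 2 * Real.pi * k := by
  have h1 : expI (Real.pi + a) = expI (Real.pi + b) := by
    rw [← expI_mul, ← expI_mul, ← quatJ_mul_self, mul_assoc, h, ← mul_assoc]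
  have h2 := congrArg (fun q : Quaternion ℝ => q.re) h1
  have h3 := congrArg (fun q : Quaternion ℝ => q.imI) h1
  simp only [expI_re, expI_imI] at h2 h3
  obtain ⟨k, hk⟩ := Real.Angle.angle_eq_iff_two_pi_dvd_sub.1 (Real.Angle.cos_sin_inj h2 h3)
  exact ⟨k, by linarith⟩

lemma conj_neg_left (o y : (Quaternion ℝ)ˣ) : -o * y * (-o)⁻¹ = o * y * o⁻¹ := by
  rw [inv_neg]; simp

section Empty

variable {L : PolygonalLink 2} {ω : PolygonalArc}

/-- The arc ends once on each component. -/
lemma exists_end {i j : Fin 2} (hij : i ≠ j) (hω : ω.Joins L i j) (i' : Fin 2) :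
    ∃ e : ℝ, ∀ t, L.curve i' t ∈ support ω.edges ↔ ∃ k : ℤ, t = e + k * L.len i' := by
  have hend : ω.vertex 0 ∈ support ω.edges ∧ ω.vertex ω.len ∈ support ω.edges := by
    rw [ω.mem_support_edges, ω.mem_support_edges]
    exact ⟨⟨0, ⟨le_rfl, Nat.cast_nonneg _⟩, by simpa using (ω.curve_nat 0).symm⟩,
      ⟨ω.len, ⟨Nat.cast_nonneg _, le_rfl⟩, (ω.curve_nat _).symm⟩⟩
  obtain ⟨e₁, h₁⟩ := L.mem_support_edges.1 hω.1
  obtain ⟨e₂, h₂⟩ := L.mem_support_edges.1 hω.2.1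
  have key {i j : Fin 2} (hij : i ≠ j) {e f : ℝ} (h : L.curve i e ∈ support ω.edges)
      (h' : ∀ x ∈ support ω.edges, x ∈ L.carrier → x = L.curve i e ∨ x = L.curve j f) (t : ℝ) :
      L.curve i t ∈ support ω.edges ↔ ∃ k : ℤ, t = e + k * L.len i := by
    constructor
    · intro ht
      rcases h' _ ht (L.curve_mem_carrier i t) with h1 | h1
      · exact (L.curve_inj h1).2
      · exact absurd (L.curve_inj h1).1 hij
    · rintro ⟨k, rfl⟩
      rwa [L.curve_add_len]
  have hor : i' = i ∨ i' = j := by omega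
  rcases hor with rfl | rfl
  · exact ⟨e₁, key hij (h₁ ▸ hend.1) (by rw [← h₁, ← h₂]; exact hω.2.2)⟩
  · exact ⟨e₂, key hij.symm (h₂ ▸ hend.2) (by
      rw [← h₁, ← h₂]; exact fun x a b => (hω.2.2 x a b).symm)⟩

-- The labels at the starting points of the arcs have angles `θ`. The crossing rule, with a shift by
-- `π` on the one arc of each component where the marking arc ends, is the linear system excluded by
-- `false_of_system`.
open Classical in
theorem isEmpty_RB {i j : Fin 2} (hij : i ≠ j) (hω : ω.Joins L i j) (hgp : GeneralPosition L ω)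
    (lab : L.ArcLabelling) (a₀ : lab.Arc) (hdet : lab.det a₀ = 0)
    (x₀ : Complement (L.carrier ∪ support ω.edges)) : IsEmpty (RB L ω.edges x₀) := by
  refine ⟨fun q => ?_⟩
  obtain ⟨ρ⟩ := q
  obtain ⟨G, hG⟩ := exists_isDehn ω.finite_edges ρ
  choose e he using exists_end hij hω
  have hU := fun i => exists_passesUnder hG hgp hω (he i)
  have hcutω (i : Fin 2) (k : ℤ) : L.curve i (lab.cut i k) ∉ support ω.edges :=
    not_mem_arc_of_passesUnder hgp hω (lab.passesUnder_cut (hU i) k)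
  -- Arc `k` starts at the cut `k - 1`, so `x a` is the label just after the cut with index `a.2.val
  -- - 1`; for the residue `0` this is the cut `-1`.
  choose x hxB hxR using fun a : lab.Arc =>
    exists_labR hG hgp hω (lab.passesUnder_cut (hU a.1) (a.2.val - 1))
  have hval (i : Fin 2) (k : ℤ) : ∃ q : ℤ, k = ((k : ZMod (lab.num i)).val : ℤ) + q * lab.num i := by
    refine ⟨k / lab.num i, ?_⟩
    rw [ZMod.val_intCast, mul_comm]
    exact (Int.emod_add_mul_ediv k _).symm
  have hxR' (i : Fin 2) (k : ℤ) : LabR L G i (lab.cut i (k - 1)) (x ⟨i, k⟩) := by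
    obtain ⟨q, hq⟩ := hval i k
    have h1 := (hxR ⟨i, k⟩).add_len q
    rw [← lab.cut_add_mul, show ((k : ZMod (lab.num i)).val : ℤ) - 1 + q * lab.num i = k - 1 by
      linarith] at h1
    exact h1
  -- Within one arc the label stays `±x`. An arc spans at most one period, and endpoint parameters
  -- on a component differ by full periods, so the sign changes at most once.
  have hxL (i : Fin 2) (k : ℤ) (t : ℝ) (ht : t ∈ Set.Ioc (lab.cut i (k - 1)) (lab.cut i k)) :
      LabL L G i t (if ∃ s ∈ Set.Ioo (lab.cut i (k - 1)) t, L.curve i s ∈ support ω.edges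
        then -x ⟨i, k⟩ else x ⟨i, k⟩) := by
    refine (hxR' i k).labL hG hgp hω ht.1
      (fun s hs => lab.not_passesUnder (hU i) k s ⟨hs.1, hs.2.trans_le ht.2⟩) ?_
    intro s hs s' hs' hsω hsω'
    obtain ⟨q, hq⟩ := (he i s).1 hsω
    obtain ⟨q', hq'⟩ := (he i s').1 hsω'
    have hle := lab.cut_sub_le i k
    have hlen := L.one_le_len i
    have h1 : ((q - q' : ℤ) : ℝ) * L.len i < 1 * L.len i := by
      push_cast; linarith [hs.1, hs.2, hs'.1, hs'.2, ht.2]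
    have h2 : ((q' - q : ℤ) : ℝ) * L.len i < 1 * L.len i := by
      push_cast; linarith [hs.1, hs.2, hs'.1, hs'.2, ht.2]
    have h3 := lt_of_mul_lt_mul_right h1 (by linarith)
    have h4 := lt_of_mul_lt_mul_right h2 (by linarith)
    norm_cast at h3 h4
    rw [hq, hq', show q = q' by omega]
  choose θ hθ using hxB
  choose ov hov using fun a : lab.Arc =>
    (lab.existsUnique_passesOver hgp (a := a) (lab.passesUnder_cut (hU a.1) _))
  set v : lab.Arc → ℤ := fun a => if ∃ s ∈ Set.Ioo (lab.cut a.1 (a.2.val - 1))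
    (lab.cut a.1 a.2.val), L.curve a.1 s ∈ support ω.edges then 1 else 0 with hv
  have hz (a : lab.Arc) : ∃ z : ℤ,
      θ a + θ ⟨a.1, a.2 + 1⟩ - 2 * θ (ov a) = Real.pi * (v a + 2 * z) := by
    obtain ⟨k, hk, t, ht, hsh, hlt⟩ := (hov a).1
    obtain ⟨y, -, o, -, h1, h2, h3, -⟩ := label_crossing hG hgp hω (shadow_eq_iff.1 hsh) hlt
    have h4 := h3.unique (hxL _ k t ht)
    rw [hk] at h4
    -- The over strand may already have passed the endpoint of `ω`, but its sign does not matter for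
    -- conjugation.
    have h5 : o * y * o⁻¹ = x (ov a) * y * (x (ov a))⁻¹ := by
      rw [h4]
      split_ifs
      · exact conj_neg_left _ _
      · rfl
    have h6 := hxR' a.1 (a.2.val + 1)
    rw [add_sub_cancel_right] at h6
    have h7 : ((a.2.val + 1 : ℤ) : ZMod (lab.num a.1)) = a.2 + 1 := by
      push_cast; rw [ZMod.natCast_zmod_val]
    rw [h7] at h6
    have h8 := h2.unique h6
    rw [h5] at h8
    have h9 := h1.unique (hxL a.1 a.2.val _ ⟨lab.cut_strictMono _ (by omega), le_rfl⟩)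
    have h10 : ((a.2.val : ℤ) : ZMod (lab.num a.1)) = a.2 := by
      push_cast; rw [ZMod.natCast_zmod_val]
    rw [h10] at h9
    have h11 : (y : Quaternion ℝ) = quatJ * expI (θ a + Real.pi * v a) := by
      by_cases hc : ∃ s ∈ Set.Ioo (lab.cut a.1 (a.2.val - 1)) (lab.cut a.1 a.2.val),
          L.curve a.1 s ∈ support ω.edges
      · rw [show y = -x a from h9.trans (if_pos hc), show v a = 1 from if_pos hc, val_neg_eq (hθ a)]
        simp
      · rw [show y = x a from h9.trans (if_neg hc), show v a = 0 from if_neg hc, hθ a]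
        simp
    have h12 := val_conj_eq h11 (hθ (ov a))
    rw [h8, hθ] at h12
    obtain ⟨z, hz⟩ := exists_int_of_expI_eq h12
    -- The reflection produces `-π v + 2π z`, which equals `π (v + 2 (z - v))`.
    refine ⟨z - v a, ?_⟩
    push_cast
    linarith
  choose z hz using hz
  have hdet' : (lab.crossingMatrix.submatrix
      (Subtype.val : {b : lab.Arc // b ≠ a₀} → lab.Arc) Subtype.val).det = 0 :=
    Int.natAbs_eq_zero.1 hdet
  refine false_of_system lab.crossingMatrix ov (fun a b => ?_) a₀ ?_ θ v z hz fun i => ?_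
  · have h1 : lab.IsCrossing a := lab.passesUnder_cut (hU a.1) _
    have h2 : lab.PassesOver b a ↔ b = ov a := ⟨fun h => (hov a).2 b h, fun h => h ▸ (hov a).1⟩
    rw [PolygonalLink.ArcLabelling.crossingMatrix, if_pos h1]
    simp only [h2]
  · convert hdet'
  · obtain ⟨K, hK⟩ := lab.exists_mem_Ioc i (e i)
    obtain ⟨q, hq⟩ := hval i K
    have heω (q : ℤ) : L.curve i (e i + q * L.len i) ∈ support ω.edges := (he i _).2 ⟨q, rfl⟩
    refine ⟨K, if_pos ⟨e i + (-q : ℤ) * L.len i, ?_, heω _⟩, fun k' hk' => if_neg ?_⟩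
    swap
    · have h1 : ((K : ZMod (lab.num i)).val : ℤ) = K + (-q) * lab.num i := by linarith
      change _ ∈ Set.Ioo (lab.cut i ((K : ZMod (lab.num i)).val - 1 : ℤ))
        (lab.cut i ((K : ZMod (lab.num i)).val : ℤ))
      rw [h1]
      rw [show K + -q * (lab.num i : ℤ) - 1 = K - 1 + -q * lab.num i by ring, lab.cut_add_mul,
        lab.cut_add_mul]
      refine ⟨by linarith [hK.1], ?_⟩
      -- The endpoint of `ω` is not at a cut, because an undercrossing point never lies on `ω`; it
      -- is therefore interior to its arc.
      have : e i ≠ lab.cut i K := fun h => hcutω i K (h ▸ by simpa using heω 0)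
      have := lt_of_le_of_ne hK.2 this
      linarith
    · rintro ⟨s, hs, hsω⟩
      obtain ⟨q', rfl⟩ := (he i s).1 hsω
      refine hk' ?_
      rw [lab.cast_eq_of_mem_Ioc hK ⟨hs.1, hs.2.le⟩]
      push_cast
      rw [ZMod.natCast_zmod_val]

end Empty

end MarkedLink

end

noncomputable section

namespace MarkedLink

open Matrix

/-! ### Products of spin projectors around a polygon -/

/-- The Pauli matrix `|a| + σ · a`. -/
def spin (a : E3) : Matrix (Fin 2) (Fin 2) ℂ :=
  !![((‖a‖ + a 2 : ℝ) : ℂ), a 0 - a 1 * Complex.I; a 0 + a 1 * Complex.I, ((‖a‖ - a 2 : ℝ) : ℂ)]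

/-- A multiple of the spin state in direction `a`. -/
def spinor (a : E3) : Fin 2 → ℂ := ![((‖a‖ + a 2 : ℝ) : ℂ), a 0 + a 1 * Complex.I]

lemma norm_sq_eq (a : E3) : ‖a‖ ^ 2 = a 0 ^ 2 + a 1 ^ 2 + a 2 ^ 2 := by
  rw [EuclideanSpace.norm_sq_eq, Fin.sum_univ_three]
  simp

lemma norm_add_nonneg (a : E3) : 0 ≤ ‖a‖ + a 2 := by
  have h := norm_sq_eq a
  have h1 : |a 2| ≤ ‖a‖ := abs_le_of_sq_le_sq (by nlinarith [sq_nonneg (a 0), sq_nonneg (a 1)])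
    (norm_nonneg a)
  linarith [neg_abs_le (a 2)]

lemma smul_spin (a : E3) :
    ((‖a‖ + a 2 : ℝ) : ℂ) • spin a = vecMulVec (spinor a) (star (spinor a)) := by
  have h : (‖a‖ : ℂ) ^ 2 = a 0 ^ 2 + a 1 ^ 2 + a 2 ^ 2 := by exact_mod_cast norm_sq_eq a
  ext i j
  fin_cases i <;> fin_cases j <;>
    simp only [spin, spinor, vecMulVec_apply, Matrix.smul_apply, Pi.star_apply, Fin.zero_eta,
      Fin.mk_one, Matrix.of_apply, Matrix.cons_val_zero, Matrix.cons_val_one, Matrix.cons_val',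
      Matrix.cons_val_fin_one, smul_eq_mul, star_add, star_mul', Complex.star_def,
      Complex.conj_ofReal, Complex.conj_I]
  · ring
  · ring
  · push_cast; linear_combination h + (a 1 : ℂ) ^ 2 * Complex.I_sq

/-- The matrix is positive semidefinite of rank at most one. Rescaling `spinor a` gives the state
unless `a` points straight down or is zero; there `spinor a` vanishes and the second basis vector is
used. This state does not depend continuously on `a`, which is why both versions are kept. -/
lemma exists_spinor (a : E3) : ∃ ψ : Fin 2 → ℂ, spin a = vecMulVec ψ (star ψ) := by
  rcases (norm_add_nonneg a).eq_or_lt with h | h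
  · have h1 := norm_sq_eq a
    have h2 : ‖a‖ ^ 2 = a 2 ^ 2 := by rw [show ‖a‖ = -a 2 by linarith]; ring
    have h3 : a 0 = 0 := by nlinarith [sq_nonneg (a 0), sq_nonneg (a 1)]
    have h4 : a 1 = 0 := by nlinarith [sq_nonneg (a 0), sq_nonneg (a 1)]
    obtain ⟨s, hs⟩ : ∃ s, s = √(2 * ‖a‖) := ⟨_, rfl⟩
    refine ⟨![0, (s : ℂ)], ?_⟩
    have h5 : (s : ℂ) * s = (‖a‖ : ℂ) - a 2 := by
      rw [hs, ← Complex.ofReal_mul, Real.mul_self_sqrt (by positivity),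
        show 2 * ‖a‖ = ‖a‖ - a 2 by linarith]
      push_cast; rfl
    have h6 : (‖a‖ : ℂ) + a 2 = 0 := by exact_mod_cast h.symm
    ext i j
    fin_cases i <;> fin_cases j <;> simp [spin, vecMulVec_apply, h3, h4, h5, h6]
  · refine ⟨((√(‖a‖ + a 2) : ℝ) : ℂ)⁻¹ • spinor a, ?_⟩
    have hs : ((√(‖a‖ + a 2) : ℝ) : ℂ) * ((√(‖a‖ + a 2) : ℝ) : ℂ) = ((‖a‖ + a 2 : ℝ) : ℂ) := by
      rw [← Complex.ofReal_mul, Real.mul_self_sqrt h.le]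
    have hne : ((‖a‖ + a 2 : ℝ) : ℂ) ≠ 0 := by exact_mod_cast h.ne'
    have h1 : star (((√(‖a‖ + a 2) : ℝ) : ℂ)⁻¹ • spinor a) =
        ((√(‖a‖ + a 2) : ℝ) : ℂ)⁻¹ • star (spinor a) := by
      rw [star_smul]
      congr 1
      simp
    rw [h1, vecMulVec_smul, smul_vecMulVec, smul_smul, ← mul_inv, hs, ← smul_spin, smul_smul,
      inv_mul_cancel₀ hne, one_smul]

lemma trace_spin_mul (a b : E3) :
    (spin a * spin b).trace = 2 * ((‖a‖ * ‖b‖ + inner ℝ a b : ℝ) : ℂ) := by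
  have h : inner ℝ a b = a 0 * b 0 + a 1 * b 1 + a 2 * b 2 := by
    rw [PiLp.inner_apply, Fin.sum_univ_three]
    simp [mul_comm]
  rw [h]
  simp [spin, Matrix.trace_fin_two]
  linear_combination (-2 * a 1 * b 1 : ℂ) * Complex.I_sq

/-- States of a point off a segment with respect to its endpoints are not orthogonal. -/
lemma dotProduct_ne_zero {x v v' : E3} (hx : x ∉ segment ℝ v v') {ψ φ : Fin 2 → ℂ}
    (hψ : spin (v - x) = vecMulVec ψ (star ψ)) (hφ : spin (v' - x) = vecMulVec φ (star φ)) :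
    star ψ ⬝ᵥ φ ≠ 0 := by
  intro h
  -- Orthogonal states give trace zero, hence `|a| |b| + a · b = 0`: equality in Cauchy–Schwarz with
  -- `a` and `b` in opposite directions, which puts `x` between the endpoints.
  have h1 : (spin (v - x) * spin (v' - x)).trace = 0 := by
    rw [hψ, hφ, vecMulVec_mul_vecMulVec, h]
    simp
  rw [trace_spin_mul, mul_eq_zero] at h1
  have h2 : ‖v - x‖ * ‖v' - x‖ + inner ℝ (v - x) (v' - x) = 0 := by
    exact_mod_cast h1.resolve_left two_ne_zero
  have h3 : inner ℝ (x - v) (v' - x) = ‖x - v‖ * ‖v' - x‖ := by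
    rw [← neg_sub v x, inner_neg_left, norm_neg]; linarith
  rw [inner_eq_norm_mul_iff_real] at h3
  exact hx (mem_segment_iff_sameRay.2 (sameRay_iff_norm_smul_eq.2 h3.symm))

/-- The product of the first `n` of a sequence of matrices. -/
def matProd (A : ℕ → Matrix (Fin 2) (Fin 2) ℂ) : ℕ → Matrix (Fin 2) (Fin 2) ℂ
  | 0 => 1
  | n + 1 => matProd A n * A n

lemma matProd_succ_left (A : ℕ → Matrix (Fin 2) (Fin 2) ℂ) (n : ℕ) :
    matProd A (n + 1) = A 0 * matProd (fun k => A (k + 1)) n := by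
  induction n with
  | zero => simp [matProd]
  | succ n ih => rw [matProd, ih, matProd, mul_assoc]

/-- Cyclic invariance of the trace; it lets any edge of the polygon be treated as the first one. -/
lemma trace_matProd_shift {A : ℕ → Matrix (Fin 2) (Fin 2) ℂ} {n : ℕ} (hA : ∀ k, A (k + n) = A k)
    (k : ℕ) : (matProd (fun j => A (j + k)) n).trace = (matProd A n).trace := by
  cases n with
  | zero => rfl
  | succ n =>
    induction k with
    | zero => rfl
    | succ k ih =>
      rw [← ih, matProd_succ_left (fun j => A (j + k)), Matrix.trace_mul_comm, matProd]
      simp only [zero_add, ← hA k, show ∀ j, j + (k + 1) = j + 1 + k by omega,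
        show n + 1 + k = k + (n + 1) by omega]

lemma matProd_vecMulVec (ψ : ℕ → Fin 2 → ℂ) (n : ℕ) :
    matProd (fun k => vecMulVec (ψ k) (star (ψ k))) (n + 1) =
      (∏ k ∈ Finset.range n, star (ψ k) ⬝ᵥ ψ (k + 1)) • vecMulVec (ψ 0) (star (ψ n)) := by
  induction n with
  | zero => simp [matProd]
  | succ n ih =>
    rw [matProd, ih, smul_mul_assoc, vecMulVec_mul_vecMulVec, Finset.prod_range_succ,
      vecMulVec_smul, smul_smul]

/-- The trace of the product of the spin projectors of a closed polygon off `x`. -/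
lemma trace_matProd_spin_ne_zero {v : ℕ → E3} {n : ℕ} (hn : 0 < n) (hv : v n = v 0) {x : E3}
    (hx : ∀ k < n, x ∉ segment ℝ (v k) (v (k + 1))) :
    (matProd (fun k => spin (v k - x)) n).trace ≠ 0 := by
  choose ψ hψ using fun k => exists_spinor (v k - x)
  obtain ⟨n, rfl⟩ : ∃ m, n = m + 1 := ⟨n - 1, by omega⟩
  simp only [hψ]
  rw [matProd_vecMulVec, trace_smul, trace_vecMulVec, smul_eq_mul]
  refine mul_ne_zero (Finset.prod_ne_zero_iff.2 fun k hk => ?_) ?_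
  · exact dotProduct_ne_zero (hx k (by simp at hk; omega)) (hψ k) (hψ _)
  · rw [dotProduct_comm]
    refine dotProduct_ne_zero (hx n (by omega)) (hψ n) ?_
    rw [hv]; exact hψ 0

/-- The overlap of two neighbouring states. -/
def overlap (a b : E3) : ℂ := star (spinor a) ⬝ᵥ spinor b

/-- The trace of the spin projectors in terms of the overlap of the first two states. -/
lemma smul_trace_matProd (A : ℕ → Matrix (Fin 2) (Fin 2) ℂ) (a b : E3) (n : ℕ)
    (ha : A 0 = spin a) (hb : A 1 = spin b) :
    ((‖a‖ + a 2 : ℝ) : ℂ) * ((‖b‖ + b 2 : ℝ) : ℂ) * (matProd A (n + 2)).trace =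
      overlap a b * (star (spinor b) ⬝ᵥ (matProd (fun k => A (k + 2)) n *ᵥ spinor a)) := by
  have h1 : (((‖a‖ + a 2 : ℝ) : ℂ) * ((‖b‖ + b 2 : ℝ) : ℂ)) • matProd A (n + 2) =
      overlap a b • (vecMulVec (spinor a) (star (spinor b)) * matProd (fun k => A (k + 2)) n) := by
    rw [matProd_succ_left, matProd_succ_left, ha, hb, ← mul_assoc, ← smul_mul_assoc,
      ← smul_mul_smul_comm, smul_spin, smul_spin, vecMulVec_mul_vecMulVec, vecMulVec_smul,
      smul_mul_assoc]
    rfl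
  rw [← smul_eq_mul, ← trace_smul, h1, trace_smul, smul_eq_mul, vecMulVec_mul,
    trace_vecMulVec, dotProduct_comm (spinor a), ← dotProduct_mulVec]

/-- The remaining factor does not vanish on the edge of the first two states. -/
lemma remainder_ne_zero {v : ℕ → E3} {n : ℕ} (hv : v (n + 2) = v 0) {x : E3}
    (hx : ∀ k < n + 2, 0 < k → x ∉ segment ℝ (v k) (v (k + 1)))
    (h₀ : ‖v 0 - x‖ + (v 0 - x) 2 ≠ 0) (h₁ : ‖v 1 - x‖ + (v 1 - x) 2 ≠ 0) :
    star (spinor (v 1 - x)) ⬝ᵥ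
      (matProd (fun k => spin (v (k + 2) - x)) n *ᵥ spinor (v 0 - x)) ≠ 0 := by
  intro h
  choose ψ hψ using fun k => exists_spinor (v (k + 1) - x)
  have hne (k : ℕ) (hk : k < n + 1) : star (ψ k) ⬝ᵥ ψ (k + 1) ≠ 0 :=
    dotProduct_ne_zero (hx (k + 1) (by omega) (by omega)) (hψ k) (hψ _)
  -- The open chain from `v 1` around to `v (n + 2) = v 0` uses every edge except the first. All its
  -- overlaps are nonzero, so its product is nonzero; but up to scalars this product is the
  -- remainder times a rank one matrix.
  have h1 : matProd (fun k => spin (v (k + 1) - x)) (n + 2) ≠ 0 := by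
    simp only [hψ]
    rw [matProd_vecMulVec]
    refine smul_ne_zero (Finset.prod_ne_zero_iff.2 fun k hk => hne k (by simpa using hk)) ?_
    refine vecMulVec_ne_zero (fun h0 => ?_) (fun h0 => ?_)
    · have := hne 0 (by omega)
      rw [h0] at this
      simp at this
    · have := hne n (by omega)
      rw [star_eq_zero] at h0
      rw [h0] at this
      simp at this
  refine h1 ?_
  have h2 : (((‖v 1 - x‖ + (v 1 - x) 2 : ℝ) : ℂ) * ((‖v 0 - x‖ + (v 0 - x) 2 : ℝ) : ℂ)) •
      matProd (fun k => spin (v (k + 1) - x)) (n + 2) = 0 := by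
    rw [matProd, matProd_succ_left, hv, zero_add, ← smul_mul_smul_comm, ← smul_mul_assoc, smul_spin,
      smul_spin, vecMulVec_mul, vecMulVec_mul_vecMulVec, ← dotProduct_mulVec]
    erw [h]
    simp
  refine (smul_eq_zero.1 h2).resolve_left (mul_ne_zero ?_ ?_)
  · exact_mod_cast h₁
  · exact_mod_cast h₀

end MarkedLink

end

noncomputable section

namespace MarkedLink

open unitInterval Filter Topology

/-! ### Winding numbers of nonvanishing functions -/

section Winding

variable {Y : Type*} [TopologicalSpace Y] {f : Y → ℂ}

/-- A continuous logarithm of `f` along the path `γ`. -/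
def IsLogLift (f : Y → ℂ) {y z : Y} (γ : Path y z) (Γ : I → ℂ) : Prop :=
  Continuous Γ ∧ ∀ t, Complex.exp (Γ t) = f (γ t)

/-- The nonvanishing function `f` as a map to the punctured plane. -/
def toPunctured (hf : Continuous f) (h0 : ∀ y, f y ≠ 0) : C(Y, {z : ℂ // z ≠ 0}) :=
  ⟨fun y => ⟨f y, h0 y⟩, by fun_prop⟩

/-- Lifting along the covering `exp` of the punctured plane; the endpoint of a lift depends only on
the homotopy class of the path. -/
lemma exists_logLift_homotopic (hf : Continuous f) (h0 : ∀ y, f y ≠ 0) {y z : Y} {γ δ : Path y z}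
    (h : γ.Homotopic δ) : ∃ Γ Δ : I → ℂ, IsLogLift f γ Γ ∧ IsLogLift f δ Δ ∧ Γ 1 - Γ 0 = Δ 1 - Δ 0 := by
  have e (y : Y) : Complex.exp (Complex.log (f y)) = f y := Complex.exp_log (h0 y)
  have key (γ : Path y z) : ((γ.map (toPunctured hf h0).continuous : C(I, {z : ℂ // z ≠ 0})) 0) =
      (⟨_, (Complex.log (f y)).exp_ne_zero⟩ : {z : ℂ // z ≠ 0}) := by
    refine Subtype.ext ?_
    simp [toPunctured, e]
  have lifts (γ : Path y z) := Complex.isCoveringMap_exp.liftPath_lifts _ _ (key γ)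
  refine ⟨Complex.isCoveringMap_exp.liftPath _ _ (key γ),
    Complex.isCoveringMap_exp.liftPath _ _ (key δ), ⟨ContinuousMap.continuous _, fun t => ?_⟩,
    ⟨ContinuousMap.continuous _, fun t => ?_⟩, ?_⟩
  · exact congrArg Subtype.val (congrFun (lifts γ) t)
  · exact congrArg Subtype.val (congrFun (lifts δ) t)
  · rw [Complex.isCoveringMap_exp.liftPath_zero, Complex.isCoveringMap_exp.liftPath_zero]
    congr 1
    exact Complex.isCoveringMap_exp.liftPath_apply_one_eq_of_homotopicRel
      (h.map (toPunctured hf h0)) _ (key γ) (key δ)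

lemma exists_logLift (hf : Continuous f) (h0 : ∀ y, f y ≠ 0) {y z : Y} (γ : Path y z) :
    ∃ Γ : I → ℂ, IsLogLift f γ Γ := by
  obtain ⟨Γ, -, h, -⟩ := exists_logLift_homotopic hf h0 (Path.Homotopic.refl γ)
  exact ⟨Γ, h⟩

/-- Two logarithms along the same path differ by a constant, by uniqueness of lifts, so the
variation is well defined. -/
lemma IsLogLift.sub_eq {y z : Y} {γ : Path y z} {Γ Δ : I → ℂ} (hΓ : IsLogLift f γ Γ)
    (hΔ : IsLogLift f γ Δ) : Γ 1 - Γ 0 = Δ 1 - Δ 0 := by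
  have h : Γ = fun t => Δ t + (Γ 0 - Δ 0) := by
    refine Complex.isCoveringMap_exp.eq_of_comp_eq hΓ.1 (hΔ.1.add continuous_const) ?_ 0 (by simp)
    funext t
    refine Subtype.ext ?_
    change Complex.exp (Γ t) = Complex.exp (Δ t + (Γ 0 - Δ 0))
    rw [Complex.exp_add, Complex.exp_sub, hΓ.2, hΔ.2, hΓ.2, hΔ.2, div_self, mul_one]
    rw [← hΔ.2]
    exact Complex.exp_ne_zero _
  have := congrFun h 1
  linear_combination this

/-- The variation of the logarithm of a nonvanishing function along paths. -/
def windingHolonomy (hf : Continuous f) (h0 : ∀ y, f y ≠ 0) : Holonomy Y (Multiplicative ℂ) where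
  toFun γ := .ofAdd ((exists_logLift hf h0 γ).choose 1 - (exists_logLift hf h0 γ).choose 0)
  map_trans {x y z} γ δ := by
    rw [← ofAdd_add]
    congr 1
    obtain hΓ := (exists_logLift hf h0 γ).choose_spec
    obtain hΔ := (exists_logLift hf h0 δ).choose_spec
    set Γ := (exists_logLift hf h0 γ).choose
    set Δ := (exists_logLift hf h0 δ).choose
    let P : Path (Γ 0) (Γ 1) := ⟨⟨Γ, hΓ.1⟩, rfl, rfl⟩
    let Q : Path (Γ 1) (Δ 1 + (Γ 1 - Δ 0)) :=
      ⟨⟨fun t => Δ t + (Γ 1 - Δ 0), hΔ.1.add continuous_const⟩, by simp, rfl⟩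
    have hQ (t : I) : Complex.exp (Q t) = f (δ t) := by
      change Complex.exp (Δ t + (Γ 1 - Δ 0)) = _
      rw [Complex.exp_add, Complex.exp_sub, hΔ.2, hΔ.2, hΓ.2, γ.target, δ.source, div_self (h0 y),
        mul_one]
    have h : IsLogLift f (γ.trans δ) (P.trans Q) := by
      refine ⟨(P.trans Q).continuous, fun t => ?_⟩
      rw [Path.trans_apply, Path.trans_apply]
      split_ifs
      · exact hΓ.2 _
      · exact hQ _
    rw [(exists_logLift hf h0 (γ.trans δ)).choose_spec.sub_eq h, (P.trans Q).target,
      (P.trans Q).source]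
    ring
  map_homotopic {y z γ δ} h := by
    congr 1
    obtain ⟨Γ, Δ, hΓ, hΔ, e⟩ := exists_logLift_homotopic hf h0 h
    rw [(exists_logLift hf h0 γ).choose_spec.sub_eq hΓ, e,
      (exists_logLift hf h0 δ).choose_spec.sub_eq hΔ]

lemma windingHolonomy_eq (hf : Continuous f) (h0 : ∀ y, f y ≠ 0) {y z : Y} {γ : Path y z}
    {Γ : I → ℂ} (h : IsLogLift f γ Γ) :
    (windingHolonomy hf h0).toFun γ = .ofAdd (Γ 1 - Γ 0) :=
  congrArg Multiplicative.ofAdd ((exists_logLift hf h0 γ).choose_spec.sub_eq h)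

lemma exists_winding (hf : Continuous f) (h0 : ∀ y, f y ≠ 0) {y : Y} (γ : Path y y) :
    ∃ n : ℤ, (windingHolonomy hf h0).toFun γ = .ofAdd (n * (2 * Real.pi * Complex.I)) := by
  obtain ⟨Γ, hΓ⟩ := exists_logLift hf h0 γ
  rw [windingHolonomy_eq hf h0 hΓ]
  have : Complex.exp (Γ 1 - Γ 0) = 1 := by
    rw [Complex.exp_sub, hΓ.2, hΓ.2, γ.target, γ.source, div_self (h0 y)]
  obtain ⟨n, hn⟩ := Complex.exp_eq_one_iff.1 this
  exact ⟨n, by rw [hn]⟩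

/-- The winding number of `f` along a loop. -/
def winding (hf : Continuous f) (h0 : ∀ y, f y ≠ 0) {y : Y} (γ : Path y y) : ℤ :=
  (exists_winding hf h0 γ).choose

lemma winding_eq_iff (hf : Continuous f) (h0 : ∀ y, f y ≠ 0) {y : Y} {γ : Path y y} {n : ℤ} :
    winding hf h0 γ = n ↔
      (windingHolonomy hf h0).toFun γ = .ofAdd (n * (2 * Real.pi * Complex.I)) := by
  rw [(exists_winding hf h0 γ).choose_spec]
  refine ⟨fun h => by rw [← h]; rfl, fun h => ?_⟩
  exact Int.cast_injective
    (mul_right_cancel₀ Complex.two_pi_I_ne_zero (Multiplicative.ofAdd.injective h))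

lemma winding_trans (hf : Continuous f) (h0 : ∀ y, f y ≠ 0) {y : Y} (γ δ : Path y y) :
    winding hf h0 (γ.trans δ) = winding hf h0 γ + winding hf h0 δ := by
  rw [winding_eq_iff, Holonomy.map_trans, (winding_eq_iff hf h0).1 rfl,
    (winding_eq_iff hf h0 (γ := δ)).1 rfl, ← ofAdd_add]
  push_cast
  rw [add_mul]

lemma winding_homotopic (hf : Continuous f) (h0 : ∀ y, f y ≠ 0) {y : Y} {γ δ : Path y y}
    (h : γ.Homotopic δ) : winding hf h0 γ = winding hf h0 δ := by
  rw [winding_eq_iff, Holonomy.map_homotopic _ h, ← winding_eq_iff]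

/-- The target is commutative, so the contributions of `δ` and of its reverse cancel. -/
lemma winding_conj (hf : Continuous f) (h0 : ∀ y, f y ≠ 0) {x y : Y} (δ : Path x y) (c : Path y y) :
    winding hf h0 ((δ.trans c).trans δ.symm) = winding hf h0 c := by
  rw [winding_eq_iff, Holonomy.map_trans, Holonomy.map_trans, mul_right_comm,
    ← Holonomy.map_trans, Holonomy.map_homotopic _
      ⟨(Path.Homotopy.reflTransSymm δ).symm⟩, Holonomy.map_refl, one_mul, ← winding_eq_iff]

/-- The winding number as a homomorphism to the powers of `b`. -/
def windingHom (hf : Continuous f) (h0 : ∀ y, f y ≠ 0) {H : Type*} [Group H] (b : H) (x₀ : Y) :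
    FundamentalGroup Y x₀ →* H where
  toFun g := b ^ Quotient.lift (s := Path.Homotopic.setoid x₀ x₀) (winding hf h0)
    (fun _ _ => winding_homotopic hf h0) (FundamentalGroup.toPath g)
  map_one' := by
    change b ^ winding hf h0 (Path.refl x₀) = 1
    rw [(winding_eq_iff hf h0 (n := 0)).2, zpow_zero]
    rw [Holonomy.map_refl]; simp
  map_mul' p q := by
    induction p using Quotient.inductionOn with | _ p
    induction q using Quotient.inductionOn with | _ q
    change b ^ winding hf h0 (q.trans p) = b ^ winding hf h0 p * b ^ winding hf h0 q
    rw [winding_trans, add_comm, zpow_add]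

lemma windingHom_fromPath (hf : Continuous f) (h0 : ∀ y, f y ≠ 0) {H : Type*} [Group H] (b : H)
    {x₀ : Y} (γ : Path x₀ x₀) : windingHom hf h0 b x₀
      (FundamentalGroup.fromPath (Path.Homotopic.Quotient.mk γ)) = b ^ winding hf h0 γ := rfl

end Winding

/-- The element `J` of `BD`. -/
def unitJ : BD := ⟨⟨quatJ, quatJ * expI Real.pi, by
    rw [← mul_assoc, quatJ_mul_self, expI_mul, ← two_mul, expI_two_pi], by
    rw [mul_assoc, expI_mul_J, ← mul_assoc, quatJ_mul_self, expI_mul, add_neg_cancel, expI_zero]⟩,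
  Or.inr ⟨0, by simp [expI_zero]⟩⟩

/-- Since `J² = -1`, an odd power of `J` is `J` or `-J = J⁻¹`. -/
lemma unitJ_zpow_mem {n : ℤ} (hn : Odd n) : ((unitJ ^ n : BD) : (Quaternion ℝ)ˣ) ∈ circleB := by
  obtain ⟨k, rfl⟩ := hn
  have hJ : (unitJ : (Quaternion ℝ)ˣ) ∈ circleB := ⟨0, by rw [expI_zero, mul_one]; rfl⟩
  have h2 : (unitJ : (Quaternion ℝ)ˣ) ^ (2 : ℤ) = -1 := by
    rw [zpow_two, mul_self_of_mem_circleB hJ]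
  rw [SubgroupClass.coe_zpow, zpow_add, zpow_mul, h2, zpow_one]
  rcases Int.even_or_odd k with hk | hk
  · rwa [hk.neg_one_zpow, one_mul]
  · rw [hk.neg_one_zpow, neg_one_mul, ← inv_eq_neg_of_mem_circleB hJ]
    exact inv_mem_circleB hJ

end MarkedLink

end

noncomputable section

namespace MarkedLink

open Matrix Filter Topology

/-! ### The spin trace of a polygon -/

lemma continuous_spin : Continuous spin := by
  refine continuous_matrix fun i j => ?_
  fin_cases i <;> fin_cases j <;> simp [spin] <;> fun_prop

lemma continuous_spinor : Continuous spinor := by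
  refine continuous_pi fun i => ?_
  fin_cases i <;> simp [spinor] <;> fun_prop

lemma spin_smul {r : ℝ} (hr : 0 ≤ r) (a : E3) : spin (r • a) = (r : ℂ) • spin a := by
  ext i j
  fin_cases i <;> fin_cases j <;> simp [spin, norm_smul, abs_of_nonneg hr] <;> ring

lemma continuous_matProd {Z : Type*} [TopologicalSpace Z] {A : Z → ℕ → Matrix (Fin 2) (Fin 2) ℂ}
    (hA : ∀ k, Continuous fun z => A z k) (n : ℕ) : Continuous fun z => matProd (A z) n := by
  induction n with
  | zero => exact continuous_const
  | succ n ih => exact ih.matrix_mul (hA n)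

lemma matProd_smul (r : ℂ) (A : ℕ → Matrix (Fin 2) (Fin 2) ℂ) (n : ℕ) :
    matProd (fun k => r • A k) n = r ^ n • matProd A n := by
  induction n with
  | zero => simp [matProd]
  | succ n ih => rw [matProd, ih, matProd, smul_mul_smul_comm, pow_succ]

/-- The trace of the product of the spin matrices of the directions from `x` to the vertices of a
polygon, normalized to have a limit at infinity. -/
def polyTrace (v : ℕ → E3) (n : ℕ) (x : E3) : ℂ :=
  (((max 1 ‖x‖)⁻¹ : ℝ) : ℂ) ^ n * (matProd (fun k => spin (v k - x)) n).trace

lemma polyTrace_ne_zero {v : ℕ → E3} {n : ℕ} {x : E3}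
    (h : (matProd (fun k => spin (v k - x)) n).trace ≠ 0) : polyTrace v n x ≠ 0 := by
  refine mul_ne_zero (pow_ne_zero _ ?_) h
  have : (0 : ℝ) < max 1 ‖x‖ := lt_max_of_lt_left one_pos
  exact_mod_cast (inv_pos.2 this).ne'

lemma continuous_normalization : Continuous fun x : E3 => (((max 1 ‖x‖)⁻¹ : ℝ) : ℂ) :=
  Complex.continuous_ofReal.comp
    ((continuous_const.max continuous_norm).inv₀ fun _ => (lt_max_of_lt_left one_pos).ne')

lemma continuous_polyTrace (v : ℕ → E3) (n : ℕ) : Continuous (polyTrace v n) := by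
  refine (continuous_normalization.pow n).mul (Continuous.matrix_trace (continuous_matProd ?_ n))
  exact fun k => continuous_spin.comp (by fun_prop)

/-- For a unit vector the matrix is twice a projector of rank one, so its `n`-th power has trace `2
^ n`. The exponent `max n 1` covers the empty product, the identity, whose trace is `2`. -/
lemma trace_matProd_spin_const {u : E3} (hu : ‖u‖ = 1) (n : ℕ) :
    (matProd (fun _ => spin u) n).trace = 2 ^ max n 1 := by
  obtain ⟨ψ, hψ⟩ := exists_spinor u
  have h1 : (spin u).trace = 2 := by
    simp [spin, Matrix.trace_fin_two, hu]; norm_num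
  cases n with
  | zero => simp [matProd]
  | succ n =>
    rw [hψ, trace_vecMulVec] at h1
    rw [hψ, matProd_vecMulVec (fun _ => ψ), Finset.prod_const, trace_smul, trace_vecMulVec, h1,
      dotProduct_comm, h1, Finset.card_range, max_eq_left (by omega), pow_succ, smul_eq_mul]

/-- By homogeneity the value at a large `x` is the trace for the directions `ε v_k - u` with `ε = 1
/ ‖x‖` and `u = x / ‖x‖`. At `ε = 0` all directions are `-u`, the trace does not depend on `u`, and
compactness of the sphere makes the limit uniform. -/
lemma tendsto_polyTrace (v : ℕ → E3) (n : ℕ) :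
    Tendsto (polyTrace v n) (cocompact E3) (𝓝 (2 ^ max n 1)) := by
  let F : ℝ × E3 → ℂ := fun q => (matProd (fun k => spin (q.1 • v k - q.2)) n).trace
  have hF : Continuous F := Continuous.matrix_trace
    (continuous_matProd (fun k => continuous_spin.comp (by fun_prop)) n)
  intro U hU
  obtain ⟨U', hU', hU'o, hmem⟩ := mem_nhds_iff.1 hU
  have hsub : ({0} : Set ℝ) ×ˢ Metric.sphere (0 : E3) 1 ⊆ F ⁻¹' U' := by
    rintro ⟨ε, u⟩ ⟨hε, hu⟩
    obtain rfl : ε = 0 := hε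
    have h1 : ‖-u‖ = 1 := by simpa using hu
    simpa [F, trace_matProd_spin_const h1] using hmem
  obtain ⟨V, T, hV, -, h0, hT, hVT⟩ := generalized_tube_lemma isCompact_singleton
    (isCompact_sphere _ _) (hU'o.preimage hF) hsub
  have h1 : Tendsto (fun x : E3 => ‖x‖⁻¹) (cocompact E3) (𝓝 0) :=
    tendsto_inv_atTop_zero.comp tendsto_norm_cocompact_atTop
  have h2 := h1.eventually (hV.mem_nhds (h0 rfl))
  have h3 := (tendsto_norm_cocompact_atTop (E := E3)).eventually_ge_atTop 1
  rw [Filter.mem_map]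
  filter_upwards [h2, h3] with x hx hx1
  have hpos : 0 < ‖x‖ := by linarith
  have hmem' : (‖x‖⁻¹, ‖x‖⁻¹ • x) ∈ F ⁻¹' U' :=
    hVT ⟨hx, hT (by simp [norm_smul, hpos.ne'])⟩
  have e : F (‖x‖⁻¹, ‖x‖⁻¹ • x) = polyTrace v n x := by
    simp only [F, polyTrace, ← smul_sub, spin_smul (inv_nonneg.2 hpos.le), matProd_smul,
      max_eq_right hx1, trace_smul, smul_eq_mul]
  rw [Set.mem_preimage, ← e]
  exact hU' hmem'

namespace PolygonalLink

variable {m : ℕ} (L : PolygonalLink m)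

/-- The product of the spin traces of the components. -/
def spinTrace (x : E3) : ℂ := ∏ i, polyTrace (fun k => L.vertex i (k : ZMod (L.len i))) (L.len i) x

/-- The spin trace on the three-sphere. -/
def spinTraceS3 : C(S3, ℂ) :=
  OnePoint.continuousMapMk ⟨L.spinTrace, continuous_finsetProd _ fun _ _ =>
    continuous_polyTrace _ _⟩ (∏ i, 2 ^ max (L.len i) 1) (by
      rw [coclosedCompact_eq_cocompact]
      exact tendsto_finsetProd _ fun i _ => tendsto_polyTrace _ _)

lemma spinTraceS3_coe (x : E3) : L.spinTraceS3 (x : S3) = L.spinTrace x := rfl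

lemma spinTraceS3_ne_zero {z : S3} (hz : z ∉ ((↑) : E3 → S3) '' L.carrier) :
    L.spinTraceS3 z ≠ 0 := by
  induction z using OnePoint.rec with
  | infty =>
    change ∏ i, (2 : ℂ) ^ max (L.len i) 1 ≠ 0
    exact Finset.prod_ne_zero_iff.2 fun i _ => pow_ne_zero _ two_ne_zero
  | coe x =>
    have hx : x ∉ L.carrier := fun h => hz ⟨x, h, rfl⟩
    rw [spinTraceS3_coe]
    refine Finset.prod_ne_zero_iff.2 fun i _ => polyTrace_ne_zero ?_
    refine trace_matProd_spin_ne_zero (Nat.pos_of_neZero _) (by simp) fun k _ h => hx ?_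
    rw [carrier, Set.mem_iUnion]
    exact ⟨i, mem_support.2 ⟨_, L.edge_mem i k, by simpa using h⟩⟩

end PolygonalLink

end MarkedLink

end

noncomputable section

namespace MarkedLink

open Matrix Filter Topology

/-! ### The winding of the spin trace around an edge -/

lemma overlap_eq (a b : E3) : overlap a b =
    ⟨(‖a‖ + a 2) * (‖b‖ + b 2) + (a 0 * b 0 + a 1 * b 1), a 0 * b 1 - a 1 * b 0⟩ := by
  apply Complex.ext
  · simp [overlap, spinor, dotProduct, Fin.sum_univ_two]
  · simp [overlap, spinor, dotProduct, Fin.sum_univ_two]; ring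

lemma pos_of_mul_sub_eq {U p s : ℝ} (hU : 0 ≤ U) (hs : 0 < s) (h : U * (U - 2 * p) = s ^ 2) :
    0 < U := by
  refine lt_of_le_of_ne hU fun h0 => ?_
  rw [← h0, zero_mul] at h
  exact (pow_pos hs 2).ne h

lemma sq_add_sq_pos {d : E3} (hd : csh d ≠ 0) : 0 < d 0 ^ 2 + d 1 ^ 2 := by
  refine lt_of_le_of_ne (by positivity) fun h0 => hd ?_
  apply Complex.ext
  · simp only [csh, Complex.zero_re]; nlinarith [sq_nonneg (d 0), sq_nonneg (d 1)]
  · simp only [csh, Complex.zero_im]; nlinarith [sq_nonneg (d 0), sq_nonneg (d 1)]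

lemma norm_add_mul_sub (a : E3) :
    (‖a‖ + a 2) * ((‖a‖ + a 2) - 2 * a 2) = a 0 ^ 2 + a 1 ^ 2 := by
  linear_combination norm_sq_eq a

/-- Two neighbouring states whose overlap is real. -/
lemma overlap_sign {a b : E3} {n₀ n₁ A B : ℝ} (h₀ : b 0 - a 0 = n₀) (h₁ : b 1 - a 1 = n₁)
    (hA : n₀ * a 0 + n₁ * a 1 = -A) (hB : n₀ * b 0 + n₁ * b 1 = B) (hA0 : 0 < A) (hB0 : 0 < B)
    (him : a 0 * b 1 - a 1 * b 0 = 0) (hne : B * a 2 + A * b 2 ≠ 0) :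
    0 < ((‖a‖ + a 2) * (‖b‖ + b 2) + (a 0 * b 0 + a 1 * b 1)) * (B * a 2 + A * b 2) := by
  have hN : n₀ ^ 2 + n₁ ^ 2 = A + B := by rw [← hB, ← neg_neg A, ← hA, ← h₀, ← h₁]; ring
  have hN0 : 0 < A + B := by positivity
  have ha0 : a 0 * (A + B) = -A * n₀ := by
    rw [← hN, ← hA, ← h₀, ← h₁]; linear_combination (b 1 - a 1) * him
  have ha1 : a 1 * (A + B) = -A * n₁ := by
    rw [← hN, ← hA, ← h₀, ← h₁]; linear_combination -(b 0 - a 0) * him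
  have hb0 : b 0 * (A + B) = B * n₀ := by linear_combination (A + B) * h₀ + ha0
  have hb1 : b 1 * (A + B) = B * n₁ := by linear_combination (A + B) * h₁ + ha1
  obtain ⟨ν, hν, hνN⟩ : ∃ ν : ℝ, 0 < ν ∧ ν ^ 2 = A + B :=
    ⟨√(A + B), Real.sqrt_pos.2 hN0, Real.sq_sqrt hN0.le⟩
  -- The hypotheses make the horizontal parts of `a` and `b` antiparallel; `s` and `t` are their
  -- lengths, so the overlap is `U V - s t` with `U = ‖a‖ + a 2` and `V = ‖b‖ + b 2`.
  obtain ⟨s, hs⟩ : ∃ s, s = A / ν := ⟨_, rfl⟩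
  obtain ⟨t, ht⟩ : ∃ t, t = B / ν := ⟨_, rfl⟩
  have hs0 : 0 < s := hs ▸ div_pos hA0 hν
  have ht0 : 0 < t := ht ▸ div_pos hB0 hν
  have hsA : s * ν = A := by rw [hs]; field_simp
  have htB : t * ν = B := by rw [ht]; field_simp
  have e1 : a 0 ^ 2 + a 1 ^ 2 = s ^ 2 := by
    refine mul_right_cancel₀ (pow_pos hN0 2).ne' ?_
    have : s ^ 2 * (A + B) ^ 2 = A ^ 2 * (A + B) := by rw [← hνN, ← hsA]; ring
    rw [this, ← hN]
    rw [← hN] at ha0 ha1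
    linear_combination (a 0 * (n₀ ^ 2 + n₁ ^ 2) - A * n₀) * ha0 +
      (a 1 * (n₀ ^ 2 + n₁ ^ 2) - A * n₁) * ha1
  have e2 : b 0 ^ 2 + b 1 ^ 2 = t ^ 2 := by
    refine mul_right_cancel₀ (pow_pos hN0 2).ne' ?_
    have : t ^ 2 * (A + B) ^ 2 = B ^ 2 * (A + B) := by rw [← hνN, ← htB]; ring
    rw [this, ← hN]
    rw [← hN] at hb0 hb1
    linear_combination (b 0 * (n₀ ^ 2 + n₁ ^ 2) + B * n₀) * hb0 +
      (b 1 * (n₀ ^ 2 + n₁ ^ 2) + B * n₁) * hb1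
  have e3 : a 0 * b 0 + a 1 * b 1 = -(s * t) := by
    refine mul_right_cancel₀ (pow_pos hN0 2).ne' ?_
    have : -(s * t) * (A + B) ^ 2 = -(A * B) * (A + B) := by rw [← hνN, ← hsA, ← htB]; ring
    rw [this, ← hN]
    rw [← hN] at ha0 ha1 hb0 hb1
    linear_combination (b 0 * (n₀ ^ 2 + n₁ ^ 2)) * ha0 + (b 1 * (n₀ ^ 2 + n₁ ^ 2)) * ha1 -
      A * n₀ * hb0 - A * n₁ * hb1
  have hU := norm_add_mul_sub a
  have hV := norm_add_mul_sub b
  have hU0 := norm_add_nonneg a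
  have hV0 := norm_add_nonneg b
  rw [e1] at hU
  rw [e2] at hV
  rw [e3]
  generalize ‖a‖ + a 2 = U at *
  generalize ‖b‖ + b 2 = V at *
  have hU1 := pos_of_mul_sub_eq hU0 hs0 hU
  have hV1 := pos_of_mul_sub_eq hV0 ht0 hV
  -- From `U² - s² = 2 U a₂` and `V² - t² = 2 V b₂`. All other factors are positive, so the overlap
  -- has the sign of `B a₂ + A b₂`.
  have key : (t * U + s * V) * (U * V + -(s * t)) * ν = 2 * U * V * (B * a 2 + A * b 2) := by
    rw [← hsA, ← htB]
    linear_combination t * V * ν * hU + s * U * ν * hV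
  have h3 : 0 < (t * U + s * V) * ν := by positivity
  have h4 : (t * U + s * V) * ν * ((U * V + -(s * t)) * (B * a 2 + A * b 2)) =
      2 * U * V * (B * a 2 + A * b 2) ^ 2 := by linear_combination (B * a 2 + A * b 2) * key
  have h5 : 0 < 2 * U * V * (B * a 2 + A * b 2) ^ 2 := by positivity
  rw [← h4] at h5
  exact pos_of_mul_pos_right h5 h3.le

/-- The linear part of the overlap of the states of a point near the segment from `v` to
`v + d`, as a function of the position relative to the segment. -/
def overlapLin (d y : E3) : ℂ :=
  ⟨d 2 * (d 0 * y 0 + d 1 * y 1) - (d 0 ^ 2 + d 1 ^ 2) * y 2, d 0 * y 1 - d 1 * y 0⟩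

lemma overlapLin_add (d x y : E3) : overlapLin d (x + y) = overlapLin d x + overlapLin d y := by
  apply Complex.ext <;> simp [overlapLin] <;> ring

lemma overlapLin_smul (d : E3) (r : ℝ) (y : E3) :
    overlapLin d (r • y) = (r : ℂ) * overlapLin d y := by
  apply Complex.ext <;> simp [overlapLin] <;> ring

lemma continuous_overlapLin (d : E3) : Continuous (overlapLin d) :=
  Complex.equivRealProdCLM.symm.continuous.comp (f := fun y : E3 =>
    ((d 2 * (d 0 * y 0 + d 1 * y 1) - (d 0 ^ 2 + d 1 ^ 2) * y 2, d 0 * y 1 - d 1 * y 0) : ℝ × ℝ))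
    (by fun_prop)

/-- The real linear map `overlapLin d` has exactly the line of the edge as its kernel. Its
restriction to a transverse plane is thus an isomorphism onto the complex numbers, and this is the
source of the winding `±1`. -/
lemma exists_of_overlapLin_eq_zero {d y : E3} (hd : csh d ≠ 0) (h : overlapLin d y = 0) :
    ∃ r : ℝ, y = r • d := by
  have hN := sq_add_sq_pos hd
  have h1 : d 2 * (d 0 * y 0 + d 1 * y 1) - (d 0 ^ 2 + d 1 ^ 2) * y 2 = 0 := congrArg Complex.re h
  have h2 : d 0 * y 1 - d 1 * y 0 = 0 := congrArg Complex.im h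
  refine ⟨(d 0 * y 0 + d 1 * y 1) / (d 0 ^ 2 + d 1 ^ 2), ?_⟩
  ext k
  rw [PiLp.smul_apply, smul_eq_mul, div_mul_eq_mul_div, eq_div_iff hN.ne']
  fin_cases k <;> simp only [Fin.zero_eta, Fin.mk_one, Fin.reduceFinMk]
  · linear_combination -d 1 * h2
  · linear_combination d 0 * h2
  · linear_combination -h1

lemma overlap_div_mem_slitPlane {d y : E3} {μ : ℝ}
    (hA : 0 < μ * (d 0 ^ 2 + d 1 ^ 2) + (d 0 * y 0 + d 1 * y 1))
    (hB : 0 < (1 - μ) * (d 0 ^ 2 + d 1 ^ 2) - (d 0 * y 0 + d 1 * y 1)) (hy : overlapLin d y ≠ 0) :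
    overlap (-(μ • d) - y) ((1 - μ) • d - y) / overlapLin d y ∈ Complex.slitPlane := by
  rw [Complex.mem_slitPlane_iff_not_le_zero]
  intro hle
  -- Outside the slit plane the overlap would be a nonpositive multiple of its linear part. Their
  -- imaginary parts are equal, so both vanish; then the real parts have the same strict sign by
  -- `overlap_sign`.
  obtain ⟨τ, hτ, he⟩ : ∃ τ : ℝ, 0 ≤ τ ∧
      overlap (-(μ • d) - y) ((1 - μ) • d - y) = -(τ : ℂ) * overlapLin d y := by
    rw [Complex.le_def] at hle
    refine ⟨-(overlap (-(μ • d) - y) ((1 - μ) • d - y) / overlapLin d y).re, by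
      simpa using hle.1, ?_⟩
    rw [← div_eq_iff hy]
    apply Complex.ext
    · simp
    · simpa using hle.2
  rw [overlap_eq] at he
  have hre := congrArg Complex.re he
  have him := congrArg Complex.im he
  simp only [overlapLin, Complex.mul_re, Complex.mul_im, Complex.neg_re, Complex.neg_im,
    Complex.ofReal_re, Complex.ofReal_im, neg_zero, zero_mul, sub_zero, add_zero] at hre him
  have h1 : d 0 * y 1 - d 1 * y 0 = 0 := by
    have : (1 + τ) * (d 0 * y 1 - d 1 * y 0) = 0 := by
      simp only [PiLp.sub_apply, PiLp.neg_apply, PiLp.smul_apply, smul_eq_mul] at him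
      linear_combination him
    exact (mul_eq_zero.1 this).resolve_left (by positivity)
  have e : ((1 - μ) * (d 0 ^ 2 + d 1 ^ 2) - (d 0 * y 0 + d 1 * y 1)) * (-(μ • d) - y) 2 +
      (μ * (d 0 ^ 2 + d 1 ^ 2) + (d 0 * y 0 + d 1 * y 1)) * ((1 - μ) • d - y) 2 =
      d 2 * (d 0 * y 0 + d 1 * y 1) - (d 0 ^ 2 + d 1 ^ 2) * y 2 := by
    simp only [PiLp.sub_apply, PiLp.neg_apply, PiLp.smul_apply, smul_eq_mul]
    ring
  have h2 : d 2 * (d 0 * y 0 + d 1 * y 1) - (d 0 ^ 2 + d 1 ^ 2) * y 2 ≠ 0 := fun h =>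
    hy (Complex.ext h h1)
  have key := overlap_sign (a := -(μ • d) - y) (b := (1 - μ) • d - y) (n₀ := d 0) (n₁ := d 1)
    (by simp; ring) (by simp; ring) (by simp; ring) (by simp; ring) hA hB
    (by simp; linear_combination h1) (by rwa [e])
  rw [e, hre] at key
  nlinarith [mul_nonneg hτ (sq_nonneg
    (d 2 * (d 0 * y 0 + d 1 * y 1) - (d 0 ^ 2 + d 1 ^ 2) * y 2))]

/-- An ellipse around the origin is a rotation up to a function with values in the slit plane. -/
lemma ellipse_div_mem_slitPlane {z : ℂ} {ε : ℝ} (hε : ε * ε = 1) (hz : 0 < ε * z.im) (θ : ℝ) :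
    (Real.cos θ + Real.sin θ * z) / Complex.exp (ε * θ * Complex.I) ∈ Complex.slitPlane := by
  have hcos : Real.cos (ε * θ) = Real.cos θ := by
    rcases mul_self_eq_one_iff.1 hε with rfl | rfl <;> simp
  have hsin : Real.sin (ε * θ) = ε * Real.sin θ := by
    rcases mul_self_eq_one_iff.1 hε with rfl | rfl <;> simp
  rw [Complex.mem_slitPlane_iff_not_le_zero]
  intro hle
  have hexp : Complex.exp (ε * θ * Complex.I) = ⟨Real.cos θ, ε * Real.sin θ⟩ := by
    rw [← hcos, ← hsin]
    apply Complex.ext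
    · rw [← Complex.ofReal_mul, Complex.exp_ofReal_mul_I_re]
    · rw [← Complex.ofReal_mul, Complex.exp_ofReal_mul_I_im]
  have hne := Complex.exp_ne_zero (ε * θ * Complex.I)
  obtain ⟨τ, hτ, he⟩ : ∃ τ : ℝ, 0 ≤ τ ∧ (Real.cos θ + Real.sin θ * z : ℂ) =
      -(τ : ℂ) * Complex.exp (ε * θ * Complex.I) := by
    rw [Complex.le_def] at hle
    refine ⟨-((Real.cos θ + Real.sin θ * z) / Complex.exp (ε * θ * Complex.I)).re, by
      simpa using hle.1, ?_⟩
    rw [← div_eq_iff hne]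
    apply Complex.ext
    · simp
    · simpa using hle.2
  rw [hexp] at he
  have hre := congrArg Complex.re he
  have him := congrArg Complex.im he
  simp only [Complex.add_re, Complex.add_im, Complex.mul_re, Complex.mul_im, Complex.neg_re,
    Complex.neg_im, Complex.ofReal_re, Complex.ofReal_im, neg_zero, zero_mul, sub_zero, add_zero,
    zero_add] at hre him
  -- For a nonpositive quotient the imaginary parts force `sin θ = 0`, and then the real parts force
  -- `cos θ = 0`.
  have h1 : Real.sin θ * (ε * z.im + τ) = 0 := by linear_combination ε * him - τ * Real.sin θ * hε
  have h2 : Real.sin θ = 0 := (mul_eq_zero.1 h1).resolve_right (by positivity)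
  rw [h2] at hre
  have h3 : Real.cos θ * (1 + τ) = 0 := by linear_combination hre
  have h4 : Real.cos θ = 0 := (mul_eq_zero.1 h3).resolve_right (by positivity)
  have := Real.sin_sq_add_cos_sq θ
  rw [h2, h4] at this
  norm_num at this

end MarkedLink

end

/-! ### The factor of the spin trace that vanishes on an edge. -/

noncomputable section

namespace MarkedLink

open Matrix Filter Topology unitInterval

lemma norm_add_ne_zero {a : E3} (h : csh a ≠ 0) : ‖a‖ + a 2 ≠ 0 := by
  intro h0
  have h1 := norm_add_mul_sub a
  rw [h0, zero_mul] at h1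
  exact (sq_add_sq_pos h).ne h1

/-- Near an inner point of one edge, only the overlap across that edge can vanish. The factors `C`
and `D` are written with the continuous `spinor`, so they are continuous everywhere; they are
nonzero at `p` because the edge is not vertical there and no other edge passes through `p`. -/
lemma polyTrace_factor {v : ℕ → E3} {N : ℕ} (hN : 2 ≤ N) (hv : ∀ k, v (k + N) = v k) (k : ℕ) {p : E3}
    (hp : ∀ l < N, 0 < l → p ∉ segment ℝ (v (l + k)) (v (l + 1 + k)))
    (h₀ : csh (v k - p) ≠ 0) (h₁ : csh (v (1 + k) - p) ≠ 0) :
    ∃ C D : E3 → ℂ, Continuous C ∧ Continuous D ∧ C p ≠ 0 ∧ D p ≠ 0 ∧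
      ∀ x, D x * polyTrace v N x = C x * overlap (v k - x) (v (1 + k) - x) := by
  obtain ⟨n, rfl⟩ : ∃ n, N = n + 2 := ⟨N - 2, by omega⟩
  refine ⟨fun x => (((max 1 ‖x‖)⁻¹ : ℝ) : ℂ) ^ (n + 2) * (star (spinor (v (1 + k) - x)) ⬝ᵥ
      (matProd (fun l => spin (v (l + 2 + k) - x)) n *ᵥ spinor (v k - x))),
    fun x => ((‖v k - x‖ + (v k - x) 2 : ℝ) : ℂ) * ((‖v (1 + k) - x‖ + (v (1 + k) - x) 2 : ℝ) : ℂ),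
    ?_, ?_, ?_, ?_, fun x => ?_⟩
  · refine (continuous_normalization.pow _).mul (Continuous.dotProduct ?_
      (Continuous.matrix_mulVec (continuous_matProd
        (fun l => continuous_spin.comp (by fun_prop)) n) (continuous_spinor.comp (by fun_prop))))
    exact (continuous_spinor.comp (by fun_prop)).star
  · fun_prop
  · refine mul_ne_zero (pow_ne_zero _ ?_) ?_
    · have : (0 : ℝ) < max 1 ‖p‖ := lt_max_of_lt_left one_pos
      exact_mod_cast (inv_pos.2 this).ne'
    · have h := remainder_ne_zero (v := fun l => v (l + k)) (n := n) (x := p) (by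
        rw [show n + 2 + k = k + (n + 2) by omega, hv, zero_add]) hp
      rw [zero_add] at h
      exact h (norm_add_ne_zero h₀) (norm_add_ne_zero h₁)
  · refine mul_ne_zero ?_ ?_
    · exact_mod_cast norm_add_ne_zero h₀
    · exact_mod_cast norm_add_ne_zero h₁
  · have h := smul_trace_matProd (fun l => spin (v (l + k) - x)) (v k - x) (v (1 + k) - x) n
      (by rw [zero_add]) rfl
    rw [trace_matProd_shift (A := fun l => spin (v l - x)) (fun l => by rw [hv])] at h
    rw [polyTrace, mul_left_comm, h]
    ring

namespace PolygonalLink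

variable {m : ℕ} {L : PolygonalLink m} {ω : PolygonalArc}

lemma two_le_len (i : Fin m) : 2 ≤ L.len i := by
  by_contra! h
  have h1 : L.len i = 1 := by have := NeZero.ne (L.len i); omega
  refine L.vertex_ne i 0 (congrArg _ ?_)
  have : Subsingleton (ZMod (L.len i)) := by rw [h1]; infer_instance
  exact Subsingleton.elim _ _

/-- The spin trace near an inner point of an edge. -/
lemma spinTrace_factor (hgp : GeneralPosition L ω) (i : Fin m) (k : ℕ) {μ : ℝ} (h0 : 0 < μ)
    (h1 : μ < 1) {d p : E3} (hd : d = L.vertex i (k + 1) - L.vertex i k)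
    (hp : p = L.vertex i k + μ • d) :
    ∃ C D : E3 → ℂ, Continuous C ∧ Continuous D ∧ C p ≠ 0 ∧ D p ≠ 0 ∧
      ∀ x, D x * L.spinTrace x =
        C x * overlap (-(μ • d) - (x - p)) ((1 - μ) • d - (x - p)) := by
  have hcurve : p = L.curve i ((k : ℤ) + μ) := by
    rw [L.curve_int_add i k h0.le h1.le, hp, hd]; push_cast; rfl
  have hcsh : csh d ≠ 0 := by
    have := hgp.csh_vertex_ne i k
    rw [hd, csh_sub, sub_ne_zero]
    push_cast at this
    exact this.symm
  obtain ⟨C, D, hC, hD, hC0, hD0, h⟩ := polyTrace_factor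
    (v := fun l : ℕ => L.vertex i (l : ZMod (L.len i))) (N := L.len i) (p := p)
    (two_le_len i) (fun l => by simp) k (fun l hl hl0 hpl => by
      have h2 : p ∈ segment ℝ (L.vertex i (((l + k : ℕ) : ℤ) : ZMod (L.len i)))
          (L.vertex i (((l + k : ℕ) : ℤ) + 1)) := by
        convert hpl using 2
        · simp
        · push_cast; rw [add_right_comm]
      rw [segment_eq_image'] at h2
      obtain ⟨ν, hν, he⟩ := h2
      -- A second edge through `p` would give two parameters of the same point whose difference lies
      -- strictly between zero and one period.
      have h3 : L.curve i ((k : ℤ) + μ) = L.curve i (((l + k : ℕ) : ℤ) + ν) := by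
        rw [← hcurve, L.curve_int_add i _ hν.1 hν.2, ← he]
      obtain ⟨-, q, hq⟩ := L.curve_inj h3
      push_cast at hq
      have h4 : (q : ℝ) * L.len i < 0 := by
        have : (1 : ℝ) ≤ l := by exact_mod_cast hl0
        linarith [hν.1]
      have h5 : -(L.len i : ℝ) < q * L.len i := by
        have : (l : ℝ) + 1 ≤ L.len i := by exact_mod_cast hl
        linarith [hν.2]
      have hpos : (0 : ℝ) < L.len i := by linarith [L.one_le_len i]
      have h6 : (q : ℝ) < 0 := by nlinarith
      have h7 : (-1 : ℝ) < q := by nlinarith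
      have h8 : q < 0 := by exact_mod_cast h6
      have h9 : -1 < q := by exact_mod_cast h7
      omega)
    (by
      have e : L.vertex i k - p = -μ • d := by rw [hp, neg_smul]; abel
      change csh (L.vertex i k - p) ≠ 0
      rw [e, csh_smul]
      exact smul_ne_zero (neg_ne_zero.2 h0.ne') hcsh)
    (by
      have e : L.vertex i ((1 + k : ℕ) : ZMod (L.len i)) - p = (1 - μ) • d := by
        rw [hp, sub_smul, one_smul]; nth_rw 2 [hd]; push_cast; rw [add_comm (1 : ZMod (L.len i))]; abel
      change csh (L.vertex i ((1 + k : ℕ) : ZMod (L.len i)) - p) ≠ 0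
      rw [e, csh_smul]
      exact smul_ne_zero (sub_pos.2 h1).ne' hcsh)
  refine ⟨fun x => C x * ∏ j ∈ Finset.univ.erase i,
      polyTrace (fun k => L.vertex j (k : ZMod (L.len j))) (L.len j) x, D,
    hC.mul (continuous_finsetProd _ fun _ _ => continuous_polyTrace _ _), hD,
    mul_ne_zero hC0 (Finset.prod_ne_zero_iff.2 fun j hj => polyTrace_ne_zero
      (trace_matProd_spin_ne_zero (Nat.pos_of_neZero _) (by simp) fun l _ hl => ?_)), hD0,
    fun x => ?_⟩
  · have h2 : p ∈ support (L.edges j) := mem_support.2 ⟨_, L.edge_mem j l, by simpa using hl⟩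
    obtain ⟨s, hs⟩ := L.mem_support_edges.1 h2
    exact Finset.ne_of_mem_erase hj (L.curve_inj (hs.symm.trans hcurve)).1
  · have e1 : -(μ • d) - (x - p) = L.vertex i k - x := by rw [hp]; abel
    have e2 : (1 - μ) • d - (x - p) = L.vertex i ((1 + k : ℕ) : ZMod (L.len i)) - x := by
      rw [hp, sub_smul, one_smul]; nth_rw 1 [hd]; push_cast; rw [add_comm (1 : ZMod (L.len i))]; abel
    rw [e1, e2, spinTrace, ← Finset.mul_prod_erase _ _ (Finset.mem_univ i), ← mul_assoc, h x]
    ring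

end PolygonalLink

end MarkedLink

end

/-! ### Odd winding around every edge, and the unmarked representation. -/

noncomputable section

namespace MarkedLink

open Filter Topology unitInterval

/-- A factor with values in the slit plane has a continuous principal logarithm, which returns to
its value along a loop; only the exponential contributes to the winding. -/
lemma winding_eq_of_factor {Y : Type*} [TopologicalSpace Y] {f : Y → ℂ} (hf : Continuous f)
    (h0 : ∀ y, f y ≠ 0) {y : Y} {γ : Path y y} {n : ℤ} {ι : Type*} [Fintype ι] {z : ℂ} (hz : z ≠ 0)
    (h : ι → I → ℂ) (hc : ∀ i, Continuous (h i)) (hs : ∀ i t, h i t ∈ Complex.slitPlane)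
    (h01 : ∀ i, h i 1 = h i 0)
    (hfac : ∀ t : I, f (γ t) = z * (∏ i, h i t) * Complex.exp (n * (2 * Real.pi * Complex.I) * t)) :
    winding hf h0 γ = n := by
  have key : IsLogLift f γ fun t =>
      Complex.log z + (∑ i, Complex.log (h i t)) + n * (2 * Real.pi * Complex.I) * t := by
    refine ⟨?_, fun t => ?_⟩
    · refine (continuous_const.add (continuous_finsetSum _ fun i _ =>
        (hc i).clog (hs i))).add (by fun_prop)
    · rw [Complex.exp_add, Complex.exp_add, Complex.exp_log hz, Complex.exp_sum, hfac]
      congr 2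
      exact Finset.prod_congr rfl fun i _ => Complex.exp_log (Complex.slitPlane_ne_zero (hs i t))
  rw [winding_eq_iff, windingHolonomy_eq hf h0 key]
  simp [h01]

/-- The boundary of an elliptical disc can be shrunk towards the centre. -/
lemma exists_shrink {X : Set E3} {H : Type*} [CommGroup H] (hol : Holonomy (Complement X) H)
    {p u w : E3} (hX : ∀ a b : ℝ, a ^ 2 + b ^ 2 ≤ 1 → p + a • u + b • w ∈ X → a = 0 ∧ b = 0)
    {y : Complement X} {c : Path y y}
    (hc : ∀ t : I, (c t : S3) =
      ((p + Real.cos (2 * Real.pi * t) • u + Real.sin (2 * Real.pi * t) • w : E3) : S3))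
    {r : ℝ} (hr0 : 0 < r) (hr1 : r ≤ 1) :
    ∃ (y' : Complement X) (c' : Path y' y'), (∀ t : I, (c' t : S3) =
      ((p + r • (Real.cos (2 * Real.pi * t) • u + Real.sin (2 * Real.pi * t) • w) : E3) : S3)) ∧
      hol.toFun c' = hol.toFun c := by
  have hpos (τ : I) : 0 < 1 - τ * (1 - r) ∧ 1 - τ * (1 - r) ≤ 1 := by
    have h1 := τ.2.1
    have h2 := τ.2.2
    constructor <;> nlinarith
  let E : I × I → E3 := fun q => p + (1 - (q.2 : ℝ) * (1 - r)) •
    (Real.cos (2 * Real.pi * q.1) • u + Real.sin (2 * Real.pi * q.1) • w)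
  have hE : Continuous E := by fun_prop
  have hmem (q : I × I) : E q ∉ X := fun h => by
    obtain ⟨h1, h2⟩ := hpos q.2
    have h3 := Real.cos_sq_add_sin_sq (2 * Real.pi * q.1)
    simp only [E, smul_add, smul_smul, ← add_assoc] at h
    obtain ⟨h4, h5⟩ := hX _ _ (by rw [mul_pow, mul_pow, ← mul_add, h3, mul_one]; nlinarith) h
    rw [(mul_eq_zero.1 h4).resolve_left h1.ne', (mul_eq_zero.1 h5).resolve_left h1.ne'] at h3
    norm_num at h3
  let K : C(I × I, Complement X) :=
    ⟨fun q => cpt (E q) (hmem q), (OnePoint.continuous_coe.comp hE).subtype_mk _⟩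
  have hper (τ : I) : K (1, τ) = K (0, τ) := by
    refine Subtype.ext (congrArg ((↑) : E3 → S3) ?_)
    simp [E]
  have h0 (s : I) : K (s, 0) = c s := by
    refine Subtype.ext ((congrArg ((↑) : E3 → S3) ?_).trans (hc s).symm)
    simp [E, add_assoc]
  let c' : Path (K (0, 1)) (K (0, 1)) := ⟨⟨fun s => K (s, 1), by fun_prop⟩, rfl, hper 1⟩
  let α : Path y (K (0, 1)) := ⟨⟨fun s => K (0, s), by fun_prop⟩, by
    change K (0, 0) = y
    rw [h0, c.source], rfl⟩
  -- The annulus between the two ellipses is a square with both radial sides equal to `α`. In a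
  -- commutative group these cancel.
  have hsq := hol.map_square K c c' α α h0 (fun _ => rfl) (fun _ => rfl) hper
  refine ⟨_, c', fun t => ?_, ?_⟩
  · change ((E (t, 1) : E3) : S3) = _
    simp [E]
  · rw [mul_comm] at hsq
    exact (mul_left_cancel hsq).symm

namespace PolygonalLink

variable {m : ℕ} {L : PolygonalLink m} {ω : PolygonalArc}

/-- The spin trace winds once around small ellipses around an edge. -/
lemma exists_winding_small (hgp : GeneralPosition L ω) {X : Set E3} {f : Complement X → ℂ}
    (hf : Continuous f) (h0 : ∀ y, f y ≠ 0) (hfL : ∀ y, f y = L.spinTraceS3 y) (i : Fin m) {e : E3 × E3}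
    (he : e ∈ L.edges i) {p u w : E3} (hp : p ∈ openSegment ℝ e.1 e.2)
    (huw : LinearIndependent ℝ ![e.2 - e.1, u, w]) :
    ∃ r : ℝ, 0 < r ∧ r ≤ 1 ∧ ∀ (y : Complement X) (c : Path y y), (∀ t : I, (c t : S3) =
      ((p + r • (Real.cos (2 * Real.pi * t) • u + Real.sin (2 * Real.pi * t) • w) : E3) : S3)) →
      Odd (winding hf h0 c) := by
  obtain ⟨j, rfl⟩ := he
  obtain ⟨k, rfl⟩ := ZMod.natCast_zmod_surjective j
  rw [openSegment_eq_image'] at hp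
  obtain ⟨μ, ⟨hμ0, hμ1⟩, hp⟩ := hp
  dsimp only at hp huw
  obtain ⟨d, hd⟩ : ∃ d, d = L.vertex i (k + 1) - L.vertex i k := ⟨_, rfl⟩
  rw [← hd] at hp huw
  have hcsh : csh d ≠ 0 := by
    have := hgp.csh_vertex_ne i k
    rw [hd, csh_sub, sub_ne_zero]
    push_cast at this
    exact this.symm
  obtain ⟨C, D, hC, hD, hC0, hD0, hfac⟩ := spinTrace_factor hgp i k hμ0 hμ1 hd hp.symm
  have hN := sq_add_sq_pos hcsh
  have hz0 : C p / D p ≠ 0 := div_ne_zero hC0 hD0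
  have ev1 : ∀ᶠ x in 𝓝 p, D x ≠ 0 := hD.continuousAt.eventually_ne hD0
  have ev2 : ∀ᶠ x in 𝓝 p, C x / D x / (C p / D p) ∈ Complex.slitPlane := by
    refine ((hC.continuousAt.div hD.continuousAt hD0).div_const _).eventually_mem
      (Complex.isOpen_slitPlane.mem_nhds ?_)
    change C p / D p / (C p / D p) ∈ _
    rw [div_self hz0]
    exact Complex.one_mem_slitPlane
  have ev3 : ∀ᶠ x in 𝓝 p, 0 < μ * (d 0 ^ 2 + d 1 ^ 2) + (d 0 * (x - p) 0 + d 1 * (x - p) 1) :=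
    ContinuousAt.eventually_lt (by fun_prop) (by fun_prop) (by simp; positivity)
  have ev4 : ∀ᶠ x in 𝓝 p,
      0 < (1 - μ) * (d 0 ^ 2 + d 1 ^ 2) - (d 0 * (x - p) 0 + d 1 * (x - p) 1) :=
    ContinuousAt.eventually_lt (by fun_prop) (by fun_prop) (by
      simpa using mul_pos (sub_pos.2 hμ1) hN)
  obtain ⟨ε, hε, hball⟩ := Metric.eventually_nhds_iff.1 (ev1.and (ev2.and (ev3.and ev4)))
  have hrel (a b r : ℝ) (h : a • u + b • w = r • d) : a = 0 ∧ b = 0 := by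
    have := Fintype.linearIndependent_iff.1 huw ![-r, a, b] (by
      simp only [Fin.sum_univ_three, Matrix.cons_val_zero, Matrix.cons_val_one, Matrix.cons_val]
      rw [add_assoc, h, neg_smul, neg_add_cancel])
    exact ⟨this 1, this 2⟩
  have hΛ (a b : ℝ) (h : overlapLin d (a • u + b • w) = 0) : a = 0 ∧ b = 0 := by
    obtain ⟨r, hr⟩ := exists_of_overlapLin_eq_zero hcsh h
    exact hrel a b r hr
  have hU : overlapLin d u ≠ 0 := fun h => one_ne_zero (hΛ 1 0 (by simpa using h)).1
  -- Divided by the image of `u`, the linear part of the ellipse is `cos + sin · z`. Injectivity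
  -- makes `z` nonreal, and the sign of its imaginary part is the direction `n = ±1` of the winding.
  obtain ⟨z, hz⟩ : ∃ z, z = overlapLin d w / overlapLin d u := ⟨_, rfl⟩
  have hzim : z.im ≠ 0 := fun h => by
    have hzr : z = (z.re : ℂ) := Complex.ext rfl (by simpa using h)
    have h1 : overlapLin d w = z.re * overlapLin d u := by rw [← hzr, hz, div_mul_cancel₀ _ hU]
    refine one_ne_zero (hΛ (-z.re) 1 ?_).2
    rw [overlapLin_add, overlapLin_smul, overlapLin_smul, h1]
    push_cast; ring
  obtain ⟨n, hn, hnz⟩ : ∃ n : ℤ, (n = 1 ∨ n = -1) ∧ 0 < (n : ℝ) * z.im := by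
    rcases hzim.lt_or_gt with h | h
    · exact ⟨-1, Or.inr rfl, by push_cast; linarith⟩
    · exact ⟨1, Or.inl rfl, by push_cast; linarith⟩
  have hnn : (n : ℝ) * n = 1 := by rcases hn with rfl | rfl <;> norm_num
  obtain ⟨r, hr0, hr1, hrε⟩ : ∃ r : ℝ, 0 < r ∧ r ≤ 1 ∧ r * (‖u‖ + ‖w‖) < ε := by
    refine ⟨min 1 (ε / (‖u‖ + ‖w‖ + 1)), by positivity, min_le_left _ _, ?_⟩
    have h1 : min 1 (ε / (‖u‖ + ‖w‖ + 1)) * (‖u‖ + ‖w‖ + 1) ≤ ε := by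
      rw [← le_div_iff₀ (by positivity)]; exact min_le_right _ _
    have h2 : 0 < min 1 (ε / (‖u‖ + ‖w‖ + 1)) := by positivity
    linarith
  refine ⟨r, hr0, hr1, fun y c hc => ?_⟩
  set Q : I → E3 := fun t => Real.cos (2 * Real.pi * t) • u + Real.sin (2 * Real.pi * t) • w with hQ
  have hQc : Continuous Q := by fun_prop
  have hQ01 : Q 1 = Q 0 := by simp [hQ]
  have hgood (t : I) := hball (y := p + r • Q t) (by
    rw [dist_eq_norm, add_sub_cancel_left, norm_smul, Real.norm_of_nonneg hr0.le]
    refine lt_of_le_of_lt (mul_le_mul_of_nonneg_left ((norm_add_le _ _).trans ?_) hr0.le) hrε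
    rw [norm_smul, norm_smul]
    exact add_le_add (mul_le_of_le_one_left (norm_nonneg _) (Real.abs_cos_le_one _))
      (mul_le_of_le_one_left (norm_nonneg _) (Real.abs_sin_le_one _)))
  simp only [add_sub_cancel_left] at hgood
  have hlin (t : I) : overlapLin d (r • Q t) = r * overlapLin d u *
      (Real.cos (2 * Real.pi * t) + Real.sin (2 * Real.pi * t) * z) := by
    rw [overlapLin_smul, hQ, overlapLin_add, overlapLin_smul, overlapLin_smul, hz]
    field_simp
  have hlin0 (t : I) : overlapLin d (r • Q t) ≠ 0 := by
    rw [overlapLin_smul]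
    refine mul_ne_zero (by exact_mod_cast hr0.ne') fun h => ?_
    obtain ⟨h1, h2⟩ := hΛ _ _ h
    have := Real.cos_sq_add_sin_sq (2 * Real.pi * t)
    rw [h1, h2] at this
    norm_num at this
  have hovc : Continuous fun t : I => overlap (-(μ • d) - r • Q t) ((1 - μ) • d - r • Q t) :=
    Continuous.dotProduct (continuous_spinor.comp (by fun_prop)).star
      (continuous_spinor.comp (by fun_prop))
  -- Three corrections stay in the slit plane: the variation of `C / D` around `p`, the quotient of
  -- the overlap by its linear part, and the quotient of the ellipse by the circle. What is left is
  -- a constant times `exp (2π i n t)`.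
  have hwind : winding hf h0 c = n := by
    refine winding_eq_of_factor hf h0 (z := C p / D p * (r * overlapLin d u))
      (mul_ne_zero hz0 (mul_ne_zero (by exact_mod_cast hr0.ne') hU))
      (fun (s : Fin 3) => ![fun t => C (p + r • Q t) / D (p + r • Q t) / (C p / D p),
        fun t => overlap (-(μ • d) - r • Q t) ((1 - μ) • d - r • Q t) / overlapLin d (r • Q t),
        fun t => (Real.cos (2 * Real.pi * t) + Real.sin (2 * Real.pi * t) * z) /
          Complex.exp ((n : ℝ) * (2 * Real.pi * t : ℝ) * Complex.I)] s) ?_ ?_ ?_ ?_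
    · intro s
      fin_cases s
      · exact ((hC.comp (by fun_prop)).div (hD.comp (by fun_prop)) fun t => (hgood t).1).div_const _
      · exact hovc.div ((continuous_overlapLin d).comp (by fun_prop)) hlin0
      · exact Continuous.div (by fun_prop) (by fun_prop) fun t => Complex.exp_ne_zero _
    · intro s t
      obtain ⟨-, g2, g3, g4⟩ := hgood t
      fin_cases s
      · exact g2
      · exact overlap_div_mem_slitPlane g3 g4 (hlin0 t)
      · exact ellipse_div_mem_slitPlane hnn hnz _
    · intro s
      fin_cases s
      · simp [hQ01]
      · simp [hQ01]
      · have h1 : Complex.exp ((n : ℝ) * (2 * Real.pi : ℝ) * Complex.I) = 1 :=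
          Complex.exp_eq_one_iff.2 ⟨n, by push_cast; ring⟩
        simpa using h1
    · intro t
      have g1 := (hgood t).1
      have hx := hfac (p + r • Q t)
      rw [add_sub_cancel_left] at hx
      have hexp : Complex.exp (n * (2 * Real.pi * Complex.I) * t) =
          Complex.exp ((n : ℝ) * (2 * Real.pi * t : ℝ) * Complex.I) := by
        congr 1; push_cast; ring
      have hF : f (c t) = L.spinTrace (p + r • Q t) := by
        rw [hfL, hc t, L.spinTraceS3_coe]
      have e1 : L.spinTrace (p + r • Q t) = C (p + r • Q t) / D (p + r • Q t) *
          overlap (-(μ • d) - r • Q t) ((1 - μ) • d - r • Q t) := by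
        rw [div_mul_eq_mul_div, eq_div_iff g1, ← hx, mul_comm]
      have hne := Complex.exp_ne_zero ((n : ℝ) * (2 * Real.pi * t : ℝ) * Complex.I)
      have h2 := hlin0 t
      have h3 := hlin t
      rw [hF, e1, hexp, Fin.prod_univ_three]
      simp only [Matrix.cons_val_zero, Matrix.cons_val_one, Matrix.cons_val]
      calc _ = C (p + r • Q t) / D (p + r • Q t) / (C p / D p) * (C p / D p) *
            (overlap (-(μ • d) - r • Q t) ((1 - μ) • d - r • Q t) / overlapLin d (r • Q t) *
              overlapLin d (r • Q t)) := by
            rw [div_mul_cancel₀ _ hz0, div_mul_cancel₀ _ h2]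
        _ = C (p + r • Q t) / D (p + r • Q t) / (C p / D p) * (C p / D p) *
            (overlap (-(μ • d) - r • Q t) ((1 - μ) • d - r • Q t) / overlapLin d (r • Q t) *
              (r * overlapLin d u * ((Real.cos (2 * Real.pi * t) + Real.sin (2 * Real.pi * t) * z) /
          Complex.exp ((n : ℝ) * (2 * Real.pi * t : ℝ) * Complex.I) *
          Complex.exp ((n : ℝ) * (2 * Real.pi * t : ℝ) * Complex.I)))) := by
            rw [div_mul_cancel₀ _ hne, ← h3]
        _ = _ := by ring
  rw [hwind]
  rcases hn with rfl | rfl <;> decide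

end PolygonalLink

/-- Sending every meridian to `J` or `J⁻¹` gives an unmarked representation. -/
theorem nonempty_RB {m : ℕ} {L : PolygonalLink m} {ω : PolygonalArc} (hgp : GeneralPosition L ω)
    (x₀ : Complement (L.carrier ∪ support ∅)) : Nonempty (RB L ∅ x₀) := by
  let f : Complement (L.carrier ∪ support ∅) → ℂ := fun y => L.spinTraceS3 y
  have hf : Continuous f := L.spinTraceS3.continuous.comp continuous_subtype_val
  have h0 (y) : f y ≠ 0 := L.spinTraceS3_ne_zero fun h =>
    y.2 (Set.image_mono Set.subset_union_left h)
  refine ⟨Quotient.mk _ ⟨windingHom hf h0 unitJ x₀, fun i g hg => ?_, fun g hg => ?_⟩⟩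
  · obtain ⟨e, he, p, hp, u, w, huw, hX, y, c, δ, hc, rfl⟩ := hg
    rw [windingHom_fromPath, winding_conj]
    -- The disc of a meridian may be large, while the local computation holds only near the edge.
    -- Since the disc meets the link only in its centre, its boundary is first shrunk.
    obtain ⟨r, hr0, hr1, hr⟩ :=
      PolygonalLink.exists_winding_small hgp hf h0 (fun _ => rfl) i he hp huw
    obtain ⟨y', c', hc', hcc⟩ := exists_shrink (windingHolonomy hf h0) hX hc hr0 hr1
    refine unitJ_zpow_mem ?_
    rw [(winding_eq_iff hf h0).2 (hcc.symm.trans ((winding_eq_iff hf h0).1 rfl))]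
    exact hr y' c' hc'
  · obtain ⟨e, he, -⟩ := hg
    exact absurd he (Set.notMem_empty e)

end MarkedLink

end

theorem mainTheorem8 (L : MarkedLink.PolygonalLink 2) (ω : MarkedLink.PolygonalArc)
    (i j : Fin 2) (hij : i ≠ j) (hω : ω.Joins L i j)
    (hgp : MarkedLink.GeneralPosition L ω)
    (lab : L.ArcLabelling) (a : lab.Arc) (hdet : lab.det a = 0) :
    (∀ x₀ : MarkedLink.Complement (L.carrier ∪ MarkedLink.support ω.edges),
        IsEmpty (MarkedLink.RB L ω.edges x₀)) ∧
      (∀ x₀ : MarkedLink.Complement (L.carrier ∪ MarkedLink.support ∅),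
        Nonempty (MarkedLink.RB L ∅ x₀)) := by
  exact ⟨fun x₀ => MarkedLink.isEmpty_RB hij hω hgp lab a hdet x₀,
    fun x₀ => MarkedLink.nonempty_RB hgp x₀⟩
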